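/- **Setting.** For integers $n,p\ge1$ let $X$ be a deterministic real $n\times p$ matrix with columns $X_{\cdot,1},\dots,X_{\cdot,p}$ and $\|X\|=\max_i\|X_{\cdot,i}\|_2$. We observe $Y=X\beta^0+\varepsilon$ with $\varepsilon\sim N(0,I_n)$; $\mathbb E_{\beta^0}$ is the corresponding expectation. For $\beta\in\mathbb R^p$ write $S_\beta=\{i:\beta_i\ne0\}$, and $S_0=S_{\beta^0}$. The prior $\Pi$ on $\beta$ draws a dimension $s\in\{0,\dots,p\}$ from a probability distribution $\pi_p$, then a uniformly random set $S\subset\{1,\dots,p\}$ with $|S|=s$, and then sets $\beta_i=0$ for $i\notin S$ and draws $(\beta_i)_{i\in S}$ independently from the Laplace density $x\mapsto\frac{\lambda}{2}e^{-\lambda|x|}$, $\lambda>0$. The posterior distribution is $$\Pi(B\mid Y)=\int_B e^{-\|Y-X\beta\|_2^2/2}\,d\Pi(\beta)\Big/\int e^{-\|Y-X\beta\|_2^2/2}\,d\Pi(\beta).$$ Put $\overline\lambda=2\|X\|\sqrt{\log p}$ and, with $\inf\emptyset=\infty$, $$\phi(S)=\inf\Big\{\tfrac{\|X\beta\|_2|S|^{1/2}}{\|X\|\,\|\beta_S\|_1}:\|\beta_{S^c}\|_1\le7\|\beta_S\|_1,\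 \beta_S\ne0\Big\},$$ $$\overline\phi(s)=\inf\Big\{\tfrac{\|X\beta\|_2|S_\beta|^{1/2}}{\|X\|\,\|\beta\|_1}:0\ne|S_\beta|\le s\Big\},\qquad \widetilde\phi(s)=\inf\Big\{\tfrac{\|X\beta\|_2}{\|X\|\,\|\beta\|_2}:0\ne|S_\beta|\le s\Big\},$$ $$\mathrm{mc}(X)=\max_{i\ne j}\frac{|\langle X_{\cdot,i},X_{\cdot,j}\rangle|}{\|X_{\cdot,i}\|_2\|X_{\cdot,j}\|_2}.$$ Fix constants $A_1,A_2,A_3,A_4>0$ and set $$\overline\psi(S)=\overline\phi\Big(\big(2+\tfrac3{A_4}+\tfrac{33}{\phi(S)^2}\tfrac{\lambda}{\overline\lambda}\big)|S|\Big),\qquad \widetilde\psi(S)=\widetilde\phi\Big(\big(2+\tfrac3{A_4}+\tfrac{33}{\phi(S)^2}\tfrac{\lambda}{\overline\lambda}\big)|S|\Big).$$ A threshold below with a zero index ($\phi$, $\overline\psi$ or $\widetilde\psi$) in its denominator is read as $\infty$, and one with an infinite index (the case $S_0=\emptyset$) as $0$. **Theorem (Recovery).** Consider sequences of such problems $(n,p,X,\lambda,\pi_p)$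 with $p\to\infty$, such that $\|X\|/p\le\lambda\le2\overline\lambda$ and $A_1p^{-A_3}\pi_p(s-1)\le\pi_p(s)\le A_2p^{-A_4}\pi_p(s-1)$ for $s=1,\dots,p$. (a) There is $M_0$, depending only on $A_1,\dots,A_4$, such that for every $M\ge M_0$ and every such sequence $$\sup_{\beta^0\in\mathbb R^p}\mathbb E_{\beta^0}\Pi\Big(\beta:\|X(\beta-\beta^0)\|_2>\frac{M}{\overline\psi(S_0)}\frac{\sqrt{|S_0|\log p}}{\phi(S_0)}\,\Big|\,Y\Big)\to0,$$ $$\sup_{\beta^0\in\mathbb R^p}\mathbb E_{\beta^0}\Pi\Big(\beta:\|\beta-\beta^0\|_1>\frac{M}{\overline\psi(S_0)^2}\frac{|S_0|\sqrt{\log p}}{\|X\|\phi(S_0)^2}\,\Big|\,Y\Big)\to0,$$ $$\sup_{\beta^0\in\mathbb R^p}\mathbb E_{\beta^0}\Pi\Big(\beta:\|\beta-\beta^0\|_2>\frac{M}{\widetilde\psi(S_0)^2}\frac{\sqrt{|S_0|\log p}}{\|X\|\phi(S_0)}\,\Big|\,Y\Big)\to0.$$ (b) For every $c_0>0$ and every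 $d_0<c_0^2(1+2/A_4)^{-1}/8$ there is $M_0$, depending only on $A_1,\dots,A_4,c_0,d_0$, such that for every $M\ge M_0$, every such sequence of problems and every real sequence $s_n$ with $\lambda s_n\sqrt{\log p}/\|X\|\to0$, $$\sup_{\substack{\beta^0:\ \phi(S_0)\ge c_0,\ \widetilde\psi(S_0)\ge c_0,\\ |S_0|\le s_n,\ |S_0|\le d_0\,\mathrm{mc}(X)^{-1}}}\mathbb E_{\beta^0}\Pi\Big(\beta:\|\beta-\beta^0\|_\infty>\frac{M\sqrt{\log p}}{\|X\|}\,\Big|\,Y\Big)\to0$$ (with $\mathrm{mc}(X)^{-1}=\infty$ if $\mathrm{mc}(X)=0$; a supremum over the empty set is $0$). -/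

import Mathlib

open MeasureTheory ProbabilityTheory Filter Topology
open scoped ENNReal Matrix

noncomputable section

namespace SparseRegression

/-- The `ℓ^q` norm of a real vector. -/
def lqNorm {ι : Type} [Fintype ι] (q : ℝ≥0∞) (v : ι → ℝ) : ℝ := ‖WithLp.toLp q v‖

/-- The support `S_β = {i : β i ≠ 0}`. -/
def supp {p : ℕ} (β : Fin p → ℝ) : Finset (Fin p) := Finset.univ.filter fun i => β i ≠ 0

/-- `‖X‖`, the largest Euclidean norm of a column of `X`. -/
def colNorm {n p : ℕ} (X : Matrix (Fin n) (Fin p) ℝ) : ℝ := ⨆ i : Fin p, lqNorm 2 (Xᵀ i)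

/-- `2 ‖X‖ √(log p)`. -/
def lamBar {n p : ℕ} (X : Matrix (Fin n) (Fin p) ℝ) : ℝ := 2 * colNorm X * √(Real.log p)

/-! ### Design indices

They take values in `[0, ∞]`, so that the infimum over the empty set is `∞`. -/

/-- The compatibility number `φ(S)` of a model `S`. -/
def compat {n p : ℕ} (X : Matrix (Fin n) (Fin p) ℝ) (S : Finset (Fin p)) : ℝ≥0∞ :=
  ⨅ (β : Fin p → ℝ) (_ : lqNorm 1 (Sᶜ.restrict β) ≤ 7 * lqNorm 1 (S.restrict β))
    (_ : S.restrict β ≠ 0),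
    ENNReal.ofReal (lqNorm 2 (X *ᵥ β) * √(S.card : ℝ) / (colNorm X * lqNorm 1 (S.restrict β)))

/-- The uniform compatibility number over vectors with at most `s` nonzero coordinates. -/
def unifCompat {n p : ℕ} (X : Matrix (Fin n) (Fin p) ℝ) (s : ℝ≥0∞) : ℝ≥0∞ :=
  ⨅ (β : Fin p → ℝ) (_ : (supp β).card ≠ 0) (_ : ((supp β).card : ℝ≥0∞) ≤ s),
    ENNReal.ofReal (lqNorm 2 (X *ᵥ β) * √((supp β).card : ℝ) / (colNorm X * lqNorm 1 β))

/-- The smallest scaled singular value over vectors with at most `s` nonzero coordinates. -/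
def sparseSingular {n p : ℕ} (X : Matrix (Fin n) (Fin p) ℝ) (s : ℝ≥0∞) : ℝ≥0∞ :=
  ⨅ (β : Fin p → ℝ) (_ : (supp β).card ≠ 0) (_ : ((supp β).card : ℝ≥0∞) ≤ s),
    ENNReal.ofReal (lqNorm 2 (X *ᵥ β) / (colNorm X * lqNorm 2 β))

/-- The mutual coherence number, the largest absolute correlation between two columns. -/
def mutualCoherence {n p : ℕ} (X : Matrix (Fin n) (Fin p) ℝ) : ℝ≥0∞ :=
  ⨆ (i : Fin p) (j : Fin p) (_ : i ≠ j),
    ENNReal.ofReal (|Xᵀ i ⬝ᵥ Xᵀ j| / (lqNorm 2 (Xᵀ i) * lqNorm 2 (Xᵀ j)))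

/-- The dimension `(2 + 3 / A₄ + (33 / φ(S)²) (lam / lamBar)) |S|`. -/
def psiDim {n p : ℕ} (A₄ : ℝ) (X : Matrix (Fin n) (Fin p) ℝ) (lam : ℝ) (S : Finset (Fin p)) :
    ℝ≥0∞ :=
  (2 + 3 / ENNReal.ofReal A₄ + 33 / compat X S ^ 2 * ENNReal.ofReal (lam / lamBar X)) * S.card

/-- The number `ψ̄(S)`. -/
def psiBar {n p : ℕ} (A₄ : ℝ) (X : Matrix (Fin n) (Fin p) ℝ) (lam : ℝ) (S : Finset (Fin p)) :
    ℝ≥0∞ :=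
  unifCompat X (psiDim A₄ X lam S)

/-- The number `ψ̃(S)`. -/
def psiTilde {n p : ℕ} (A₄ : ℝ) (X : Matrix (Fin n) (Fin p) ℝ) (lam : ℝ) (S : Finset (Fin p)) :
    ℝ≥0∞ :=
  sparseSingular X (psiDim A₄ X lam S)

/-! ### Prior, model and posterior -/

/-- The Laplace distribution on `ℝ` with density `(lam / 2) exp (- lam |x|)`. -/
def laplace (lam : ℝ) : Measure ℝ :=
  volume.withDensity fun x => ENNReal.ofReal (lam / 2 * Real.exp (-lam * |x|))

/-- The law of `β` given the model `S`: independent coordinates, Laplace on `S` and zero off `S`. -/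
def slab {p : ℕ} (lam : ℝ) (S : Finset (Fin p)) : Measure (Fin p → ℝ) :=
  Measure.pi fun i => if i ∈ S then laplace lam else Measure.dirac 0

/-- The prior on `β`: a dimension from `w`, a uniformly distributed model `S` of that dimension,
and Laplace coordinates on `S`. -/
def prior (p : ℕ) (w : ℕ → ℝ) (lam : ℝ) : Measure (Fin p → ℝ) :=
  ∑ S : Finset (Fin p), ENNReal.ofReal (w S.card / (p.choose S.card : ℝ)) • slab lam S

/-- The law `N(X β, I)` of the data. -/
def dataLaw {n p : ℕ} (X : Matrix (Fin n) (Fin p) ℝ) (β : Fin p → ℝ) : Measure (Fin n → ℝ) :=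
  Measure.pi fun i => gaussianReal ((X *ᵥ β) i) 1

/-- The Gaussian likelihood, up to its normalizing constant. -/
def likelihood {n p : ℕ} (X : Matrix (Fin n) (Fin p) ℝ) (y : Fin n → ℝ) (β : Fin p → ℝ) : ℝ≥0∞ :=
  ENNReal.ofReal (Real.exp (-(lqNorm 2 (y - X *ᵥ β)) ^ 2 / 2))

/-- The posterior distribution given the data `y`, by Bayes's formula. -/
def posterior {n p : ℕ} (X : Matrix (Fin n) (Fin p) ℝ) (Q : Measure (Fin p → ℝ)) (y : Fin n → ℝ) :
    Measure (Fin p → ℝ) :=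
  (∫⁻ β, likelihood X y β ∂Q)⁻¹ • Q.withDensity (likelihood X y)

/-- The expectation under `β⁰` of the posterior probability of the set `B`. -/
def expectedPosterior {n p : ℕ} (X : Matrix (Fin n) (Fin p) ℝ) (Q : Measure (Fin p → ℝ))
    (β₀ : Fin p → ℝ) (B : Set (Fin p → ℝ)) : ℝ≥0∞ :=
  ∫⁻ y, posterior X Q y B ∂(dataLaw X β₀)

/-- `w` is a probability distribution on `{0, …, p}`, with weights that decrease exponentially
with the dimension. -/
structure DimensionPrior (A₁ A₂ A₃ A₄ : ℝ) (p : ℕ) (w : ℕ → ℝ) : Prop where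
  nonneg : ∀ s ≤ p, 0 ≤ w s
  sum_eq_one : ∑ s ∈ Finset.range (p + 1), w s = 1
  lower : ∀ s ∈ Finset.Icc 1 p, A₁ * (p : ℝ) ^ (-A₃) * w (s - 1) ≤ w s
  upper : ∀ s ∈ Finset.Icc 1 p, w s ≤ A₂ * (p : ℝ) ^ (-A₄) * w (s - 1)

/-- A sequence of regression problems `Y = X β + ε`, with `p` tending to infinity, together with
prior parameters in the admissible range. -/
structure Experiments (A₁ A₂ A₃ A₄ : ℝ) where
  n : ℕ → ℕ
  p : ℕ → ℕ
  X : ∀ k, Matrix (Fin (n k)) (Fin (p k)) ℝ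
  lam : ℕ → ℝ
  w : ℕ → ℕ → ℝ
  p_tendsto : Tendsto p atTop atTop
  lam_pos : ∀ k, 0 < lam k
  le_lam : ∀ k, colNorm (X k) / p k ≤ lam k
  lam_le : ∀ k, lam k ≤ 2 * lamBar (X k)
  dimensionPrior : ∀ k, DimensionPrior A₁ A₂ A₃ A₄ (p k) (w k)

namespace Experiments

variable {A₁ A₂ A₃ A₄ : ℝ} (E : Experiments A₁ A₂ A₃ A₄) (k : ℕ)

/-- `E_{β⁰} Π(B | Y)` in the `k`-th problem. -/
def risk (β₀ : Fin (E.p k) → ℝ) (B : Set (Fin (E.p k) → ℝ)) : ℝ≥0∞ :=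
  expectedPosterior (E.X k) (prior (E.p k) (E.w k) (E.lam k)) β₀ B

/-- `φ(S)` in the `k`-th problem. -/
def phi (S : Finset (Fin (E.p k))) : ℝ≥0∞ := compat (E.X k) S

/-- `ψ̄(S)` in the `k`-th problem. -/
def psiBar (S : Finset (Fin (E.p k))) : ℝ≥0∞ := SparseRegression.psiBar A₄ (E.X k) (E.lam k) S

/-- `ψ̃(S)` in the `k`-th problem. -/
def psiTilde (S : Finset (Fin (E.p k))) : ℝ≥0∞ := SparseRegression.psiTilde A₄ (E.X k) (E.lam k) S

/-- `log p` in the `k`-th problem. -/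
def logp : ℝ := Real.log (E.p k)

end Experiments

end SparseRegression

end

noncomputable section

namespace SparseRegression

/-! ### Norms -/

section Norms

variable {ι : Type} [Fintype ι]

/-! Everything rests on one non-asymptotic estimate, `expectedPosterior_le_master`, for the expected
posterior mass of a set `B`. The posterior is a ratio of integrals of the likelihood ratio Λ of β
against β₀. Its denominator is bounded below for every data vector. Keep only the model supp β₀ and
a small box around β₀: averaging Λ over a point and its reflection in β₀ turns the noise term into a
cosh, which is at least 1 (`le_lintegral_likRatio`).

For the numerator, `exists_noise_event` provides an event T of probability at least 1 - 1/p on which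
⟨Xβ, ε⟩ ≤ ‖Xβ‖²/4 + 12|U| log p for all β supported on U, simultaneously in U. On T the noise
exponent is split in proportions θ and 1 - θ. The first part is bounded by the event and the second
is integrated exactly. This yields the decay exp(-θ‖X(β-β₀)‖²/4) at the price p^(12θ) per coordinate
of |S| + |S₀|. With θ = `splitExp A₄` small, this price is negligible against the prior decay
p^(-A₄). Compatibility (`CompatBound.le_add`) then trades part of the quadratic decay for ℓ¹ decay
around β₀, after which the Laplace integrals are explicit and a geometric sum over dimensions
remains.

The estimate gives concentration in prediction norm always, in ℓ¹ norm when λ/λ̄ is bounded below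
(the penalty itself controls the ℓ¹ distance), and in dimension when λ/λ̄ is below a constant. For
small λ/λ̄ the difference β - β₀ is therefore sparse, and the sparse design indices convert
prediction error into ℓ¹ and ℓ² error. For large λ/λ̄ the ℓ² bound needs another argument:
`sparse_lower_bound_transfer` extends the sparse singular value bound to all vectors up to an ℓ¹
term, by Maurey's empirical method, and that term is controlled by the ℓ¹ recovery.

For the supremum norm, a pair of models S and S ∪ {i} is compared with all coordinates but the i-th
frozen. The conditional posterior is then a one-dimensional spike and slab problem, and it forces
|⟨X_i, y - Xβ⟩| to be of order ‖X‖√(log p), whatever the data (`posterior_residual_le`). Small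
coherence together with the ℓ¹ bound decouples the coordinates and turns this into a bound on each
of them (`sq_mul_abs_le_residual`, `Admissible.recovery_sup`). -/

theorem lqNorm_nonneg (q : ℝ≥0∞) [Fact (1 ≤ q)] (v : ι → ℝ) : 0 ≤ lqNorm q v :=
  norm_nonneg _

theorem lqNorm_one (v : ι → ℝ) : lqNorm 1 v = ∑ i, |v i| := by
  rw [lqNorm, PiLp.norm_eq_of_L1]
  simp

theorem lqNorm_two_sq (v : ι → ℝ) : lqNorm 2 v ^ 2 = v ⬝ᵥ v := by
  rw [lqNorm, EuclideanSpace.norm_sq_eq]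
  simp [dotProduct, pow_two]

theorem lqNorm_two_sq' (v : ι → ℝ) : lqNorm 2 v ^ 2 = ∑ i, v i ^ 2 := by
  rw [lqNorm_two_sq]
  simp [dotProduct, pow_two]

theorem exists_lt_of_lt_lqNorm_top {v : ι → ℝ} {a : ℝ} (ha : 0 ≤ a) (h : a < lqNorm ∞ v) :
    ∃ i, a < |v i| := by
  by_contra! hc
  have : lqNorm ∞ v ≤ a := by
    rw [lqNorm, PiLp.norm_eq_ciSup]
    exact Real.iSup_le (fun i => by simpa using hc i) ha
  linarith

theorem dotProduct_le_lqNorm (v w : ι → ℝ) : |v ⬝ᵥ w| ≤ lqNorm 2 v * lqNorm 2 w := by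
  have := abs_real_inner_le_norm (WithLp.toLp 2 w) (WithLp.toLp 2 v)
  rw [EuclideanSpace.inner_eq_star_dotProduct] at this
  simpa [lqNorm, mul_comm] using this

theorem lqNorm_one_le_sqrt_card_mul (v : ι → ℝ) (s : Finset ι) (hs : ∀ i ∉ s, v i = 0) :
    lqNorm 1 v ≤ √(s.card : ℝ) * lqNorm 2 v := by
  rw [lqNorm_one]
  have h1 : ∑ i, |v i| = ∑ i ∈ s, |v i| :=
    (Finset.sum_subset (Finset.subset_univ s) fun i _ hi => by simp [hs i hi]).symm
  rw [h1]
  refine abs_le_of_sq_le_sq' ?_ (mul_nonneg (Real.sqrt_nonneg _) (lqNorm_nonneg 2 v)) |>.2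
  rw [mul_pow, Real.sq_sqrt (Nat.cast_nonneg _), lqNorm_two_sq']
  calc (∑ i ∈ s, |v i|) ^ 2 ≤ s.card * ∑ i ∈ s, |v i| ^ 2 := sq_sum_le_card_mul_sum_sq
    _ ≤ s.card * ∑ i, v i ^ 2 := by
        gcongr
        simp only [sq_abs]
        exact Finset.sum_le_sum_of_subset_of_nonneg (Finset.subset_univ s)
          fun i _ _ => sq_nonneg _

end Norms

/-! ### Elementary bounds for the design matrix. -/

section Design

variable {n p : ℕ} (X : Matrix (Fin n) (Fin p) ℝ)

theorem col_le_colNorm (i : Fin p) : lqNorm 2 (Xᵀ i) ≤ colNorm X :=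
  le_ciSup (f := fun i : Fin p => lqNorm 2 (Xᵀ i)) (Set.finite_range _).bddAbove i

theorem colNorm_nonneg : 0 ≤ colNorm X := Real.iSup_nonneg fun i => lqNorm_nonneg 2 (Xᵀ i)

theorem mulVec_eq_sum_smul_col (β : Fin p → ℝ) : X *ᵥ β = ∑ i, β i • Xᵀ i := by
  ext k
  simp [Matrix.mulVec, dotProduct, mul_comm]

theorem lqNorm_mulVec_le (β : Fin p → ℝ) : lqNorm 2 (X *ᵥ β) ≤ colNorm X * lqNorm 1 β := by
  rw [mulVec_eq_sum_smul_col, lqNorm_one, Finset.mul_sum, lqNorm, WithLp.toLp_sum]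
  refine (norm_sum_le _ _).trans (Finset.sum_le_sum fun i _ => ?_)
  rw [WithLp.toLp_smul, norm_smul, Real.norm_eq_abs, mul_comm]
  gcongr
  exact col_le_colNorm X i

end Design

/-! ### Product measures -/

section Product

variable {ι : Type} [Fintype ι] {E : ι → Type} [∀ i, MeasurableSpace (E i)]

theorem lintegral_pi_prod (μ : ∀ i, Measure (E i)) [∀ i, SigmaFinite (μ i)]
    {f : ∀ i, E i → ℝ≥0∞} (hf : ∀ i, Measurable (f i)) :
    ∫⁻ x, ∏ i, f i (x i) ∂Measure.pi μ = ∏ i, ∫⁻ t, f i t ∂μ i := by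
  classical
  by_cases hne : Nonempty (∀ i, E i)
  · obtain ⟨x₀⟩ := hne
    -- Tonelli one coordinate at a time. The base point `x₀` is needed only to evaluate the full
    -- marginal, hence the separate treatment of an empty product space.
    have key : ∀ s : Finset ι, ∀ x, (∫⋯∫⁻_s, (fun x => ∏ i ∈ s, f i (x i)) ∂μ) x
        = ∏ i ∈ s, ∫⁻ t, f i t ∂μ i := by
      intro s
      induction s using Finset.induction_on with
      | empty => intro x; simp
      | insert i s hi ih =>
        intro x
        have hm : ∀ s : Finset ι, Measurable fun x : (∀ i, E i) => ∏ i ∈ s, f i (x i) :=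
          fun s => Finset.measurable_prod _ fun i _ => (hf i).comp (measurable_pi_apply i)
        rw [lmarginal_insert' _ (hm _) hi]
        have : (fun x : (∀ i, E i) => ∫⁻ t, ∏ j ∈ insert i s, f j (Function.update x i t j) ∂μ i)
            = fun x => (∫⁻ t, f i t ∂μ i) * ∏ j ∈ s, f j (x j) := by
          ext x
          rw [← lintegral_mul_const _ (hf i)]
          refine lintegral_congr fun t => ?_
          rw [Finset.prod_insert hi, Function.update_self]
          congr 1
          refine Finset.prod_congr rfl fun j hj => ?_
          rw [Function.update_of_ne (by rintro rfl; exact hi hj)]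
        rw [this, Finset.prod_insert hi, ← ih x]
        simp only [lmarginal]
        rw [lintegral_const_mul]
        exact (hm s).comp measurable_updateFinset
    have h := key Finset.univ x₀
    rwa [← lintegral_eq_lmarginal_univ] at h
  · rw [not_nonempty_iff] at hne
    obtain ⟨i, hi⟩ := isEmpty_pi.1 hne
    rw [Measure.eq_zero_of_isEmpty (Measure.pi μ), lintegral_zero_measure]
    refine (Finset.prod_eq_zero (Finset.mem_univ i) ?_).symm
    rw [Measure.eq_zero_of_isEmpty (μ i), lintegral_zero_measure]

theorem pi_withDensity (μ : ∀ i, Measure (E i)) [∀ i, SigmaFinite (μ i)]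
    {f : ∀ i, E i → ℝ≥0∞} (hf : ∀ i, Measurable (f i))
    [∀ i, SigmaFinite ((μ i).withDensity (f i))] :
    Measure.pi (fun i => (μ i).withDensity (f i))
      = (Measure.pi μ).withDensity fun x => ∏ i, f i (x i) := by
  refine Measure.pi_eq fun s hs => ?_
  rw [withDensity_apply _ (MeasurableSet.univ_pi hs), ← lintegral_indicator (.univ_pi hs)]
  have : (fun x => (Set.univ.pi s).indicator (fun x => ∏ i, f i (x i)) x)
      = fun x => ∏ i, (s i).indicator (f i) (x i) := by
    ext x
    by_cases hx : x ∈ Set.univ.pi s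
    · rw [Set.indicator_of_mem hx]
      exact Finset.prod_congr rfl fun i _ => (Set.indicator_of_mem (hx i trivial) _).symm
    · rw [Set.indicator_of_notMem hx]
      simp only [Set.mem_univ_pi, not_forall] at hx
      obtain ⟨i, hi⟩ := hx
      exact (Finset.prod_eq_zero (Finset.mem_univ i) (Set.indicator_of_notMem hi _)).symm
  rw [this, lintegral_pi_prod μ fun i => (hf i).indicator (hs i)]
  refine Finset.prod_congr rfl fun i _ => ?_
  rw [lintegral_indicator (hs i), withDensity_apply _ (hs i)]

end Product

/-! ### Gaussian noise -/

section Gaussian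

theorem lintegral_exp_mul_sub_gaussianReal (m v : ℝ) :
    ∫⁻ x, ENNReal.ofReal (Real.exp (v * (x - m))) ∂gaussianReal m 1
      = ENNReal.ofReal (Real.exp (v ^ 2 / 2)) := by
  have h1 : ∀ x : ℝ, Real.exp (v * (x - m)) = Real.exp (-(v * m)) * Real.exp (v * x) := by
    intro x; rw [← Real.exp_add]; ring_nf
  rw [← ofReal_integral_eq_lintegral_ofReal]
  · congr 1
    simp_rw [h1]
    rw [integral_const_mul]
    have := congrFun (mgf_fun_id_gaussianReal (μ := m) (v := 1)) v
    rw [mgf] at this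
    rw [this, ← Real.exp_add]
    congr 1
    push_cast
    ring
  · simp_rw [h1]
    exact (integrable_exp_mul_gaussianReal v).const_mul _
  · exact Eventually.of_forall fun x => (Real.exp_pos _).le

/-- Linearization of the square: up to the factor √2, exp(x²/4) is a Gaussian mixture over b of the
exponentials exp(bx - b²/2), which have mean one when x is standard normal. -/
theorem lintegral_exp_mul_sub_sq_gaussianReal (x : ℝ) :
    ∫⁻ b, ENNReal.ofReal (Real.exp (b * x - b ^ 2 / 2)) ∂gaussianReal 0 1
      = ENNReal.ofReal (Real.exp (x ^ 2 / 4) / √2) := by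
  rw [gaussianReal_of_var_ne_zero 0 one_ne_zero,
    lintegral_withDensity_eq_lintegral_mul _ (measurable_gaussianPDF 0 1) (by fun_prop)]
  have h1 : ∀ b : ℝ, (gaussianPDF 0 1 * fun b => ENNReal.ofReal (Real.exp (b * x - b ^ 2 / 2))) b
      = ENNReal.ofReal ((√(2 * Real.pi))⁻¹ * Real.exp (x ^ 2 / 4) *
          Real.exp (-1 * (b - x / 2) ^ 2)) := by
    intro b
    simp only [Pi.mul_apply, gaussianPDF, gaussianPDFReal]
    rw [← ENNReal.ofReal_mul (by positivity)]
    congr 1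
    push_cast
    rw [mul_one, mul_assoc, mul_assoc, ← Real.exp_add, ← Real.exp_add]
    congr 2
    ring
  simp_rw [h1]
  rw [← ofReal_integral_eq_lintegral_ofReal]
  · congr 1
    rw [integral_const_mul, integral_sub_right_eq_self (fun b => Real.exp (-1 * b ^ 2)) (x / 2),
      integral_gaussian, Real.sqrt_mul (by norm_num), div_one]
    have : √Real.pi ≠ 0 := (Real.sqrt_pos.2 Real.pi_pos).ne'
    field_simp
  · exact ((integrable_exp_neg_mul_sq one_pos).comp_sub_right (x / 2)).const_mul _
  · exact Eventually.of_forall fun b => by positivity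

variable {n p : ℕ} (X : Matrix (Fin n) (Fin p) ℝ) (β₀ : Fin p → ℝ)

instance : IsProbabilityMeasure (dataLaw X β₀) := by
  unfold dataLaw; infer_instance

theorem lintegral_exp_dotProduct_dataLaw (v : Fin n → ℝ) :
    ∫⁻ y, ENNReal.ofReal (Real.exp (v ⬝ᵥ (y - X *ᵥ β₀))) ∂dataLaw X β₀
      = ENNReal.ofReal (Real.exp (v ⬝ᵥ v / 2)) := by
  have h1 : ∀ y : Fin n → ℝ, ENNReal.ofReal (Real.exp (v ⬝ᵥ (y - X *ᵥ β₀)))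
      = ∏ i, ENNReal.ofReal (Real.exp (v i * (y i - (X *ᵥ β₀) i))) := by
    intro y
    rw [← ENNReal.ofReal_prod_of_nonneg fun i _ => (Real.exp_pos _).le, ← Real.exp_sum]
    rfl
  simp_rw [h1]
  rw [dataLaw, lintegral_pi_prod (fun i => gaussianReal ((X *ᵥ β₀) i) 1)
    (f := fun i x => ENNReal.ofReal (Real.exp (v i * (x - (X *ᵥ β₀) i)))) (by fun_prop)]
  simp_rw [lintegral_exp_mul_sub_gaussianReal]
  rw [← ENNReal.ofReal_prod_of_nonneg fun i _ => (Real.exp_pos _).le, ← Real.exp_sum]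
  simp only [dotProduct, Finset.sum_div, pow_two]

/-- Exponential moment of the squared length of the projection of the noise on the span of
orthonormal vectors. -/
theorem lintegral_exp_sum_sq_dataLaw {r : ℕ} (e : Fin r → Fin n → ℝ)
    (he : ∀ j k, e j ⬝ᵥ e k = if j = k then 1 else 0) :
    ∫⁻ y, ENNReal.ofReal (Real.exp ((∑ j, (e j ⬝ᵥ (y - X *ᵥ β₀)) ^ 2) / 4)) ∂dataLaw X β₀
      = ENNReal.ofReal (√2 ^ r) := by
  set γ : Measure (Fin r → ℝ) := Measure.pi fun _ => gaussianReal 0 1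
  have h1 : ∀ x : Fin r → ℝ, ENNReal.ofReal (Real.exp ((∑ j, x j ^ 2) / 4))
      = ENNReal.ofReal (√2 ^ r) *
        ∫⁻ b, ENNReal.ofReal (Real.exp (∑ j, (b j * x j - b j ^ 2 / 2))) ∂γ := by
    intro x
    simp_rw [Real.exp_sum, ENNReal.ofReal_prod_of_nonneg fun i _ => (Real.exp_pos _).le]
    rw [lintegral_pi_prod (fun _ => gaussianReal 0 1)
      (f := fun j b => ENNReal.ofReal (Real.exp (b * x j - b ^ 2 / 2))) (by fun_prop)]
    simp_rw [lintegral_exp_mul_sub_sq_gaussianReal]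
    rw [← ENNReal.ofReal_prod_of_nonneg fun i _ => by positivity,
      ← ENNReal.ofReal_mul (by positivity), Finset.prod_div_distrib, ← Real.exp_sum]
    congr 1
    simp only [Finset.prod_const, Finset.card_univ, Fintype.card_fin, Finset.sum_div]
    field_simp
  have h2 : ∀ b : Fin r → ℝ, (∑ j, b j • e j) ⬝ᵥ (∑ j, b j • e j) = ∑ j, b j ^ 2 := by
    intro b
    simp only [sum_dotProduct, dotProduct_sum, smul_dotProduct, dotProduct_smul, he, smul_eq_mul]
    simp [pow_two]
  simp_rw [fun y => h1 fun j => e j ⬝ᵥ (y - X *ᵥ β₀)]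
  rw [lintegral_const_mul']
  swap; · exact ENNReal.ofReal_ne_top
  rw [lintegral_lintegral_swap]
  -- After exchanging the integrals, each b contributes a normalized exponential of the linear form
  -- given by ∑ b_j e_j. Orthonormality makes its mean exactly one.
  · have h3 : ∀ b : Fin r → ℝ, ∫⁻ y, ENNReal.ofReal (Real.exp
        (∑ j, (b j * e j ⬝ᵥ (y - X *ᵥ β₀) - b j ^ 2 / 2))) ∂dataLaw X β₀ = 1 := by
      intro b
      have h4 : ∀ y : Fin n → ℝ, ENNReal.ofReal (Real.exp
          (∑ j, (b j * e j ⬝ᵥ (y - X *ᵥ β₀) - b j ^ 2 / 2)))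
          = ENNReal.ofReal (Real.exp (-((∑ j, b j ^ 2) / 2))) *
            ENNReal.ofReal (Real.exp ((∑ j, b j • e j) ⬝ᵥ (y - X *ᵥ β₀))) := by
        intro y
        rw [← ENNReal.ofReal_mul (Real.exp_pos _).le, ← Real.exp_add, sum_dotProduct,
          Finset.sum_sub_distrib, Finset.sum_div]
        simp only [smul_dotProduct, smul_eq_mul]
        congr 2
        ring
      simp_rw [h4]
      rw [lintegral_const_mul' _ _ ENNReal.ofReal_ne_top, lintegral_exp_dotProduct_dataLaw, h2,
        ← ENNReal.ofReal_mul (Real.exp_pos _).le, ← Real.exp_add]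
      simp
    simp_rw [h3]
    simp [γ]
  · refine Measurable.aemeasurable ?_
    refine ENNReal.measurable_ofReal.comp (Real.measurable_exp.comp ?_)
    simp only [dotProduct]
    fun_prop

end Gaussian

/-! ### The Laplace distribution -/

section Laplace

variable {lam : ℝ}

theorem integral_exp_neg_mul_abs {κ : ℝ} (hκ : 0 < κ) :
    ∫ t : ℝ, Real.exp (-κ * |t|) = 2 / κ := by
  rw [integral_comp_abs (f := fun t => Real.exp (-κ * t)),
    integral_exp_mul_Ioi (neg_lt_zero.2 hκ)]
  simp
  ring

theorem integrable_exp_neg_mul_abs {κ : ℝ} (hκ : 0 < κ) :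
    Integrable fun t : ℝ => Real.exp (-κ * |t|) := by
  refine Integrable.of_integral_ne_zero ?_
  rw [integral_exp_neg_mul_abs hκ]
  positivity

theorem lintegral_laplace {f : ℝ → ℝ≥0∞} (hf : Measurable f) :
    ∫⁻ t, f t ∂laplace lam
      = ∫⁻ t, ENNReal.ofReal (lam / 2 * Real.exp (-lam * |t|)) * f t := by
  rw [laplace, lintegral_withDensity_eq_lintegral_mul _ (by fun_prop) hf]
  rfl

/-- The factor exp(λ|t|) removes the Laplace density and leaves an exponential kernel centred at b,
so the value does not depend on b. -/
theorem lintegral_exp_abs_laplace (hlam : 0 < lam) {κ : ℝ} (hκ : 0 < κ) (b : ℝ) :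
    ∫⁻ t, ENNReal.ofReal (Real.exp (lam * |t| - κ * |t - b|)) ∂laplace lam
      = ENNReal.ofReal (lam / κ) := by
  rw [lintegral_laplace (by fun_prop)]
  have h1 : ∀ t : ℝ, ENNReal.ofReal (lam / 2 * Real.exp (-lam * |t|)) *
      ENNReal.ofReal (Real.exp (lam * |t| - κ * |t - b|))
      = ENNReal.ofReal (lam / 2 * Real.exp (-κ * |t - b|)) := by
    intro t
    rw [← ENNReal.ofReal_mul (by positivity), mul_assoc, ← Real.exp_add]
    ring_nf
  simp_rw [h1]
  rw [← ofReal_integral_eq_lintegral_ofReal]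
  · rw [integral_const_mul, integral_sub_right_eq_self (fun t => Real.exp (-κ * |t|)) b,
      integral_exp_neg_mul_abs hκ]
    congr 1
    field_simp
  · exact ((integrable_exp_neg_mul_abs hκ).comp_sub_right b).const_mul _
  · exact Eventually.of_forall fun t => by positivity

instance : SigmaFinite (laplace lam) := by
  unfold laplace; infer_instance

end Laplace

/-! ### The slab -/

section Slab

variable {p : ℕ} (lam : ℝ) (S : Finset (Fin p))

/-- The law of a coordinate under the slab. -/
def slabCoord (i : Fin p) : Measure ℝ := if i ∈ S then laplace lam else Measure.dirac 0

instance (i : Fin p) : SigmaFinite (slabCoord lam S i) := by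
  unfold slabCoord; split_ifs <;> infer_instance

theorem slab_eq_pi : slab lam S = Measure.pi (slabCoord lam S) := rfl

instance : SigmaFinite (slab lam S) := by
  rw [slab_eq_pi]; infer_instance

instance (w : ℕ → ℝ) : SFinite (prior p w lam) := by
  unfold prior
  rw [← Measure.sum_fintype]
  infer_instance

theorem ae_slab_eq_zero : ∀ᵐ β ∂slab lam S, ∀ i ∉ S, β i = 0 := by
  rw [ae_all_iff]
  intro i
  by_cases hi : i ∈ S
  · simp [hi]
  · have h : ∀ᵐ t ∂slabCoord lam S i, t = 0 := by
      rw [slabCoord, if_neg hi]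
      exact (ae_dirac_iff (measurableSet_singleton (0 : ℝ))).2 rfl
    filter_upwards [(Measure.tendsto_eval_ae_ae (μ := slabCoord lam S) (i := i)).eventually h]
      with β hβ _ using hβ

theorem lintegral_prior (w : ℕ → ℝ) (f : (Fin p → ℝ) → ℝ≥0∞) :
    ∫⁻ β, f β ∂prior p w lam = ∑ S : Finset (Fin p),
      ENNReal.ofReal (w S.card / (p.choose S.card : ℝ)) * ∫⁻ β, f β ∂slab lam S := by
  simp [prior, lintegral_smul_measure]

variable {lam}

/-- Equality holds coordinatewise on S. Off S the integrand is evaluated at zero and equals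
exp(-κ|β₀ i|) ≤ 1, which is the only loss. -/
theorem lintegral_exp_abs_slab_le (hlam : 0 < lam) {κ : ℝ} (hκ : 0 < κ) (β₀ : Fin p → ℝ) :
    ∫⁻ β, ENNReal.ofReal (Real.exp (lam * lqNorm 1 β - κ * lqNorm 1 (β - β₀))) ∂slab lam S
      ≤ ENNReal.ofReal ((lam / κ) ^ S.card) := by
  have h1 : ∀ β : Fin p → ℝ,
      ENNReal.ofReal (Real.exp (lam * lqNorm 1 β - κ * lqNorm 1 (β - β₀)))
      = ∏ i, ENNReal.ofReal (Real.exp (lam * |β i| - κ * |β i - β₀ i|)) := by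
    intro β
    rw [← ENNReal.ofReal_prod_of_nonneg fun i _ => (Real.exp_pos _).le, ← Real.exp_sum,
      lqNorm_one, lqNorm_one, Finset.mul_sum, Finset.mul_sum, Finset.sum_sub_distrib]
    rfl
  simp_rw [h1]
  rw [slab_eq_pi, lintegral_pi_prod (slabCoord lam S)
    (f := fun i t => ENNReal.ofReal (Real.exp (lam * |t| - κ * |t - β₀ i|))) (by fun_prop)]
  calc _ ≤ ∏ i, (if i ∈ S then ENNReal.ofReal (lam / κ) else 1) := by
        refine Finset.prod_le_prod' fun i _ => ?_
        rw [slabCoord]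
        split_ifs with hi
        · exact (lintegral_exp_abs_laplace hlam hκ _).le
        · rw [lintegral_dirac' _ (by fun_prop)]
          rw [← ENNReal.ofReal_one]
          refine ENNReal.ofReal_le_ofReal (Real.exp_le_one_iff.2 ?_)
          simp only [abs_zero, mul_zero, zero_sub, abs_neg, neg_nonpos]
          positivity
    _ = _ := by
        rw [Finset.prod_ite_mem, Finset.univ_inter, Finset.prod_const,
          ENNReal.ofReal_pow (by positivity)]

/-- The measure with respect to which the slab has a density. -/
def slabBase (i : Fin p) : Measure ℝ := if i ∈ S then volume else Measure.dirac 0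

instance (i : Fin p) : SigmaFinite (slabBase S i) := by
  unfold slabBase; split_ifs <;> infer_instance

variable (lam) in
/-- The density of a coordinate of the slab. -/
def slabDensity (i : Fin p) (t : ℝ) : ℝ≥0∞ :=
  if i ∈ S then ENNReal.ofReal (lam / 2 * Real.exp (-lam * |t|)) else 1

variable (lam) in
theorem measurable_slabDensity (i : Fin p) : Measurable (slabDensity lam S i) := by
  unfold slabDensity; split_ifs <;> fun_prop

variable (lam) in
theorem slabCoord_eq_withDensity (i : Fin p) :
    slabCoord lam S i = (slabBase S i).withDensity (slabDensity lam S i) := by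
  unfold slabCoord slabBase slabDensity
  split_ifs with hi
  · rfl
  · exact (withDensity_one).symm

variable (lam) in
theorem slab_eq_withDensity : slab lam S
    = (Measure.pi (slabBase S)).withDensity fun β => ∏ i, slabDensity lam S i (β i) := by
  have : ∀ i, SigmaFinite ((slabBase S i).withDensity (slabDensity lam S i)) := fun i => by
    rw [← slabCoord_eq_withDensity]; infer_instance
  rw [← pi_withDensity _ (measurable_slabDensity lam S), slab_eq_pi]
  congr 1
  ext1 i
  exact slabCoord_eq_withDensity lam S i

variable {S}

/-- The slab itself is not symmetric about β₀, but its reference measure is: Lebesgue measure is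
invariant under reflections, and the atom at zero is fixed because β₀ vanishes off S. -/
theorem measurePreserving_reflect {β₀ : Fin p → ℝ} (hβ₀ : ∀ i ∉ S, β₀ i = 0) :
    MeasurePreserving (fun β i => 2 * β₀ i - β i) (Measure.pi (slabBase S))
      (Measure.pi (slabBase S)) := by
  refine measurePreserving_pi (slabBase S) (slabBase S) (f := fun i t => 2 * β₀ i - t) fun i => ?_
  unfold slabBase
  split_ifs with hi
  · exact Measure.measurePreserving_sub_left volume _
  · refine ⟨by fun_prop, ?_⟩
    rw [Measure.map_dirac' (by fun_prop), hβ₀ i hi]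
    simp

/-- A lower bound for integrals with respect to the slab, by symmetry about a point. -/
theorem le_lintegral_slab_of_symmetric (hlam : 0 < lam) {β₀ : Fin p → ℝ}
    (hβ₀ : ∀ i ∉ S, β₀ i = 0) {δ : ℝ} (hδ : 0 ≤ δ) {F : (Fin p → ℝ) → ℝ≥0∞} (hF : Measurable F)
    {a : ℝ≥0∞} (ha : ∀ β : Fin p → ℝ, (∀ i ∈ S, |β i - β₀ i| ≤ δ) → (∀ i ∉ S, β i = 0) →
      2 * a ≤ F β + F (fun i => 2 * β₀ i - β i)) :
    ENNReal.ofReal ((lam * δ) ^ S.card * Real.exp (-lam * lqNorm 1 β₀ - lam * δ * S.card)) * a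
      ≤ ∫⁻ β, F β ∂slab lam S := by
  -- The symmetrization takes place under the reference measure on the reflection-invariant box `K`;
  -- the Laplace density is replaced by its minimum bound on `K` only afterwards.
  set m := Measure.pi (slabBase S)
  set box : Fin p → Set ℝ := fun i => if i ∈ S then Set.Icc (β₀ i - δ) (β₀ i + δ) else {0}
  set K : Set (Fin p → ℝ) := Set.univ.pi box
  have hKm : MeasurableSet K := MeasurableSet.univ_pi fun i => by
    simp only [box]; split_ifs <;> measurability
  have hK : ∀ β, β ∈ K ↔ (∀ i ∈ S, |β i - β₀ i| ≤ δ) ∧ ∀ i ∉ S, β i = 0 := by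
    intro β
    simp only [K, Set.mem_univ_pi, box]
    constructor
    · intro h
      refine ⟨fun i hi => ?_, fun i hi => ?_⟩
      · have := h i
        rw [if_pos hi, Set.mem_Icc] at this
        rw [abs_le]
        constructor <;> linarith
      · have := h i
        rwa [if_neg hi] at this
    · rintro ⟨h1, h2⟩ i
      split_ifs with hi
      · have := abs_le.1 (h1 i hi)
        constructor <;> linarith
      · exact h2 i hi
  have hKv : m K = ENNReal.ofReal ((2 * δ) ^ S.card) := by
    rw [Measure.pi_pi]
    have : ∀ i, slabBase S i (box i) = if i ∈ S then ENNReal.ofReal (2 * δ) else 1 := by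
      intro i
      simp only [slabBase, box]
      split_ifs
      · rw [Real.volume_Icc]
        congr 1
        ring
      · simp
    simp_rw [this]
    rw [Finset.prod_ite_mem, Finset.univ_inter, Finset.prod_const,
      ENNReal.ofReal_pow (by positivity)]
  have hrefl := measurePreserving_reflect hβ₀
  have hKr : ∀ β : Fin p → ℝ, (fun i => 2 * β₀ i - β i) ∈ K ↔ β ∈ K := by
    intro β
    rw [hK, hK]
    refine and_congr (forall₂_congr fun i _ => ?_) (forall₂_congr fun i hi => ?_)
    · rw [show 2 * β₀ i - β i - β₀ i = -(β i - β₀ i) by ring, abs_neg]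
    · rw [hβ₀ i hi]
      simp
  have h1 : ∫⁻ β in K, F (fun i => 2 * β₀ i - β i) ∂m = ∫⁻ β in K, F β ∂m := by
    rw [← lintegral_indicator hKm, ← lintegral_indicator hKm,
      ← hrefl.lintegral_comp (hF.indicator hKm)]
    refine lintegral_congr fun β => ?_
    by_cases hβ : β ∈ K
    · rw [Set.indicator_of_mem hβ, Set.indicator_of_mem ((hKr β).2 hβ)]
    · rw [Set.indicator_of_notMem hβ, Set.indicator_of_notMem (mt (hKr β).1 hβ)]
  have h2 : a * m K ≤ ∫⁻ β in K, F β ∂m := by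
    have h3 : 2 * (a * m K) ≤ 2 * ∫⁻ β in K, F β ∂m := by
      calc 2 * (a * m K) = ∫⁻ _ in K, 2 * a ∂m := by
            rw [setLIntegral_const, mul_assoc]
        _ ≤ ∫⁻ β in K, F β + F (fun i => 2 * β₀ i - β i) ∂m :=
            setLIntegral_mono' hKm fun β hβ => ha β ((hK β).1 hβ).1 ((hK β).1 hβ).2
        _ = 2 * ∫⁻ β in K, F β ∂m := by
            rw [lintegral_add_left hF, h1, two_mul]
    exact (ENNReal.mul_le_mul_iff_right two_ne_zero ENNReal.ofNat_ne_top).1 h3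
  have hdens : ∀ β ∈ K, ENNReal.ofReal ((lam / 2) ^ S.card *
      Real.exp (-lam * lqNorm 1 β₀ - lam * δ * S.card)) ≤ ∏ i, slabDensity lam S i (β i) := by
    intro β hβ
    have h4 : ∀ i, slabDensity lam S i (β i)
        = ENNReal.ofReal (if i ∈ S then lam / 2 * Real.exp (-lam * |β i|) else 1) := by
      intro i
      unfold slabDensity
      split_ifs <;> simp
    simp_rw [h4]
    rw [← ENNReal.ofReal_prod_of_nonneg fun i _ => by split_ifs <;> positivity]
    refine ENNReal.ofReal_le_ofReal ?_
    rw [Finset.prod_ite_mem, Finset.univ_inter, Finset.prod_mul_distrib, Finset.prod_const,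
      ← Real.exp_sum]
    gcongr
    have h5 : lqNorm 1 β₀ = ∑ i ∈ S, |β₀ i| := by
      rw [lqNorm_one]
      exact (Finset.sum_subset (Finset.subset_univ S) fun i _ hi => by simp [hβ₀ i hi]).symm
    rw [h5, Finset.mul_sum, show lam * δ * S.card = ∑ _i ∈ S, lam * δ by simp [mul_comm],
      ← Finset.sum_sub_distrib]
    refine Finset.sum_le_sum fun i hi => ?_
    have h6 : |β i| ≤ |β₀ i| + δ := by
      have := abs_sub_abs_le_abs_sub (β i) (β₀ i)
      linarith [((hK β).1 hβ).1 i hi]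
    nlinarith
  have hdm : Measurable fun β : Fin p → ℝ => ∏ i, slabDensity lam S i (β i) :=
    Finset.measurable_prod _ fun i _ =>
      (measurable_slabDensity lam S i).comp (measurable_pi_apply i)
  rw [slab_eq_withDensity, lintegral_withDensity_eq_lintegral_mul _ hdm hF]
  calc _ = ENNReal.ofReal ((lam / 2) ^ S.card *
          Real.exp (-lam * lqNorm 1 β₀ - lam * δ * S.card)) * (a * m K) := by
        rw [hKv, mul_comm a, ← mul_assoc, ← ENNReal.ofReal_mul (by positivity)]
        congr 2
        rw [show lam * δ = lam / 2 * (2 * δ) by ring, mul_pow (lam / 2)]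
        ring
    _ ≤ ENNReal.ofReal ((lam / 2) ^ S.card *
          Real.exp (-lam * lqNorm 1 β₀ - lam * δ * S.card)) * ∫⁻ β in K, F β ∂m := by gcongr
    _ = ∫⁻ β in K, ENNReal.ofReal ((lam / 2) ^ S.card *
          Real.exp (-lam * lqNorm 1 β₀ - lam * δ * S.card)) * F β ∂m := by
        rw [lintegral_const_mul _ hF]
    _ ≤ ∫⁻ β in K, (∏ i, slabDensity lam S i (β i)) * F β ∂m :=
        setLIntegral_mono' hKm fun β hβ => by gcongr; exact hdens β hβ
    _ ≤ _ := setLIntegral_le_lintegral _ _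

end Slab

/-! ### The likelihood ratio and the normalizing constant of the posterior -/

section Ratio

variable {n p : ℕ} (X : Matrix (Fin n) (Fin p) ℝ)

/-- The likelihood ratio of `β` with respect to `β₀`. -/
def likRatio (β₀ : Fin p → ℝ) (y : Fin n → ℝ) (β : Fin p → ℝ) : ℝ :=
  Real.exp ((X *ᵥ (β - β₀)) ⬝ᵥ (y - X *ᵥ β₀) - lqNorm 2 (X *ᵥ (β - β₀)) ^ 2 / 2)

theorem likelihood_eq (β₀ : Fin p → ℝ) (y : Fin n → ℝ) (β : Fin p → ℝ) :
    likelihood X y β = likelihood X y β₀ * ENNReal.ofReal (likRatio X β₀ y β) := by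
  rw [likelihood, likelihood, likRatio, ← ENNReal.ofReal_mul (Real.exp_pos _).le, ← Real.exp_add]
  congr 2
  have h : y - X *ᵥ β = (y - X *ᵥ β₀) - X *ᵥ (β - β₀) := by
    rw [Matrix.mulVec_sub]; abel
  rw [h, lqNorm_two_sq, lqNorm_two_sq, lqNorm_two_sq]
  generalize y - X *ᵥ β₀ = e
  generalize X *ᵥ (β - β₀) = v
  rw [sub_dotProduct, dotProduct_sub, dotProduct_sub, dotProduct_comm e v]
  ring

theorem likelihood_ne_zero (y : Fin n → ℝ) (β : Fin p → ℝ) : likelihood X y β ≠ 0 := by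
  exact (ENNReal.ofReal_pos.2 (Real.exp_pos _)).ne'

theorem likelihood_ne_top (y : Fin n → ℝ) (β : Fin p → ℝ) : likelihood X y β ≠ ∞ :=
  ENNReal.ofReal_ne_top

theorem continuous_lqNorm_two {ι : Type} [Fintype ι] :
    Continuous fun v : ι → ℝ => lqNorm 2 v := by
  unfold lqNorm
  fun_prop

theorem continuous_lqNorm_one {ι : Type} [Fintype ι] :
    Continuous fun v : ι → ℝ => lqNorm 1 v := by
  unfold lqNorm
  fun_prop

theorem continuous_likRatio (β₀ : Fin p → ℝ) :
    Continuous fun z : (Fin n → ℝ) × (Fin p → ℝ) => likRatio X β₀ z.1 z.2 := by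
  unfold likRatio
  have h : Continuous fun z : (Fin n → ℝ) × (Fin p → ℝ) => X *ᵥ (z.2 - β₀) := by fun_prop
  refine Real.continuous_exp.comp (Continuous.sub ?_ ?_)
  · exact h.dotProduct (by fun_prop)
  · exact ((continuous_lqNorm_two.comp h).pow 2).div_const 2

theorem measurable_likRatio (β₀ : Fin p → ℝ) (y : Fin n → ℝ) :
    Measurable fun β => ENNReal.ofReal (likRatio X β₀ y β) :=
  ENNReal.measurable_ofReal.comp
    ((continuous_likRatio X β₀).comp (Continuous.prodMk_right y)).measurable

theorem measurable_likelihood (y : Fin n → ℝ) : Measurable (likelihood X y) := by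
  have : likelihood X y = fun β => likelihood X y 0 * ENNReal.ofReal (likRatio X 0 y β) := by
    ext β; exact likelihood_eq X 0 y β
  rw [this]
  exact (measurable_likRatio X 0 y).const_mul _

/-- The likelihood at β₀ is a common factor of numerator and denominator, finite and nonzero, hence
cancels. -/
theorem posterior_apply (Q : Measure (Fin p → ℝ)) [SFinite Q] (β₀ : Fin p → ℝ) (y : Fin n → ℝ)
    (B : Set (Fin p → ℝ)) :
    posterior X Q y B = (∫⁻ β, ENNReal.ofReal (likRatio X β₀ y β) ∂Q)⁻¹ *
      ∫⁻ β in B, ENNReal.ofReal (likRatio X β₀ y β) ∂Q := by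
  have h : likelihood X y
      = fun β => likelihood X y β₀ * ENNReal.ofReal (likRatio X β₀ y β) :=
    funext (likelihood_eq X β₀ y)
  rw [posterior, Measure.smul_apply, withDensity_apply' _ B, smul_eq_mul, h,
    lintegral_const_mul _ (measurable_likRatio X β₀ y),
    lintegral_const_mul _ (measurable_likRatio X β₀ y),
    ENNReal.mul_inv (.inl (likelihood_ne_zero X y β₀)) (.inl (likelihood_ne_top X y β₀)),
    mul_mul_mul_comm, ENNReal.inv_mul_cancel (likelihood_ne_zero X y β₀)
      (likelihood_ne_top X y β₀), one_mul]

theorem posterior_le_one (Q : Measure (Fin p → ℝ)) [SFinite Q] (y : Fin n → ℝ)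
    (B : Set (Fin p → ℝ)) : posterior X Q y B ≤ 1 := by
  rw [posterior_apply X Q 0]
  calc _ ≤ (∫⁻ β, ENNReal.ofReal (likRatio X 0 y β) ∂Q)⁻¹ *
      ∫⁻ β, ENNReal.ofReal (likRatio X 0 y β) ∂Q := by
        gcongr
        exact Measure.restrict_le_self
    _ ≤ 1 := ENNReal.inv_mul_le_one _

theorem mem_supp {β : Fin p → ℝ} {i : Fin p} : i ∈ supp β ↔ β i ≠ 0 := by simp [supp]

theorem eq_zero_of_notMem_supp {β : Fin p → ℝ} : ∀ i ∉ supp β, β i = 0 := by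
  intro i hi
  by_contra h
  exact hi (mem_supp.2 h)

/-- The normalizing constant is bounded below, whatever the data. -/
theorem le_lintegral_likRatio {lam : ℝ} (hlam : 0 < lam) (w : ℕ → ℝ) (β₀ : Fin p → ℝ) {δ : ℝ}
    (hδ : 0 ≤ δ) (hδX : colNorm X * (δ * (supp β₀).card) ≤ 1) (y : Fin n → ℝ) :
    ENNReal.ofReal (w (supp β₀).card / (p.choose (supp β₀).card : ℝ)) *
      ENNReal.ofReal ((lam * δ) ^ (supp β₀).card *
        Real.exp (-lam * lqNorm 1 β₀ - lam * δ * (supp β₀).card - 1 / 2))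
      ≤ ∫⁻ β, ENNReal.ofReal (likRatio X β₀ y β) ∂prior p w lam := by
  rw [lintegral_prior]
  -- Only the true model is kept from the prior mixture.
  refine le_trans ?_ (Finset.single_le_sum (f := fun S : Finset (Fin p) =>
      ENNReal.ofReal (w S.card / (p.choose S.card : ℝ)) *
        ∫⁻ β, ENNReal.ofReal (likRatio X β₀ y β) ∂slab lam S) (fun _ _ => zero_le)
    (Finset.mem_univ (supp β₀)))
  gcongr
  refine le_trans (le_of_eq ?_) (le_lintegral_slab_of_symmetric (S := supp β₀) hlam
    (β₀ := β₀) eq_zero_of_notMem_supp hδ (measurable_likRatio X β₀ y)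
    (a := ENNReal.ofReal (Real.exp (-1 / 2))) fun β hβ hβ' => ?_)
  · rw [← ENNReal.ofReal_mul (by positivity), mul_assoc _ (Real.exp _), ← Real.exp_add]
    ring_nf
  · have h1 : (fun i => 2 * β₀ i - β i) - β₀ = -(β - β₀) := by
      ext i; simp; ring
    have h2 : lqNorm 2 (-(X *ᵥ (β - β₀))) = lqNorm 2 (X *ᵥ (β - β₀)) := by
      simp [lqNorm, WithLp.toLp_neg]
    have hdouble : 2 * ENNReal.ofReal (Real.exp (-1 / 2))
        = ENNReal.ofReal (2 * Real.exp (-1 / 2)) := by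
      rw [ENNReal.ofReal_mul (by norm_num)]
      simp
    rw [likRatio, likRatio, h1, Matrix.mulVec_neg, h2, neg_dotProduct,
      ← ENNReal.ofReal_add (Real.exp_pos _).le (Real.exp_pos _).le, hdouble]
    refine ENNReal.ofReal_le_ofReal ?_
    have h3 : lqNorm 1 (β - β₀) ≤ δ * (supp β₀).card := by
      rw [lqNorm_one, ← Finset.sum_subset (Finset.subset_univ (supp β₀))]
      · calc _ ≤ ∑ i ∈ supp β₀, δ := Finset.sum_le_sum fun i hi => hβ i hi
          _ = _ := by simp [mul_comm]
      · intro i _ hi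
        simp [hβ' i hi, eq_zero_of_notMem_supp i hi]
    have h4 : lqNorm 2 (X *ᵥ (β - β₀)) ^ 2 ≤ 1 := by
      refine pow_le_one₀ (lqNorm_nonneg 2 _) ((lqNorm_mulVec_le X _).trans (le_trans ?_ hδX))
      gcongr
      exact colNorm_nonneg X
    set u := (X *ᵥ (β - β₀)) ⬝ᵥ (y - X *ᵥ β₀)
    set q := lqNorm 2 (X *ᵥ (β - β₀)) ^ 2
    have h5 : Real.exp (-1 / 2) ≤ Real.exp (-q / 2) := Real.exp_le_exp.2 (by linarith)
    have h6 := Real.cosh_eq u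
    have h7 := Real.one_le_cosh u
    -- The two likelihood ratios add up to 2 cosh(u) exp(-q/2), where u carries all the noise and q
    -- ≤ 1 on the box. Since cosh ≥ 1, the bound holds without any event on the data.
    calc 2 * Real.exp (-1 / 2) ≤ 2 * Real.exp (-q / 2) := by linarith
      _ ≤ (2 * Real.cosh u) * Real.exp (-q / 2) := by gcongr; linarith
      _ = Real.exp (u - q / 2) + Real.exp (-u - q / 2) := by
          rw [h6, show u - q / 2 = u + -q / 2 by ring, show -u - q / 2 = -u + -q / 2 by ring,
            Real.exp_add, Real.exp_add]
          ring

end Ratio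

/-! ### Control of the noise -/

section Noise

variable {n p : ℕ} (X : Matrix (Fin n) (Fin p) ℝ)

/-- The vectors Xβ with β supported on U lie in the span of |U| columns. An orthonormal basis of
this span reduces a supremum over infinitely many β to at most |U| coordinates of the noise. -/
theorem exists_orthonormal_of_support (U : Finset (Fin p)) :
    ∃ r ≤ U.card, ∃ e : Fin r → Fin n → ℝ, (∀ j k, e j ⬝ᵥ e k = if j = k then 1 else 0) ∧
      ∀ β : Fin p → ℝ, (∀ i ∉ U, β i = 0) → X *ᵥ β = ∑ j, (e j ⬝ᵥ X *ᵥ β) • e j := by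
  classical
  set V : Submodule ℝ (EuclideanSpace ℝ (Fin n)) :=
    Submodule.span ℝ ((U.image fun i => WithLp.toLp 2 (Xᵀ i) : Finset _) : Set _)
  set b := stdOrthonormalBasis ℝ V
  refine ⟨Module.finrank ℝ V, (finrank_span_finset_le_card _).trans Finset.card_image_le,
    fun j => WithLp.ofLp (b j : EuclideanSpace ℝ (Fin n)), fun j k => ?_, fun β hβ => ?_⟩
  · have h := orthonormal_iff_ite.1 b.orthonormal k j
    rw [Submodule.coe_inner, EuclideanSpace.inner_eq_star_dotProduct] at h
    simpa [eq_comm] using h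
  · have hv : WithLp.toLp 2 (X *ᵥ β) ∈ V := by
      rw [mulVec_eq_sum_smul_col, WithLp.toLp_sum]
      refine Submodule.sum_mem _ fun i _ => ?_
      by_cases hi : i ∈ U
      · rw [WithLp.toLp_smul]
        refine Submodule.smul_mem _ _ (Submodule.subset_span ?_)
        exact Finset.mem_coe.2 (Finset.mem_image_of_mem _ hi)
      · simp [hβ i hi]
    have h := b.sum_repr' ⟨_, hv⟩
    have h' := congrArg (fun v : V => WithLp.ofLp (v : EuclideanSpace ℝ (Fin n))) h
    simp only [AddSubmonoidClass.coe_finsetSum, Submodule.coe_smul, WithLp.ofLp_sum,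
      WithLp.ofLp_smul] at h'
    refine h'.symm.trans (Finset.sum_congr rfl fun j _ => ?_)
    congr 1
    rw [Submodule.coe_inner, EuclideanSpace.inner_eq_star_dotProduct, star_trivial,
      dotProduct_comm]

/-- With large probability, the inner products of the noise with the vectors `X β` are small
relative to their norms and to the sparsity of `β`. -/
theorem exists_noise_event (hp : 3 ≤ p) (β₀ : Fin p → ℝ) :
    ∃ T : Set (Fin n → ℝ), MeasurableSet T ∧
      dataLaw X β₀ Tᶜ ≤ ENNReal.ofReal (1 / p) ∧
      ∀ y ∈ T, ∀ (U : Finset (Fin p)) (β : Fin p → ℝ), (∀ i ∉ U, β i = 0) →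
        (X *ᵥ β) ⬝ᵥ (y - X *ᵥ β₀) ≤ lqNorm 2 (X *ᵥ β) ^ 2 / 4 + 12 * U.card * Real.log p := by
  choose r hr e he hX using exists_orthonormal_of_support X
  have hp0 : (0 : ℝ) < p := by positivity
  set L := Real.log p
  set Q : Finset (Fin p) → (Fin n → ℝ) → ℝ := fun U y => ∑ j, (e U j ⬝ᵥ (y - X *ᵥ β₀)) ^ 2
  have hQ : ∀ U, Measurable (Q U) := by
    intro U
    simp only [Q, dotProduct]
    fun_prop
  -- Markov's inequality for exp(Q/4) at the level Q = 12|U|L gives the tail bound √2^r exp(-3|U|L),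
  -- at most x^|U| with x = √2 p⁻³.
  set x : ℝ := √2 * Real.exp (-(3 * L))
  have hx : 0 ≤ x := by positivity
  have htail : ∀ U : Finset (Fin p), dataLaw X β₀ {y | 12 * U.card * L < Q U y}
      ≤ ENNReal.ofReal (x ^ U.card) := by
    intro U
    have h1 := mul_meas_ge_le_lintegral (μ := dataLaw X β₀)
      (f := fun y => ENNReal.ofReal (Real.exp (Q U y / 4)))
      (by have := hQ U; fun_prop) (ENNReal.ofReal (Real.exp (3 * U.card * L)))
    rw [lintegral_exp_sum_sq_dataLaw X β₀ (e U) (he U)] at h1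
    have h2 : dataLaw X β₀ {y | 12 * U.card * L < Q U y} ≤ dataLaw X β₀ {y |
        ENNReal.ofReal (Real.exp (3 * U.card * L)) ≤ ENNReal.ofReal (Real.exp (Q U y / 4))} := by
      refine measure_mono fun y hy => ENNReal.ofReal_le_ofReal (Real.exp_le_exp.2 ?_)
      rw [Set.mem_ofPred_eq] at hy
      linarith
    have h3 : ENNReal.ofReal (Real.exp (3 * U.card * L)) ≠ 0 :=
      (ENNReal.ofReal_pos.2 (Real.exp_pos _)).ne'
    refine h2.trans ?_
    rw [mul_comm, ← ENNReal.le_div_iff_mul_le (.inl h3) (.inl ENNReal.ofReal_ne_top),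
      ← ENNReal.ofReal_div_of_pos (Real.exp_pos _)] at h1
    refine h1.trans (ENNReal.ofReal_le_ofReal ?_)
    rw [div_eq_mul_inv, ← Real.exp_neg, mul_pow, ← Real.exp_nat_mul]
    rw [show (U.card : ℝ) * -(3 * L) = -(3 * U.card * L) by ring]
    gcongr
    · exact Real.one_le_sqrt.2 (by norm_num)
    · exact hr U
  refine ⟨⋂ U, {y | Q U y ≤ 12 * U.card * L},
    MeasurableSet.iInter fun U => measurableSet_le (hQ U) measurable_const, ?_, ?_⟩
  -- The empty set causes no violation since its span is zero. The union bound over the others sums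
  -- to (1 + x)^p - 1 ≤ exp(px) - 1 ≤ 2px ≤ 1/p.
  · have hcompl : (⋂ U : Finset (Fin p), {y | Q U y ≤ 12 * U.card * L})ᶜ
        ⊆ ⋃ U ∈ Finset.univ.erase (∅ : Finset (Fin p)), {y | 12 * U.card * L < Q U y} := by
      intro y hy
      simp only [Set.mem_compl_iff, Set.mem_iInter, Set.mem_ofPred_eq, not_forall, not_le] at hy
      obtain ⟨U, hU⟩ := hy
      simp only [Set.mem_iUnion]
      refine ⟨U, Finset.mem_erase.2 ⟨?_, Finset.mem_univ _⟩, hU⟩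
      rintro rfl
      have h0 : r ∅ = 0 := by simpa using hr ∅
      have : IsEmpty (Fin (r ∅)) := by rw [h0]; infer_instance
      simp [Q] at hU
    calc _ ≤ ∑ U ∈ Finset.univ.erase (∅ : Finset (Fin p)), ENNReal.ofReal (x ^ U.card) :=
          (measure_mono hcompl).trans ((measure_biUnion_finset_le _ _).trans
            (Finset.sum_le_sum fun U _ => htail U))
      _ = ENNReal.ofReal (∑ U ∈ Finset.univ.erase (∅ : Finset (Fin p)), x ^ U.card) :=
          (ENNReal.ofReal_sum_of_nonneg fun U _ => by positivity).symm
      _ ≤ _ := ENNReal.ofReal_le_ofReal ?_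
    have h1 : ∑ U : Finset (Fin p), x ^ U.card = (1 + x) ^ p := by
      have := Fintype.sum_pow_mul_eq_add_pow (Fin p) x 1
      simpa [add_comm] using this
    have h2 := Finset.add_sum_erase Finset.univ (fun U : Finset (Fin p) => x ^ U.card)
      (Finset.mem_univ ∅)
    rw [h1, Finset.card_empty, pow_zero] at h2
    have h3 : (1 + x) ^ p ≤ Real.exp (p * x) := by
      rw [Real.exp_nat_mul]
      gcongr
      rw [add_comm]
      exact Real.add_one_le_exp x
    have h4 : x = √2 / p ^ 3 := by
      simp only [x, L]
      rw [Real.exp_neg, show (3 : ℝ) * Real.log p = (3 : ℕ) * Real.log p by norm_num,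
        Real.exp_nat_mul, Real.exp_log hp0]
      rfl
    have hp3 : (3 : ℝ) ≤ p := by exact_mod_cast hp
    have hsq : √2 ≤ 3 / 2 := by
      rw [Real.sqrt_le_left (by norm_num)]
      norm_num
    have h5 : p * x ≤ 1 / (2 * p) := by
      rw [h4]
      calc (p : ℝ) * (√2 / p ^ 3) = √2 / p ^ 2 := by field_simp
        _ ≤ ((p : ℝ) / 2) / p ^ 2 := by gcongr; linarith
        _ = 1 / (2 * (p : ℝ)) := by field_simp
    have h6 : 1 / (2 * (p : ℝ)) ≤ 1 / 6 := by
      gcongr; linarith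
    have h7 := Real.exp_bound_div_one_sub_of_interval (x := p * x) (by positivity) (by linarith)
    have h8 : 1 / (1 - p * x) ≤ 1 + 2 * (p * x) := by
      rw [div_le_iff₀ (by linarith)]
      have : 0 ≤ p * x := by positivity
      nlinarith
    have h9 : 1 / (p : ℝ) = 2 * (1 / (2 * p)) := by field_simp
    linarith
  · intro y hy U β hβ
    have hy' : Q U y ≤ 12 * U.card * L := Set.mem_iInter.1 hy U
    have h1 := hX U β hβ
    set a : Fin (r U) → ℝ := fun j => e U j ⬝ᵥ X *ᵥ β
    have h2 : lqNorm 2 (X *ᵥ β) ^ 2 = ∑ j, a j ^ 2 := by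
      rw [lqNorm_two_sq, h1]
      simp only [sum_dotProduct, dotProduct_sum, smul_dotProduct, dotProduct_smul, he, smul_eq_mul]
      simp [pow_two, a]
    have h3 : (X *ᵥ β) ⬝ᵥ (y - X *ᵥ β₀) = ∑ j, a j * (e U j ⬝ᵥ (y - X *ᵥ β₀)) := by
      rw [h1]
      simp only [sum_dotProduct, smul_dotProduct, smul_eq_mul, a]
    rw [h2, h3]
    refine le_trans ?_ (add_le_add_right hy' _)
    rw [Finset.sum_div, ← Finset.sum_add_distrib]
    refine Finset.sum_le_sum fun j _ => ?_
    -- The inequality ab ≤ a²/4 + b² in each coordinate of the projection.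
    nlinarith [sq_nonneg (a j / 2 - e U j ⬝ᵥ (y - X *ᵥ β₀))]

end Noise

/-! ### The posterior mass of a set -/

section Mass

variable {n p : ℕ} {X : Matrix (Fin n) (Fin p) ℝ} {β₀ : Fin p → ℝ}

/-- Let u be the noise term and q = ‖X(β-β₀)‖². The exponent u - q/2 is split as (1-θ)u + θu - q/2;
the event bounds θu by θ(q/4 + a), and (1-θ)u has exponential moment exp((1-θ)²q/2). The total
exponent is θa - (3/4)θq + θ²q/2, at most θa - θq/4 for θ ≤ 1. The parameter θ makes the price
exp(θa) of the event as mild as desired while keeping quadratic decay. -/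
theorem setLIntegral_likRatio_slab_le {T : Set (Fin n → ℝ)} (hT : MeasurableSet T) {a : ℝ}
    {S : Finset (Fin p)}
    (hTS : ∀ y ∈ T, ∀ β : Fin p → ℝ, (∀ i ∉ S, β i = 0) →
      (X *ᵥ (β - β₀)) ⬝ᵥ (y - X *ᵥ β₀) ≤ lqNorm 2 (X *ᵥ (β - β₀)) ^ 2 / 4 + a)
    {θ : ℝ} (hθ : 0 ≤ θ) (hθ1 : θ ≤ 1) (lam : ℝ) (B : Set (Fin p → ℝ)) :
    ∫⁻ y in T, ∫⁻ β in B, ENNReal.ofReal (likRatio X β₀ y β) ∂slab lam S ∂dataLaw X β₀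
      ≤ ∫⁻ β in B, ENNReal.ofReal (Real.exp (-(θ / 4) * lqNorm 2 (X *ᵥ (β - β₀)) ^ 2 + θ * a))
        ∂slab lam S := by
  set q : (Fin p → ℝ) → ℝ := fun β => lqNorm 2 (X *ᵥ (β - β₀)) ^ 2
  set g : (Fin n → ℝ) → (Fin p → ℝ) → ℝ≥0∞ := fun y β =>
    ENNReal.ofReal (Real.exp (θ * (q β / 4 + a) - q β / 2)) *
      ENNReal.ofReal (Real.exp (((1 - θ) • (X *ᵥ (β - β₀))) ⬝ᵥ (y - X *ᵥ β₀)))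
  have hqc : Continuous q := by
    have h1 : Continuous fun β : Fin p → ℝ => X *ᵥ (β - β₀) := by fun_prop
    exact (continuous_lqNorm_two.comp h1).pow 2
  have hg : Measurable (Function.uncurry g) := by
    have h1 : Continuous fun z : (Fin n → ℝ) × (Fin p → ℝ) =>
        ((1 - θ) • (X *ᵥ (z.2 - β₀))) ⬝ᵥ (z.1 - X *ᵥ β₀) := by
      refine Continuous.dotProduct ?_ (by fun_prop)
      exact (Continuous.matrix_mulVec continuous_const
        (continuous_snd.sub continuous_const)).const_smul (1 - θ)
    have h2 : Continuous fun z : (Fin n → ℝ) × (Fin p → ℝ) => q z.2 := hqc.comp continuous_snd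
    simp only [g, Function.uncurry_def]
    exact (ENNReal.measurable_ofReal.comp (by fun_prop)).mul
      (ENNReal.measurable_ofReal.comp (Real.continuous_exp.comp h1).measurable)
  calc _ ≤ ∫⁻ y in T, ∫⁻ β in B, g y β ∂slab lam S ∂dataLaw X β₀ := by
        refine setLIntegral_mono' hT fun y hy => lintegral_mono_ae ?_
        filter_upwards [ae_restrict_of_ae (ae_slab_eq_zero lam S)] with β hβ
        have h1 := hTS y hy β hβ
        simp only [g, likRatio]
        rw [← ENNReal.ofReal_mul (Real.exp_pos _).le, ← Real.exp_add, smul_dotProduct, smul_eq_mul]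
        refine ENNReal.ofReal_le_ofReal (Real.exp_le_exp.2 ?_)
        have h2 := mul_le_mul_of_nonneg_left h1 hθ
        linarith
    _ ≤ ∫⁻ y, ∫⁻ β in B, g y β ∂slab lam S ∂dataLaw X β₀ := setLIntegral_le_lintegral _ _
    _ = ∫⁻ β in B, ∫⁻ y, g y β ∂dataLaw X β₀ ∂slab lam S :=
        lintegral_lintegral_swap hg.aemeasurable
    _ ≤ _ := by
        refine lintegral_mono fun β => ?_
        simp only [g]
        rw [lintegral_const_mul' _ _ ENNReal.ofReal_ne_top, lintegral_exp_dotProduct_dataLaw,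
          ← ENNReal.ofReal_mul (Real.exp_pos _).le, ← Real.exp_add]
        refine ENNReal.ofReal_le_ofReal (Real.exp_le_exp.2 ?_)
        rw [smul_dotProduct, dotProduct_smul, ← lqNorm_two_sq, smul_eq_mul, smul_eq_mul]
        change _ ≤ -(θ / 4) * q β + θ * a
        change θ * (q β / 4 + a) - q β / 2 + (1 - θ) * ((1 - θ) * q β) / 2 ≤ _
        have hq : 0 ≤ q β := sq_nonneg _
        nlinarith [mul_nonneg (mul_nonneg hθ (sub_nonneg.2 hθ1)) hq]

/-- Off T the posterior mass is at most one. On T the denominator is replaced by its bound D, which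
leaves the expectation because it does not depend on the data. -/
theorem expectedPosterior_le_add {Q : Measure (Fin p → ℝ)} [SFinite Q] {T : Set (Fin n → ℝ)}
    (hT : MeasurableSet T) {D : ℝ≥0∞} (hD0 : D ≠ 0)
    (hD : ∀ y, D ≤ ∫⁻ β, ENNReal.ofReal (likRatio X β₀ y β) ∂Q) (B : Set (Fin p → ℝ)) :
    expectedPosterior X Q β₀ B ≤ dataLaw X β₀ Tᶜ +
      D⁻¹ * ∫⁻ y in T, ∫⁻ β in B, ENNReal.ofReal (likRatio X β₀ y β) ∂Q ∂dataLaw X β₀ := by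
  rw [expectedPosterior, ← lintegral_add_compl _ hT, add_comm]
  gcongr
  · calc _ ≤ ∫⁻ _ in Tᶜ, 1 ∂dataLaw X β₀ := lintegral_mono fun y => posterior_le_one X Q y B
      _ = _ := by simp
  · rw [← lintegral_const_mul' _ _ (ENNReal.inv_ne_top.2 hD0)]
    refine lintegral_mono fun y => ?_
    rw [posterior_apply X Q β₀]
    gcongr
    exact hD y

theorem sum_ofReal_card (f : ℕ → ℝ) (hf : ∀ s ≤ p, 0 ≤ f s) :
    ∑ S : Finset (Fin p), ENNReal.ofReal (f S.card / (p.choose S.card : ℝ))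
      = ENNReal.ofReal (∑ s ∈ Finset.range (p + 1), f s) := by
  have hcard : ∀ S : Finset (Fin p), S.card ≤ p := fun S => by
    simpa using Finset.card_le_univ S
  rw [← ENNReal.ofReal_sum_of_nonneg fun S _ => div_nonneg (hf _ (hcard S)) (Nat.cast_nonneg _)]
  congr 1
  have h := Finset.sum_powerset_apply_card (fun s => f s / (p.choose s : ℝ))
    (x := (Finset.univ : Finset (Fin p)))
  rw [Finset.powerset_univ] at h
  rw [h, Finset.card_univ, Fintype.card_fin]
  refine Finset.sum_congr rfl fun s hs => ?_
  have : (p.choose s : ℝ) ≠ 0 := by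
    exact_mod_cast (Nat.choose_pos (Nat.lt_succ_iff.1 (Finset.mem_range.1 hs))).ne'
  rw [nsmul_eq_mul]
  field_simp

/-- The master bound: a set of vectors with many nonzero coordinates, or far from `β₀` in
prediction or `ℓ¹` norm, has small posterior mass. -/
theorem expectedPosterior_le_master {lam : ℝ} (hlam : 0 < lam) {w : ℕ → ℝ}
    (hw : ∀ s ≤ p, 0 < w s) {T : Set (Fin n → ℝ)} (hT : MeasurableSet T) {L : ℝ}
    (hTU : ∀ y ∈ T, ∀ (U : Finset (Fin p)) (β : Fin p → ℝ), (∀ i ∉ U, β i = 0) →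
      (X *ᵥ β) ⬝ᵥ (y - X *ᵥ β₀) ≤ lqNorm 2 (X *ᵥ β) ^ 2 / 4 + 12 * U.card * L)
    (hL : 0 ≤ L) {δ : ℝ} (hδ : 0 < δ) (hδX : colNorm X * (δ * (supp β₀).card) ≤ 1)
    {θ : ℝ} (hθ : 0 ≤ θ) (hθ1 : θ ≤ 1) {G r : ℝ} {N : ℕ} {B : Set (Fin p → ℝ)}
    (hBm : MeasurableSet B)
    (hG : ∀ β ∈ B, lam * lqNorm 1 β₀ - θ / 8 * lqNorm 2 (X *ᵥ (β - β₀)) ^ 2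
      ≤ lam * lqNorm 1 β - lam / 4 * lqNorm 1 (β - β₀) + G)
    (hr : ∀ β ∈ B, r ≤ θ / 8 * lqNorm 2 (X *ᵥ (β - β₀)) ^ 2 + lam / 8 * lqNorm 1 (β - β₀))
    (hN : ∀ β ∈ B, N ≤ (supp β).card) :
    expectedPosterior X (prior p w lam) β₀ B ≤ dataLaw X β₀ Tᶜ + ENNReal.ofReal
      (p.choose (supp β₀).card * ((lam * δ) ^ (supp β₀).card)⁻¹ *
        Real.exp (lam * δ * (supp β₀).card + 1 / 2 + G - r + 12 * θ * (supp β₀).card * L) *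
        ∑ s ∈ Finset.Icc N p, w s / w (supp β₀).card * (8 * Real.exp (12 * θ * L)) ^ s) := by
  set S₀ := supp β₀
  set s₀ := S₀.card
  have hs₀ : s₀ ≤ p := by simpa using Finset.card_le_univ S₀
  have hch : (0 : ℝ) < p.choose s₀ := by exact_mod_cast Nat.choose_pos hs₀
  set d : ℝ := w s₀ / p.choose s₀ *
    ((lam * δ) ^ s₀ * Real.exp (-lam * lqNorm 1 β₀ - lam * δ * s₀ - 1 / 2))
  have hd : 0 < d := by have := hw s₀ hs₀; positivity
  have hD : ∀ y, ENNReal.ofReal d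
      ≤ ∫⁻ β, ENNReal.ofReal (likRatio X β₀ y β) ∂prior p w lam := fun y => by
    have := le_lintegral_likRatio X hlam w β₀ hδ.le hδX y
    rwa [← ENNReal.ofReal_mul (div_nonneg (hw s₀ hs₀).le hch.le)] at this
  refine (expectedPosterior_le_add hT (ENNReal.ofReal_pos.2 hd).ne' hD B).trans ?_
  gcongr
  -- Under the slab on S, the support of β lies in S almost surely, so models with fewer than N
  -- elements do not charge B.
  set b : ℕ → ℝ := fun s => if N ≤ s then
    Real.exp (-lam * lqNorm 1 β₀ + G - r + θ * (12 * (s + s₀) * L)) * 8 ^ s else 0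
  have hb : ∀ s, 0 ≤ b s := fun s => by simp only [b]; split_ifs <;> positivity
  have hslab : ∀ S : Finset (Fin p),
      ∫⁻ y in T, ∫⁻ β in B, ENNReal.ofReal (likRatio X β₀ y β) ∂slab lam S ∂dataLaw X β₀
        ≤ ENNReal.ofReal (b S.card) := by
    intro S
    have h1 := setLIntegral_likRatio_slab_le (X := X) (β₀ := β₀) (S := S)
      (a := 12 * (S.card + s₀) * L) hT (fun y hy β hβ => by
        refine (hTU y hy (S ∪ S₀) (β - β₀) fun i hi => ?_).trans ?_
        · rw [Finset.notMem_union] at hi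
          simp [hβ i hi.1, eq_zero_of_notMem_supp i hi.2]
        · gcongr
          exact_mod_cast Finset.card_union_le S S₀) hθ hθ1 lam B
    refine h1.trans ?_
    calc _ ≤ ∫⁻ β in B, ENNReal.ofReal (if N ≤ S.card then
          Real.exp (-lam * lqNorm 1 β₀ + G - r + θ * (12 * (S.card + s₀) * L)) else 0) *
          ENNReal.ofReal (Real.exp (lam * lqNorm 1 β - lam / 8 * lqNorm 1 (β - β₀)))
          ∂slab lam S := by
          refine lintegral_mono_ae ?_
          filter_upwards [ae_restrict_of_ae (ae_slab_eq_zero lam S), ae_restrict_mem hBm]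
            with β hβ hβB
          have hc : (supp β).card ≤ S.card := by
            refine Finset.card_le_card fun i hi => ?_
            by_contra h
            exact mem_supp.1 hi (hβ i h)
          rw [if_pos ((hN β hβB).trans hc), ← ENNReal.ofReal_mul (Real.exp_pos _).le,
            ← Real.exp_add]
          refine ENNReal.ofReal_le_ofReal (Real.exp_le_exp.2 ?_)
          -- The decay θ/4 is spent in two halves: one pays for replacing λ‖β₀‖₁ by λ‖β‖₁ with a
          -- gain of λ/4 in ℓ¹ distance, the other, with half of this gain, produces r. The
          -- remaining λ/8 makes the slab integral finite and yields the factor 8 per coordinate of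
          -- S.
          have h2 := hG β hβB
          have h3 := hr β hβB
          linarith
      _ ≤ ENNReal.ofReal (if N ≤ S.card then
          Real.exp (-lam * lqNorm 1 β₀ + G - r + θ * (12 * (S.card + s₀) * L)) else 0) *
          ENNReal.ofReal ((lam / (lam / 8)) ^ S.card) := by
          rw [lintegral_const_mul' _ _ ENNReal.ofReal_ne_top]
          gcongr
          exact (setLIntegral_le_lintegral _ _).trans
            (lintegral_exp_abs_slab_le S hlam (by positivity) β₀)
      _ = _ := by
          rw [show lam / (lam / 8) = 8 by field_simp, ← ENNReal.ofReal_mul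
            (by split_ifs <;> positivity)]
          simp only [b, ite_mul, zero_mul]
  have hmeas : ∀ S : Finset (Fin p), Measurable fun y =>
      ∫⁻ β in B, ENNReal.ofReal (likRatio X β₀ y β) ∂slab lam S := fun S =>
    (ENNReal.measurable_ofReal.comp (continuous_likRatio X β₀).measurable).lintegral_prod_right'
  have hprior : ∀ y, ∫⁻ β in B, ENNReal.ofReal (likRatio X β₀ y β) ∂prior p w lam
      = ∑ S : Finset (Fin p), ENNReal.ofReal (w S.card / (p.choose S.card : ℝ)) *
        ∫⁻ β in B, ENNReal.ofReal (likRatio X β₀ y β) ∂slab lam S := by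
    intro y
    rw [← lintegral_indicator hBm, lintegral_prior]
    simp_rw [lintegral_indicator hBm]
  calc _ ≤ (ENNReal.ofReal d)⁻¹ * ∑ S : Finset (Fin p),
        ENNReal.ofReal (w S.card / (p.choose S.card : ℝ)) * ENNReal.ofReal (b S.card) := by
        gcongr
        simp_rw [hprior]
        rw [lintegral_finsetSum _ fun S _ => (hmeas S).const_mul _]
        refine Finset.sum_le_sum fun S _ => ?_
        rw [lintegral_const_mul _ (hmeas S)]
        gcongr
        exact hslab S
    _ = (ENNReal.ofReal d)⁻¹ * ENNReal.ofReal (∑ s ∈ Finset.range (p + 1), w s * b s) := by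
        rw [← sum_ofReal_card _ fun s hs => mul_nonneg (hw s hs).le (hb s)]
        congr 1
        refine Finset.sum_congr rfl fun S _ => ?_
        have hS : S.card ≤ p := by simpa using Finset.card_le_univ S
        rw [← ENNReal.ofReal_mul (div_nonneg (hw _ hS).le (Nat.cast_nonneg _))]
        congr 1
        ring
    _ = ENNReal.ofReal (d⁻¹ * ∑ s ∈ Finset.range (p + 1), w s * b s) := by
        rw [← ENNReal.ofReal_inv_of_pos hd, ← ENNReal.ofReal_mul (by positivity)]
    _ ≤ _ := by
        refine ENNReal.ofReal_le_ofReal (le_of_eq ?_)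
        have hset : Finset.Icc N p = (Finset.range (p + 1)).filter fun s => N ≤ s := by
          ext s
          simp only [Finset.mem_Icc, Finset.mem_filter, Finset.mem_range]
          omega
        rw [hset, Finset.sum_filter, Finset.mul_sum, Finset.mul_sum]
        refine Finset.sum_congr rfl fun s hs => ?_
        simp only [b]
        split_ifs with h
        · have hws := hw s₀ hs₀
          simp only [d]
          rw [mul_inv, mul_inv, inv_div, ← Real.exp_neg, mul_pow 8, ← Real.exp_nat_mul]
          have hexp : Real.exp (-(-lam * lqNorm 1 β₀ - lam * δ * s₀ - 1 / 2)) *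
              Real.exp (-lam * lqNorm 1 β₀ + G - r + θ * (12 * (s + s₀) * L))
              = Real.exp (lam * δ * s₀ + 1 / 2 + G - r + 12 * θ * s₀ * L) *
                Real.exp (s * (12 * θ * L)) := by
            rw [← Real.exp_add, ← Real.exp_add]
            ring_nf
          calc _ = p.choose s₀ / w s₀ * ((lam * δ) ^ s₀)⁻¹ * w s * 8 ^ s *
              (Real.exp (-(-lam * lqNorm 1 β₀ - lam * δ * s₀ - 1 / 2)) *
              Real.exp (-lam * lqNorm 1 β₀ + G - r + θ * (12 * (s + s₀) * L))) := by ring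
            _ = _ := by rw [hexp]; ring
        · simp

end Mass

/-! ### The prior on the dimension -/

section Weights

variable {A₁ A₂ A₃ A₄ : ℝ} {p : ℕ} {w : ℕ → ℝ}

/-- If the weight of dimension zero vanished, the upper recursion would annihilate all weights,
contradicting total mass one; the lower recursion then propagates positivity upwards. -/
theorem DimensionPrior.pos (hw : DimensionPrior A₁ A₂ A₃ A₄ p w) (hA₁ : 0 < A₁) (hp : 0 < p) :
    ∀ s ≤ p, 0 < w s := by
  have hp' : (0 : ℝ) < p := by exact_mod_cast hp
  have h0 : 0 < w 0 := by
    refine lt_of_le_of_ne (hw.nonneg 0 (Nat.zero_le _)) fun h0 => ?_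
    have hz : ∀ s ≤ p, w s = 0 := by
      intro s
      induction s with
      | zero => exact fun _ => h0.symm
      | succ s ih =>
        intro hs
        have h1 := hw.upper (s + 1) (Finset.mem_Icc.2 ⟨by omega, hs⟩)
        rw [Nat.add_sub_cancel, ih (by omega), mul_zero] at h1
        exact le_antisymm h1 (hw.nonneg _ hs)
    have h1 := hw.sum_eq_one
    rw [Finset.sum_eq_zero fun s hs => hz s (Nat.lt_succ_iff.1 (Finset.mem_range.1 hs))] at h1
    exact zero_ne_one h1
  intro s
  induction s with
  | zero => exact fun _ => h0
  | succ s ih =>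
    intro hs
    have h1 := hw.lower (s + 1) (Finset.mem_Icc.2 ⟨by omega, hs⟩)
    rw [Nat.add_sub_cancel] at h1
    exact lt_of_lt_of_le (by have := ih (by omega); positivity) h1

theorem rpow_eq_exp_log (hp : 0 < p) (a : ℝ) : (p : ℝ) ^ a = Real.exp (a * Real.log p) := by
  rw [Real.rpow_def_of_pos (by exact_mod_cast hp), mul_comm]

theorem DimensionPrior.le_pow_mul (hw : DimensionPrior A₁ A₂ A₃ A₄ p w) (hA₂ : 0 < A₂)
    (hp : 0 < p) {s t : ℕ} (hst : s ≤ t) (ht : t ≤ p) :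
    w t ≤ (A₂ * Real.exp (-A₄ * Real.log p)) ^ (t - s) * w s := by
  induction t, hst using Nat.le_induction with
  | base => simp
  | succ t hst ih =>
    have h1 := hw.upper (t + 1) (Finset.mem_Icc.2 ⟨by omega, ht⟩)
    rw [Nat.add_sub_cancel, rpow_eq_exp_log hp] at h1
    refine h1.trans ?_
    rw [Nat.sub_add_comm hst, pow_succ', mul_assoc (A₂ * _)]
    gcongr
    exact ih (by omega)

theorem DimensionPrior.le_pow_mul_of_le (hw : DimensionPrior A₁ A₂ A₃ A₄ p w) (hA₁ : 0 < A₁)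
    (hp : 0 < p) {s t : ℕ} (hst : s ≤ t) (ht : t ≤ p) :
    w s ≤ (A₁⁻¹ * Real.exp (A₃ * Real.log p)) ^ (t - s) * w t := by
  induction t, hst using Nat.le_induction with
  | base => simp
  | succ t hst ih =>
    have h1 := hw.lower (t + 1) (Finset.mem_Icc.2 ⟨by omega, ht⟩)
    rw [Nat.add_sub_cancel, rpow_eq_exp_log hp] at h1
    refine (ih (by omega)).trans ?_
    rw [Nat.sub_add_comm hst, pow_succ, mul_assoc]
    gcongr
    calc w t = A₁⁻¹ * Real.exp (A₃ * Real.log p) *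
          (A₁ * Real.exp (-A₃ * Real.log p) * w t) := by
          rw [show A₁⁻¹ * Real.exp (A₃ * Real.log p) * (A₁ * Real.exp (-A₃ * Real.log p) * w t)
            = (A₁⁻¹ * A₁) * (Real.exp (A₃ * Real.log p) * Real.exp (-A₃ * Real.log p)) * w t by
            ring, ← Real.exp_add, inv_mul_cancel₀ hA₁.ne']
          simp
      _ ≤ _ := by gcongr

/-- Above s₀ the terms are dominated by a geometric progression of ratio at most 1/2, which gives
the factor 2. -/
theorem DimensionPrior.sum_le_of_le (hw : DimensionPrior A₁ A₂ A₃ A₄ p w) (hA₁ : 0 < A₁)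
    (hA₂ : 0 < A₂) (hp : 0 < p) {a : ℝ} (ha : 0 < a)
    (hq : A₂ * Real.exp (-A₄ * Real.log p) * a ≤ 1 / 2) {s₀ N : ℕ} (hs₀ : s₀ ≤ p)
    (hN : s₀ ≤ N) :
    ∑ s ∈ Finset.Icc N p, w s / w s₀ * a ^ s
      ≤ 2 * (a ^ s₀ * (A₂ * Real.exp (-A₄ * Real.log p) * a) ^ (N - s₀)) := by
  set b := A₂ * Real.exp (-A₄ * Real.log p)
  set q := b * a
  have hb : 0 < b := by positivity
  have hq0 : 0 < q := by positivity
  have hws := hw.pos hA₁ hp s₀ hs₀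
  have hIcc : Finset.Icc N p = Finset.Ico N (p + 1) := by ext; simp
  calc _ ≤ ∑ s ∈ Finset.Icc N p, a ^ s₀ * q ^ (s - s₀) := by
        refine Finset.sum_le_sum fun s hs => ?_
        rw [Finset.mem_Icc] at hs
        have h1 := hw.le_pow_mul hA₂ hp (hN.trans hs.1) hs.2
        rw [← div_le_iff₀ hws] at h1
        calc w s / w s₀ * a ^ s ≤ b ^ (s - s₀) * a ^ s := by gcongr
          _ = _ := by
            have h2 : a ^ s = a ^ (s - s₀) * a ^ s₀ := by
              rw [← pow_add, Nat.sub_add_cancel (hN.trans hs.1)]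
            rw [mul_pow b, h2]
            ring
    _ = a ^ s₀ * q ^ (N - s₀) * ∑ i ∈ Finset.range (p + 1 - N), q ^ i := by
        rw [hIcc, Finset.sum_Ico_eq_sum_range, Finset.mul_sum]
        refine Finset.sum_congr rfl fun i _ => ?_
        rw [show N + i - s₀ = N - s₀ + i by omega, pow_add]
        ring
    _ ≤ a ^ s₀ * q ^ (N - s₀) * 2 := by
        gcongr
        have h2 := mul_neg_geom_sum q (p + 1 - N)
        have h3 : 0 < q ^ (p + 1 - N) := by positivity
        have h4 : 0 ≤ ∑ i ∈ Finset.range (p + 1 - N), q ^ i := by positivity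
        nlinarith
    _ = _ := by ring

theorem add_two_le_three_pow {s : ℕ} (hs : 1 ≤ s) : s + 2 ≤ 3 ^ s := by
  induction s, hs using Nat.le_induction with
  | base => norm_num
  | succ m _ ih => rw [pow_succ]; omega

/-- Dimensions from s₀ on are summed geometrically. Each of the s₀ smaller dimensions costs at most
(ab)^s₀ by the lower recursion, b being the maximal growth of the weights per step down. The
prefactor s₀ + 2 is absorbed in 3^s₀. -/
theorem DimensionPrior.sum_le (hw : DimensionPrior A₁ A₂ A₃ A₄ p w) (hA₁ : 0 < A₁)
    (hA₂ : 0 < A₂) (hp : 0 < p) {a : ℝ} (ha : 1 ≤ a)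
    (hq : A₂ * Real.exp (-A₄ * Real.log p) * a ≤ 1 / 2)
    (hb : 1 ≤ A₁⁻¹ * Real.exp (A₃ * Real.log p)) {s₀ : ℕ} (hs₀ : s₀ ≤ p) (hs₁ : 1 ≤ s₀) :
    ∑ s ∈ Finset.Icc 0 p, w s / w s₀ * a ^ s
      ≤ (3 * a * (A₁⁻¹ * Real.exp (A₃ * Real.log p))) ^ s₀ := by
  set b := A₁⁻¹ * Real.exp (A₃ * Real.log p)
  have hws := hw.pos hA₁ hp s₀ hs₀
  have hIcc : Finset.Icc 0 p = Finset.Ico 0 (p + 1) := by ext; simp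
  have hIcc' : Finset.Icc s₀ p = Finset.Ico s₀ (p + 1) := by ext; simp
  rw [hIcc, ← Finset.sum_Ico_consecutive _ (Nat.zero_le s₀) (by omega : s₀ ≤ p + 1), ← hIcc']
  have h1 := hw.sum_le_of_le hA₁ hA₂ hp (by linarith) hq hs₀ le_rfl
  rw [Nat.sub_self, pow_zero, mul_one] at h1
  have h2 : ∑ s ∈ Finset.Ico 0 s₀, w s / w s₀ * a ^ s ≤ s₀ * (a * b) ^ s₀ := by
    calc _ ≤ ∑ s ∈ Finset.Ico 0 s₀, (a * b) ^ s₀ := by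
          refine Finset.sum_le_sum fun s hs => ?_
          have hs' := (Finset.mem_Ico.1 hs).2.le
          have h3 := hw.le_pow_mul_of_le hA₁ hp hs' hs₀
          rw [← div_le_iff₀ hws] at h3
          rw [mul_pow, mul_comm]
          have h4 : b ^ (s₀ - s) ≤ b ^ s₀ := pow_le_pow_right₀ hb (by omega)
          have h5 : a ^ s ≤ a ^ s₀ := pow_le_pow_right₀ ha hs'
          exact mul_le_mul h5 (h3.trans h4)
            (div_nonneg (hw.nonneg _ (hs'.trans hs₀)) hws.le) (by positivity)
      _ = _ := by simp
  have h6 : a ^ s₀ ≤ (a * b) ^ s₀ := by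
    gcongr
    nlinarith
  have h7 : (s₀ : ℝ) + 2 ≤ 3 ^ s₀ := by
    have := add_two_le_three_pow hs₁
    exact_mod_cast this
  calc _ ≤ (s₀ + 2) * (a * b) ^ s₀ := by linarith
    _ ≤ 3 ^ s₀ * (a * b) ^ s₀ := by gcongr
    _ = _ := by rw [← mul_pow]; ring

end Weights

/-! ### Large dimensions -/

section Large

/-- The dimension `p` is large relative to the constants of the prior. -/
structure LargeDim (A₁ A₂ A₃ A₄ : ℝ) (p : ℕ) : Prop where
  three_le : 3 ≤ p
  upper : 8 * A₂ ≤ Real.exp (A₄ / 20 * Real.log p)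
  half : Real.exp (-(9 / 10 * A₄) * Real.log p) ≤ 1 / 2
  lower : 1 ≤ A₁⁻¹ * Real.exp (A₃ * Real.log p)
  inv : A₁⁻¹ ≤ Real.exp (Real.log p)
  sqrt : 7 + 4 * √(Real.log p) ≤ Real.log p / 10

theorem tendsto_log_natCast : Tendsto (fun p : ℕ => Real.log p) atTop atTop :=
  Real.tendsto_log_atTop.comp tendsto_natCast_atTop_atTop

theorem eventually_largeDim {A₁ A₂ A₃ A₄ : ℝ} (hA₁ : 0 < A₁) (hA₃ : 0 < A₃) (hA₄ : 0 < A₄) :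
    ∀ᶠ p : ℕ in atTop, LargeDim A₁ A₂ A₃ A₄ p := by
  have hL := tendsto_log_natCast
  have hexp : ∀ a : ℝ, 0 < a →
      Tendsto (fun p : ℕ => Real.exp (a * Real.log p)) atTop atTop := fun a ha =>
    Real.tendsto_exp_atTop.comp (hL.const_mul_atTop ha)
  filter_upwards [eventually_ge_atTop 3,
    (hexp (A₄ / 20) (by positivity)).eventually_ge_atTop (8 * A₂),
    (hexp (9 / 10 * A₄) (by positivity)).eventually_ge_atTop 2,
    (hexp A₃ hA₃).eventually_ge_atTop A₁,
    (hexp 1 one_pos).eventually_ge_atTop A₁⁻¹,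
    hL.eventually_ge_atTop 6400] with p h1 h2 h3 h4 h5 h6
  refine ⟨h1, h2, ?_, ?_, by simpa using h5, ?_⟩
  · rw [neg_mul, Real.exp_neg, one_div]
    exact inv_anti₀ two_pos h3
  · rw [inv_mul_eq_div, one_le_div hA₁]
    exact h4
  · have h7 : √(Real.log p) ^ 2 = Real.log p := Real.sq_sqrt (by linarith)
    have h8 : 80 ≤ √(Real.log p) := by
      refine Real.le_sqrt_of_sq_le ?_
      linarith
    nlinarith

variable {A₁ A₂ A₃ A₄ : ℝ} {p : ℕ}

theorem LargeDim.p_pos (hp : LargeDim A₁ A₂ A₃ A₄ p) : (0 : ℝ) < p := by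
  have := hp.three_le
  positivity

theorem LargeDim.one_le_log (hp : LargeDim A₁ A₂ A₃ A₄ p) : 1 ≤ Real.log p := by
  have := hp.sqrt
  have := Real.sqrt_nonneg (Real.log p)
  linarith

end Large

/-! ### Admissible problems -/

section Core

/-- A regression problem with a prior in the admissible range. -/
structure Admissible (A₁ A₂ A₃ A₄ : ℝ) {n p : ℕ} (X : Matrix (Fin n) (Fin p) ℝ) (lam : ℝ)
    (w : ℕ → ℝ) : Prop where
  lam_pos : 0 < lam
  le_lam : colNorm X / p ≤ lam
  lam_le : lam ≤ 2 * lamBar X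
  dimensionPrior : DimensionPrior A₁ A₂ A₃ A₄ p w

variable {A₁ A₂ A₃ A₄ : ℝ} {n p : ℕ} {X : Matrix (Fin n) (Fin p) ℝ} {lam : ℝ} {w : ℕ → ℝ}

theorem Admissible.colNorm_pos (h : Admissible A₁ A₂ A₃ A₄ X lam w) : 0 < colNorm X := by
  refine lt_of_le_of_ne (colNorm_nonneg X) fun h0 => ?_
  have h1 := h.lam_le
  rw [lamBar, ← h0] at h1
  have h2 := h.lam_pos
  simp at h1
  linarith

/-- `f` is a lower bound for the compatibility number of `S`. -/
def CompatBound (X : Matrix (Fin n) (Fin p) ℝ) (S : Finset (Fin p)) (f : ℝ) : Prop :=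
  ∀ v : Fin p → ℝ, ∑ i ∈ Sᶜ, |v i| ≤ 7 * ∑ i ∈ S, |v i| →
    f * colNorm X * ∑ i ∈ S, |v i| ≤ lqNorm 2 (X *ᵥ v) * √(S.card : ℝ)

theorem compatBound_empty (X : Matrix (Fin n) (Fin p) ℝ) (f : ℝ) : CompatBound X ∅ f := by
  intro v _
  simp

/-- Let a and b be the ℓ¹ masses of β - β₀ on S and off S. Since ‖β₀‖₁ ≤ ‖β‖₁ + a - b, what must be
controlled is λ(5a/4 - 3b/4). Outside the cone b ≤ 7a this is nonpositive; inside it, compatibility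
bounds a by the prediction norm and the product is split by the arithmetic-geometric inequality. -/
theorem CompatBound.le_add {S : Finset (Fin p)} {f : ℝ} (hc : CompatBound X S f) (hf : 0 < f)
    (hX : 0 < colNorm X) (hlam : 0 < lam) {θ : ℝ} (hθ : 0 < θ) {β₀ : Fin p → ℝ}
    (hβ₀ : ∀ i ∉ S, β₀ i = 0) (β : Fin p → ℝ) :
    lam * lqNorm 1 β₀ - θ / 8 * lqNorm 2 (X *ᵥ (β - β₀)) ^ 2
      ≤ lam * lqNorm 1 β - lam / 4 * lqNorm 1 (β - β₀) +
        25 / (8 * θ) * (lam / (colNorm X * f)) ^ 2 * S.card := by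
  set h := β - β₀
  set a := ∑ i ∈ S, |h i|
  set b := ∑ i ∈ Sᶜ, |h i|
  have ha : 0 ≤ a := by positivity
  have hb : 0 ≤ b := by positivity
  have h1 : lqNorm 1 h = a + b := by rw [lqNorm_one, Finset.sum_add_sum_compl]
  have h2 : lqNorm 1 β₀ ≤ lqNorm 1 β + a - b := by
    rw [lqNorm_one, lqNorm_one, ← Finset.sum_add_sum_compl S, ← Finset.sum_add_sum_compl S]
    have h3 : ∑ i ∈ S, |β₀ i| ≤ ∑ i ∈ S, |β i| + a := by
      rw [← Finset.sum_add_distrib]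
      refine Finset.sum_le_sum fun i _ => ?_
      have := abs_sub_abs_le_abs_sub (β₀ i) (β i)
      rw [abs_sub_comm] at this
      simp only [h, Pi.sub_apply]
      linarith
    have h4 : ∑ i ∈ Sᶜ, |β₀ i| = 0 := Finset.sum_eq_zero fun i hi => by
      simp [hβ₀ i (Finset.mem_compl.1 hi)]
    have h5 : ∑ i ∈ Sᶜ, |β i| = b := Finset.sum_congr rfl fun i hi => by
      simp [h, hβ₀ i (Finset.mem_compl.1 hi)]
    linarith
  set x := lqNorm 2 (X *ᵥ h)
  have hx : 0 ≤ x := lqNorm_nonneg 2 _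
  rw [h1]
  have hG : 0 ≤ 25 / (8 * θ) * (lam / (colNorm X * f)) ^ 2 * S.card := by positivity
  have h6 := mul_le_mul_of_nonneg_left h2 hlam.le
  have hxx : 0 ≤ θ / 8 * x ^ 2 := by positivity
  rcases le_or_gt b (7 * a) with hab | hab
  · have h7 := hc h hab
    set t := √(S.card : ℝ)
    have ht : t ^ 2 = S.card := Real.sq_sqrt (Nat.cast_nonneg _)
    rw [← ht]
    set u := lam / (colNorm X * f)
    have hu : 0 ≤ u := by positivity
    have h8 : lam * a ≤ u * (x * t) := by
      have := mul_le_mul_of_nonneg_left h7 hu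
      calc lam * a = u * (f * colNorm X * a) := by simp only [u]; field_simp
        _ ≤ _ := this
    have h9 : 5 / 4 * (u * (x * t)) ≤ θ / 8 * x ^ 2 + 25 / (8 * θ) * u ^ 2 * t ^ 2 := by
      have h10 : θ / 8 * x ^ 2 + 25 / (8 * θ) * u ^ 2 * t ^ 2 - 5 / 4 * (u * (x * t))
          = (θ * x - 5 * u * t) ^ 2 / (8 * θ) := by
        field_simp
        ring
      have h11 : 0 ≤ (θ * x - 5 * u * t) ^ 2 / (8 * θ) := by positivity
      linarith
    have h12 : 0 ≤ lam * b := by positivity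
    linarith
  · have h13 := mul_lt_mul_of_pos_left hab hlam
    have h14 := mul_nonneg hlam.le ha
    linarith

/-- The exponent used to split the likelihood ratio. -/
def splitExp (A₄ : ℝ) : ℝ := min A₄ 1 / 240

theorem splitExp_pos (hA₄ : 0 < A₄) : 0 < splitExp A₄ := by
  unfold splitExp; positivity

/-- As 240 = 12 · 20, the noise price p^(12θ) is at most both p^(1/20) and p^(A₄/20). -/
theorem splitExp_le (A₄ : ℝ) : splitExp A₄ ≤ 1 / 240 ∧ splitExp A₄ ≤ A₄ / 240 := by
  unfold splitExp
  have h1 := min_le_left A₄ 1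
  have h2 := min_le_right A₄ 1
  constructor <;> linarith

/-- The ratio of the sum over dimensions. Of the prior decay p^(-A₄), a twentieth absorbs the
constant 8A₂ and another twentieth the noise price. -/
theorem LargeDim.geometric_le (hp : LargeDim A₁ A₂ A₃ A₄ p) :
    A₂ * Real.exp (-A₄ * Real.log p) * (8 * Real.exp (12 * splitExp A₄ * Real.log p))
      ≤ Real.exp (-(9 / 10 * A₄) * Real.log p) := by
  have hL := hp.one_le_log
  calc _ = (8 * A₂) * Real.exp (-A₄ * Real.log p + 12 * splitExp A₄ * Real.log p) := by
        rw [Real.exp_add]; ring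
    _ ≤ Real.exp (A₄ / 20 * Real.log p) *
        Real.exp (-A₄ * Real.log p + 12 * splitExp A₄ * Real.log p) := by
        gcongr; exact hp.upper
    _ ≤ _ := by
        rw [← Real.exp_add]
        refine Real.exp_le_exp.2 ?_
        have := (splitExp_le A₄).2
        nlinarith

/-- The box around β₀ has side of order 1/s, which costs s^s in volume. The s! in the count of
models of size s compensates this up to e^s. -/
theorem choose_mul_inv_pow_le {s : ℕ} (hs : 1 ≤ s) (hp : 0 < p)
    {u : ℝ} (hu : 1 / (p * s : ℝ) ≤ u) :
    (p.choose s : ℝ) * (u ^ s)⁻¹ ≤ Real.exp (2 * s * Real.log p + s) := by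
  have hp' : (0 : ℝ) < p := by exact_mod_cast hp
  have hs' : (0 : ℝ) < s := by exact_mod_cast hs
  have hu0 : 0 < u := lt_of_lt_of_le (by positivity) hu
  calc (p.choose s : ℝ) * (u ^ s)⁻¹ ≤ (p ^ s / s.factorial) * (p * s : ℝ) ^ s := by
        gcongr
        · exact Nat.choose_le_pow_div s p
        · rw [← inv_pow]
          gcongr
          rw [inv_le_comm₀ hu0 (by positivity), ← one_div]
          exact hu
    _ = (p ^ s) ^ 2 * ((s : ℝ) ^ s / s.factorial) := by rw [mul_pow]; ring
    _ ≤ (p ^ s) ^ 2 * Real.exp s := by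
        gcongr
        exact Real.pow_div_factorial_le_exp _ hs'.le _
    _ = _ := by
        rw [Real.exp_add, show 2 * (s : ℝ) * Real.log p = ((s * 2 : ℕ) : ℝ) * Real.log p by
          push_cast; ring, Real.exp_nat_mul, Real.exp_log hp', pow_mul]

/-- The master bound with its constants simplified. -/
theorem Admissible.expectedPosterior_le (h : Admissible A₁ A₂ A₃ A₄ X lam w) (hA₁ : 0 < A₁)
    (hA₄ : 0 < A₄) (hp : LargeDim A₁ A₂ A₃ A₄ p) {β₀ : Fin p → ℝ} (hs₀ : 1 ≤ (supp β₀).card)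
    {f : ℝ} (hf : 0 < f) (hc : CompatBound X (supp β₀) f) {r : ℝ} {N : ℕ}
    {B : Set (Fin p → ℝ)} (hBm : MeasurableSet B)
    (hr : ∀ β ∈ B, r ≤ splitExp A₄ / 8 * lqNorm 2 (X *ᵥ (β - β₀)) ^ 2
      + lam / 8 * lqNorm 1 (β - β₀))
    (hN : ∀ β ∈ B, N ≤ (supp β).card) :
    expectedPosterior X (prior p w lam) β₀ B ≤ ENNReal.ofReal (1 / p) + ENNReal.ofReal
      (Real.exp ((2 + 3 / 20) * (supp β₀).card * Real.log p - 5 * (supp β₀).card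
        + 25 / (8 * splitExp A₄) * (lam / (colNorm X * f)) ^ 2 * (supp β₀).card - r) *
      ∑ s ∈ Finset.Icc N p, w s / w (supp β₀).card *
        (8 * Real.exp (12 * splitExp A₄ * Real.log p)) ^ s) := by
  have hp0 : 0 < p := by have := hp.three_le; omega
  have hL := hp.one_le_log
  have hX := h.colNorm_pos
  have hlam := h.lam_pos
  have hθ := splitExp_pos hA₄
  set s₀ := (supp β₀).card
  have hs₀p : s₀ ≤ p := by simpa using Finset.card_le_univ (supp β₀)
  have hs₀' : (1 : ℝ) ≤ s₀ := by exact_mod_cast hs₀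
  have hw := h.dimensionPrior.pos hA₁ hp0
  set L := Real.log p
  obtain ⟨T, hT, hTp, hTU⟩ := exists_noise_event X hp.three_le β₀
  -- The largest half-side for which X maps the box around β₀ into the unit ball by the ℓ¹ bound.
  set δ : ℝ := 1 / (colNorm X * s₀)
  have hδ : 0 < δ := by positivity
  have hδs : δ * s₀ = 1 / colNorm X := by simp only [δ]; field_simp
  have hmaster := expectedPosterior_le_master hlam hw hT hTU (by linarith) hδ
    (by rw [hδs]; field_simp; rfl) hθ.le (by linarith [(splitExp_le A₄).1]) hBm
    (fun β _ => hc.le_add hf hX hlam hθ eq_zero_of_notMem_supp β) hr hN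
  refine hmaster.trans ?_
  gcongr
  have hsum : 0 ≤ ∑ s ∈ Finset.Icc N p, w s / w s₀ *
      (8 * Real.exp (12 * splitExp A₄ * L)) ^ s :=
    Finset.sum_nonneg fun s hs => mul_nonneg
      (div_nonneg (hw s (Finset.mem_Icc.1 hs).2).le (hw s₀ hs₀p).le) (by positivity)
  gcongr
  have h1 : 1 / ((p : ℝ) * s₀) ≤ lam * δ := by
    have h2 := h.le_lam
    have hp' := hp.p_pos
    rw [div_le_iff₀ hp'] at h2
    simp only [δ]
    rw [mul_one_div, div_le_div_iff₀ (by positivity) (by positivity)]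
    nlinarith
  have h3 := choose_mul_inv_pow_le hs₀ hp0 h1
  have h4 : lam * δ * s₀ ≤ 4 * √L := by
    have h5 := h.lam_le
    rw [lamBar] at h5
    rw [mul_assoc, hδs, mul_one_div, div_le_iff₀ hX]
    linarith
  refine (mul_le_mul_of_nonneg_right h3 (Real.exp_pos _).le).trans ?_
  rw [← Real.exp_add]
  refine Real.exp_le_exp.2 ?_
  have h6 := hp.sqrt
  have h7 := mul_le_mul_of_nonneg_right (splitExp_le A₄).1 (by positivity : 0 ≤ s₀ * L)
  -- The 7s₀ covers e^s₀ from the model count, the 1/2 from the box, and 5s₀ kept in reserve to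
  -- absorb constants raised to the power s₀ later. All of it, with 4√L from λδs₀, fits in s₀L/10.
  have h8 : 7 * (s₀ : ℝ) + 4 * √L ≤ s₀ * (7 + 4 * √L) := by
    have : 0 ≤ √L := Real.sqrt_nonneg _
    nlinarith
  have h9 : (s₀ : ℝ) * (7 + 4 * √L) ≤ s₀ * (L / 10) := by gcongr
  linarith

/-- Sets that are far from `β₀` in prediction or `ℓ¹` norm have small posterior mass. -/
theorem Admissible.expectedPosterior_le_of_far (h : Admissible A₁ A₂ A₃ A₄ X lam w)
    (hA₁ : 0 < A₁) (hA₂ : 0 < A₂) (hA₄ : 0 < A₄) (hp : LargeDim A₁ A₂ A₃ A₄ p)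
    {β₀ : Fin p → ℝ} (hs₀ : 1 ≤ (supp β₀).card)
    {f : ℝ} (hf : 0 < f) (hc : CompatBound X (supp β₀) f)
    {B : Set (Fin p → ℝ)} (hBm : MeasurableSet B)
    (hr : ∀ β ∈ B, (A₃ + 5) * (supp β₀).card * Real.log p
      + 25 / (8 * splitExp A₄) * (lam / (colNorm X * f)) ^ 2 * (supp β₀).card
      ≤ splitExp A₄ / 8 * lqNorm 2 (X *ᵥ (β - β₀)) ^ 2 + lam / 8 * lqNorm 1 (β - β₀)) :
    expectedPosterior X (prior p w lam) β₀ B ≤ ENNReal.ofReal (2 / p) := by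
  have hp0 : 0 < p := by have := hp.three_le; omega
  have hL := hp.one_le_log
  have hs₀p : (supp β₀).card ≤ p := by simpa using Finset.card_le_univ (supp β₀)
  refine (h.expectedPosterior_le hA₁ hA₄ hp hs₀ hf hc hBm hr
    fun β _ => Nat.zero_le _).trans ?_
  rw [← ENNReal.ofReal_add (by positivity) (mul_nonneg (Real.exp_pos _).le
    (Finset.sum_nonneg fun s hs => mul_nonneg (div_nonneg
      (h.dimensionPrior.nonneg s (Finset.mem_Icc.1 hs).2)
      (h.dimensionPrior.nonneg _ hs₀p)) (by positivity)))]
  refine ENNReal.ofReal_le_ofReal ?_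
  rw [show (2 : ℝ) / p = 1 / p + 1 / p by ring]
  gcongr
  have h1 := h.dimensionPrior.sum_le hA₁ hA₂ hp0
    (a := 8 * Real.exp (12 * splitExp A₄ * Real.log p)) (by
      have : 1 ≤ Real.exp (12 * splitExp A₄ * Real.log p) :=
        Real.one_le_exp (by have := splitExp_pos hA₄; positivity)
      linarith) (hp.geometric_le.trans hp.half) hp.lower hs₀p hs₀
  have h2 : 3 * (8 * Real.exp (12 * splitExp A₄ * Real.log p)) *
      (A₁⁻¹ * Real.exp (A₃ * Real.log p))
      ≤ Real.exp (4 + (1 / 20 + 1 + A₃) * Real.log p) := by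
    calc _ = 24 * Real.exp (12 * splitExp A₄ * Real.log p) * A₁⁻¹ *
          Real.exp (A₃ * Real.log p) := by ring
      _ ≤ Real.exp 4 * Real.exp (1 / 20 * Real.log p) * Real.exp (Real.log p) *
          Real.exp (A₃ * Real.log p) := by
          have h3 : (24 : ℝ) ≤ Real.exp 4 := by
            have h4 := Real.exp_one_gt_d9
            rw [show (4 : ℝ) = (4 : ℕ) * 1 by norm_num, Real.exp_nat_mul]
            calc (24 : ℝ) ≤ 2.7 ^ 4 := by norm_num
              _ ≤ _ := by gcongr; linarith
          have h5 := (splitExp_le A₄).1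
          gcongr
          · linarith
          · exact hp.inv
      _ = _ := by
          rw [← Real.exp_add, ← Real.exp_add, ← Real.exp_add]
          ring_nf
  have h3 := h1.trans (pow_le_pow_left₀ (by positivity) h2 _)
  rw [← Real.exp_nat_mul] at h3
  refine (mul_le_mul_of_nonneg_left h3 (Real.exp_pos _).le).trans ?_
  have hinv : 1 / (p : ℝ) = Real.exp (-Real.log p) := by
    rw [Real.exp_neg, Real.exp_log hp.p_pos, one_div]
  rw [← Real.exp_add, hinv]
  refine Real.exp_le_exp.2 ?_
  have hs₀' : (1 : ℝ) ≤ (supp β₀).card := by exact_mod_cast hs₀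
  -- The coefficient of s₀ log p is 2 + 3/20 + 21/20 + A₃ = A₃ + 3.2, against A₃ + 5 in the assumed
  -- lower bound, and the reserve -5s₀ beats 4s₀.
  nlinarith

/-- The posterior concentrates on vectors with few nonzero coordinates. -/
theorem Admissible.expectedPosterior_le_of_card (h : Admissible A₁ A₂ A₃ A₄ X lam w)
    (hA₁ : 0 < A₁) (hA₂ : 0 < A₂) (hA₄ : 0 < A₄) (hp : LargeDim A₁ A₂ A₃ A₄ p)
    {β₀ : Fin p → ℝ} (hs₀ : 1 ≤ (supp β₀).card)
    {f : ℝ} (hf : 0 < f) (hc : CompatBound X (supp β₀) f)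
    (hlam : lam / lamBar X ≤ 2 * splitExp A₄ * A₄)
    {B : Set (Fin p → ℝ)} (hBm : MeasurableSet B)
    (hB : ∀ β ∈ B, (1 + 3 / A₄ + 33 / f ^ 2 * (lam / lamBar X)) * (supp β₀).card
      ≤ (supp β).card) :
    expectedPosterior X (prior p w lam) β₀ B
      ≤ ENNReal.ofReal (1 / p + Real.exp (-(1 / 2) * Real.log p)) := by
  have hp0 : 0 < p := by have := hp.three_le; omega
  have hL := hp.one_le_log
  have hX := h.colNorm_pos
  have hθ := splitExp_pos hA₄
  set s₀ := (supp β₀).card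
  have hs₀p : s₀ ≤ p := by simpa using Finset.card_le_univ (supp β₀)
  have hs₀' : (1 : ℝ) ≤ s₀ := by exact_mod_cast hs₀
  set τ := lam / lamBar X
  have hlamBar : 0 < lamBar X := by
    have : 0 < √(Real.log p) := Real.sqrt_pos.2 (by linarith)
    unfold lamBar; positivity
  have hτ : 0 ≤ τ := div_nonneg h.lam_pos.le hlamBar.le
  set d := (1 + 3 / A₄ + 33 / f ^ 2 * τ) * s₀
  set N := ⌈d⌉₊
  have hd : (s₀ : ℝ) ≤ d := by
    have : 0 ≤ 3 / A₄ + 33 / f ^ 2 * τ := by positivity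
    simp only [d]
    nlinarith
  have hNd : d ≤ N := Nat.le_ceil d
  have hN : s₀ ≤ N := by exact_mod_cast hd.trans hNd
  refine (h.expectedPosterior_le hA₁ hA₄ hp hs₀ hf hc hBm (r := 0) (N := N)
    (fun β _ => ?_) fun β hβ => Nat.ceil_le.2 (hB β hβ)).trans ?_
  · have h1 := lqNorm_nonneg 1 (β - β₀)
    have h2 := h.lam_pos
    positivity
  rw [← ENNReal.ofReal_add (by positivity) (mul_nonneg (Real.exp_pos _).le
    (Finset.sum_nonneg fun s hs => mul_nonneg (div_nonneg
      (h.dimensionPrior.nonneg s (Finset.mem_Icc.1 hs).2)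
      (h.dimensionPrior.nonneg _ hs₀p)) (by positivity)))]
  refine ENNReal.ofReal_le_ofReal ?_
  gcongr
  have h1 := h.dimensionPrior.sum_le_of_le hA₁ hA₂ hp0
    (a := 8 * Real.exp (12 * splitExp A₄ * Real.log p)) (by positivity)
    (hp.geometric_le.trans hp.half) hs₀p hN
  have h2 : 2 * ((8 * Real.exp (12 * splitExp A₄ * Real.log p)) ^ s₀ *
      (A₂ * Real.exp (-A₄ * Real.log p) *
        (8 * Real.exp (12 * splitExp A₄ * Real.log p))) ^ (N - s₀))
      ≤ Real.exp (s₀ * (4 + 1 / 20 * Real.log p) +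
        (N - s₀) * (-(9 / 10 * A₄) * Real.log p)) := by
    calc _ ≤ 2 ^ s₀ * ((8 * Real.exp (12 * splitExp A₄ * Real.log p)) ^ s₀ *
          (Real.exp (-(9 / 10 * A₄) * Real.log p)) ^ (N - s₀)) := by
          gcongr
          · exact le_self_pow₀ (by norm_num) (by omega)
          · exact hp.geometric_le
      _ = (16 * Real.exp (12 * splitExp A₄ * Real.log p)) ^ s₀ *
          (Real.exp (-(9 / 10 * A₄) * Real.log p)) ^ (N - s₀) := by
          rw [← mul_assoc, ← mul_pow]
          ring_nf
      _ ≤ (Real.exp 4 * Real.exp (1 / 20 * Real.log p)) ^ s₀ *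
          (Real.exp (-(9 / 10 * A₄) * Real.log p)) ^ (N - s₀) := by
          have h3 : (16 : ℝ) ≤ Real.exp 4 := by
            have h4 := Real.exp_one_gt_d9
            rw [show (4 : ℝ) = (4 : ℕ) * 1 by norm_num, Real.exp_nat_mul]
            calc (16 : ℝ) ≤ 2.7 ^ 4 := by norm_num
              _ ≤ _ := by gcongr; linarith
          have h5 := (splitExp_le A₄).1
          gcongr
          linarith
      _ = _ := by
          rw [← Real.exp_add, ← Real.exp_nat_mul, ← Real.exp_nat_mul, ← Real.exp_add,
            Nat.cast_sub hN]
  refine (mul_le_mul_of_nonneg_left (h1.trans h2) (Real.exp_pos _).le).trans ?_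
  rw [← Real.exp_add]
  refine Real.exp_le_exp.2 ?_
  set L := Real.log p
  have hG : 25 / (8 * splitExp A₄) * (lam / (colNorm X * f)) ^ 2
      = 25 / (2 * splitExp A₄) * τ ^ 2 / f ^ 2 * L := by
    have h6 : √L ^ 2 = L := Real.sq_sqrt (by linarith)
    have h7 : lam = τ * (2 * colNorm X * √L) := (div_mul_cancel₀ lam hlamBar.ne').symm
    have h8 : (lam / (colNorm X * f)) ^ 2 = 4 * τ ^ 2 * L / f ^ 2 := by
      calc (lam / (colNorm X * f)) ^ 2 = (τ * (2 * colNorm X * √L) / (colNorm X * f)) ^ 2 := by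
            rw [← h7]
        _ = 4 * τ ^ 2 * √L ^ 2 / f ^ 2 := by field_simp; ring
        _ = _ := by rw [h6]
    rw [h8]
    field_simp
    ring
  -- The cost of compatibility is quadratic in λ/λ̄ with a large factor 1/θ. Below the assumed
  -- threshold one factor λ/λ̄ absorbs it, leaving a linear cost with constant 25.
  have hG' : 25 / (8 * splitExp A₄) * (lam / (colNorm X * f)) ^ 2
      ≤ 25 * A₄ * τ / f ^ 2 * L := by
    rw [hG]
    have h8 : 25 / (2 * splitExp A₄) * τ ^ 2 ≤ 25 * A₄ * τ := by
      rw [div_mul_eq_mul_div, div_le_iff₀ (by positivity)]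
      nlinarith [mul_le_mul_of_nonneg_left hlam hτ]
    gcongr
  have h9 : (3 / A₄ + 33 / f ^ 2 * τ) * s₀ ≤ N - s₀ := by
    have : d = s₀ + (3 / A₄ + 33 / f ^ 2 * τ) * s₀ := by simp only [d]; ring
    linarith
  -- Each excess dimension gains p^(-9A₄/10). The excess 3/A₄ yields 2.7 s₀L against a cost of 2.2
  -- s₀L, leaving p^(-1/2); the excess with factor 33 yields 29.7 against the 25 of `hG'`.
  have h10 := mul_le_mul_of_nonneg_left h9 (by positivity : 0 ≤ 9 / 10 * A₄ * L)
  have h11 : 9 / 10 * A₄ * L * ((3 / A₄ + 33 / f ^ 2 * τ) * s₀)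
      = 27 / 10 * (L * s₀) + 297 / 10 * (A₄ * τ / f ^ 2 * L * s₀) := by
    field_simp
    ring
  have h12 := mul_le_mul_of_nonneg_right hG' (by positivity : (0 : ℝ) ≤ s₀)
  have h13 : 0 ≤ A₄ * τ / f ^ 2 * L * s₀ := by positivity
  have h14 : L * 1 ≤ L * s₀ := by gcongr
  have h15 : 25 * A₄ * τ / f ^ 2 * L * s₀ = 25 * (A₄ * τ / f ^ 2 * L * s₀) := by ring
  linarith

/-- If `β₀ = 0`, then the posterior concentrates at zero. -/
theorem Admissible.expectedPosterior_le_of_zero (h : Admissible A₁ A₂ A₃ A₄ X lam w)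
    (hA₁ : 0 < A₁) (hA₂ : 0 < A₂) (hA₄ : 0 < A₄) (hp : LargeDim A₁ A₂ A₃ A₄ p)
    {β₀ : Fin p → ℝ} (hs₀ : (supp β₀).card = 0)
    {B : Set (Fin p → ℝ)} (hB : ∀ β ∈ B, β ≠ β₀) :
    expectedPosterior X (prior p w lam) β₀ B
      ≤ ENNReal.ofReal (1 / p + 4 * Real.exp (-(9 / 10 * A₄) * Real.log p)) := by
  have hp0 : 0 < p := by have := hp.three_le; omega
  have hL := hp.one_le_log
  have hX := h.colNorm_pos
  have hlam := h.lam_pos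
  have hθ := splitExp_pos hA₄
  have hS₀ : supp β₀ = ∅ := Finset.card_eq_zero.1 hs₀
  have hβ₀ : β₀ = 0 := by
    ext i
    exact eq_zero_of_notMem_supp i (by simp [hS₀])
  obtain ⟨T, hT, hTp, hTU⟩ := exists_noise_event X hp.three_le β₀
  -- For the empty model compatibility is free, and every nonzero β has at least one nonzero
  -- coordinate. Passing to the complement of zero also supplies a measurable set.
  have hmaster := expectedPosterior_le_master (r := 0) (N := 1) (B := {0}ᶜ) hlam
    (h.dimensionPrior.pos hA₁ hp0) hT hTU (by linarith) one_pos (by simp [hs₀]) hθ.le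
    (by linarith [(splitExp_le A₄).1]) (measurableSet_singleton _).compl
    (fun β _ => CompatBound.le_add (compatBound_empty X 1) one_pos hX hlam hθ
      (fun i _ => by simp [hβ₀]) β)
    (fun β _ => by have := lqNorm_nonneg 1 (β - β₀); positivity)
    (fun β hβ => by
      rw [Nat.one_le_iff_ne_zero, Ne, Finset.card_eq_zero]
      intro h0
      exact hβ (funext fun i => eq_zero_of_notMem_supp i (by simp [h0])))
  have hsub : B ⊆ {0}ᶜ := fun β hβ h0 => hB β hβ (by rw [hβ₀]; exact h0)
  refine (lintegral_mono fun y => measure_mono hsub).trans (hmaster.trans ?_)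
  rw [ENNReal.ofReal_add (by positivity) (by positivity)]
  refine add_le_add hTp (ENNReal.ofReal_le_ofReal ?_)
  have h1 := h.dimensionPrior.sum_le_of_le hA₁ hA₂ hp0
    (a := 8 * Real.exp (12 * splitExp A₄ * Real.log p)) (by positivity)
    (hp.geometric_le.trans hp.half) (Nat.zero_le p) (Nat.zero_le 1)
  rw [pow_zero, one_mul, pow_one] at h1
  rw [hs₀]
  have h2 := hp.geometric_le
  have h3 : Real.exp (1 / 2) ≤ 2 := by
    have h4 := Real.exp_one_lt_d9
    have h5 : Real.exp (1 / 2) ^ 2 = Real.exp 1 := by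
      rw [← Real.exp_nat_mul]; norm_num
    have h6 := Real.exp_pos (1 / 2)
    nlinarith
  have h7 := Real.exp_pos (-(9 / 10 * A₄) * Real.log p)
  simp only [Finset.card_empty, Nat.cast_zero, mul_zero, zero_mul, add_zero, zero_add, sub_zero,
    Nat.choose_zero_right, Nat.cast_one, pow_zero, inv_one, one_mul]
  calc _ ≤ 2 * (2 * Real.exp (-(9 / 10 * A₄) * Real.log p)) := by
        have h8 := h1.trans (mul_le_mul_of_nonneg_left h2 two_pos.le)
        exact mul_le_mul h3 h8 (Finset.sum_nonneg fun s hs => mul_nonneg (div_nonneg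
          (h.dimensionPrior.nonneg s (Finset.mem_Icc.1 hs).2)
          (h.dimensionPrior.nonneg 0 (Nat.zero_le p))) (by positivity)) two_pos.le
    _ = _ := by ring_nf

end Core

/-! ### Design indices -/

section Indices

variable {n p : ℕ} {X : Matrix (Fin n) (Fin p) ℝ}

theorem lqNorm_one_restrict (S : Finset (Fin p)) (v : Fin p → ℝ) :
    lqNorm 1 (S.restrict v) = ∑ i ∈ S, |v i| := by
  rw [lqNorm_one]
  exact Finset.sum_coe_sort S fun i => |v i|

theorem supp_single {i : Fin p} : supp (Pi.single i (1 : ℝ)) = {i} := by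
  ext j
  rw [mem_supp, Finset.mem_singleton]
  by_cases h : j = i
  · subst h; simp
  · simp [h]

theorem lqNorm_mulVec_single (i : Fin p) :
    lqNorm 2 (X *ᵥ Pi.single i 1) = lqNorm 2 (Xᵀ i) := by
  rw [Matrix.mulVec_single_one]
  rfl

theorem compatBound_of_le_compat (hX : 0 < colNorm X) {S : Finset (Fin p)} {f : ℝ}
    (h : ENNReal.ofReal f ≤ compat X S) : CompatBound X S f := by
  intro v hv
  set a := ∑ i ∈ S, |v i|
  have ha : 0 ≤ a := by positivity
  rcases ha.eq_or_lt with ha0 | ha0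
  · rw [← ha0, mul_zero]
    exact mul_nonneg (lqNorm_nonneg 2 _) (Real.sqrt_nonneg _)
  have h1 : S.restrict v ≠ 0 := by
    intro h0
    have h2 := lqNorm_one_restrict S v
    rw [h0, lqNorm_one] at h2
    simp at h2
    exact ha0.ne h2
  have h3 : compat X S ≤ ENNReal.ofReal
      (lqNorm 2 (X *ᵥ v) * √(S.card : ℝ) / (colNorm X * lqNorm 1 (S.restrict v))) :=
    iInf_le_of_le v (iInf_le_of_le (by rw [lqNorm_one_restrict, lqNorm_one_restrict]; exact hv)
      (iInf_le _ h1))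
  rw [lqNorm_one_restrict] at h3
  have h4 := (ENNReal.ofReal_le_ofReal_iff (div_nonneg
    (mul_nonneg (lqNorm_nonneg 2 _) (Real.sqrt_nonneg _)) (by positivity))).1 (h.trans h3)
  rwa [le_div_iff₀ (by positivity), ← mul_assoc] at h4

/-- Greedy signs: each new sign is chosen to make the cross term nonpositive, so every added column
increases the squared norm by at most ‖X‖². -/
theorem exists_signs_lqNorm_le (S : Finset (Fin p)) : ∃ v : Fin p → ℝ, (∀ i ∉ S, v i = 0) ∧
    (∀ i ∈ S, |v i| = 1) ∧ lqNorm 2 (X *ᵥ v) ^ 2 ≤ S.card * colNorm X ^ 2 := by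
  induction S using Finset.induction_on with
  | empty => exact ⟨0, by simp, by simp, by simp [lqNorm]⟩
  | insert i S hi ih =>
    obtain ⟨v, h0, h1, h2⟩ := ih
    have hcol : lqNorm 2 (Xᵀ i) ^ 2 ≤ colNorm X ^ 2 :=
      pow_le_pow_left₀ (lqNorm_nonneg 2 _) (col_le_colNorm X i) 2
    have key : ∀ σ : ℝ, σ ^ 2 = 1 → σ * ((X *ᵥ v) ⬝ᵥ Xᵀ i) ≤ 0 →
        ∃ v : Fin p → ℝ, (∀ j ∉ insert i S, v j = 0) ∧ (∀ j ∈ insert i S, |v j| = 1) ∧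
          lqNorm 2 (X *ᵥ v) ^ 2 ≤ (insert i S).card * colNorm X ^ 2 := by
      intro σ hσ hle
      refine ⟨v + σ • Pi.single i 1, fun j hj => ?_, fun j hj => ?_, ?_⟩
      · rw [Finset.mem_insert, not_or] at hj
        simp [h0 j hj.2, hj.1]
      · rcases Finset.mem_insert.1 hj with rfl | hj'
        · have : |σ| = 1 := by rwa [← sq_eq_sq₀ (abs_nonneg _) zero_le_one, sq_abs, one_pow]
          simp [h0 _ hi, this]
        · have hji : j ≠ i := by rintro rfl; exact hi hj'
          simp [hji, h1 j hj']
      · have h3 : X *ᵥ (v + σ • Pi.single i 1) = X *ᵥ v + σ • Xᵀ i := by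
          rw [Matrix.mulVec_add, Matrix.mulVec_smul, Matrix.mulVec_single_one]
          rfl
        rw [h3, lqNorm_two_sq, Finset.card_insert_of_notMem hi]
        simp only [add_dotProduct, dotProduct_add, smul_dotProduct, dotProduct_smul, smul_eq_mul]
        rw [← lqNorm_two_sq, ← lqNorm_two_sq, dotProduct_comm (Xᵀ i)]
        push_cast
        have h4 : σ * (σ * lqNorm 2 (Xᵀ i) ^ 2) = lqNorm 2 (Xᵀ i) ^ 2 := by
          rw [← mul_assoc, ← pow_two, hσ, one_mul]
        linarith
    rcases le_total ((X *ᵥ v) ⬝ᵥ Xᵀ i) 0 with h | h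
    · exact key 1 (by norm_num) (by linarith)
    · exact key (-1) (by norm_num) (by linarith)

/-- The greedy sign vector on S is the test vector. The bound shows that the index is finite and
lets 1/φ² dominate constants. -/
theorem compat_le_one (hX : 0 < colNorm X) {S : Finset (Fin p)} (hS : 1 ≤ S.card) :
    compat X S ≤ 1 := by
  obtain ⟨v, h0, h1, h2⟩ := exists_signs_lqNorm_le (X := X) S
  have hsum : ∑ i ∈ S, |v i| = S.card := by
    rw [Finset.sum_congr rfl h1]; simp
  have hS' : (0 : ℝ) < S.card := by exact_mod_cast hS
  refine iInf_le_of_le v (iInf_le_of_le ?_ (iInf_le_of_le ?_ ?_))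
  · rw [lqNorm_one_restrict, lqNorm_one_restrict, hsum,
      Finset.sum_eq_zero fun i hi => by simp [h0 i (Finset.mem_compl.1 hi)]]
    positivity
  · intro h
    have h3 := lqNorm_one_restrict S v
    rw [h, lqNorm_one, hsum] at h3
    simp at h3
    linarith
  · rw [lqNorm_one_restrict, hsum, ← ENNReal.ofReal_one]
    refine ENNReal.ofReal_le_ofReal (div_le_one_of_le₀ ?_ (by positivity))
    have hs : √(S.card : ℝ) ^ 2 = S.card := Real.sq_sqrt hS'.le
    have h3 : lqNorm 2 (X *ᵥ v) ≤ √(S.card : ℝ) * colNorm X := by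
      refine abs_le_of_sq_le_sq' ?_ (by positivity) |>.2
      rw [mul_pow, hs]
      exact h2
    calc _ ≤ (√(S.card : ℝ) * colNorm X) * √(S.card : ℝ) := by gcongr
      _ = colNorm X * √(S.card : ℝ) ^ 2 := by ring
      _ = _ := by rw [hs]

/-- Cauchy–Schwarz on the support of each test vector. -/
theorem sparseSingular_le_unifCompat (hX : 0 < colNorm X) (s : ℝ≥0∞) :
    sparseSingular X s ≤ unifCompat X s := by
  refine iInf_mono fun v => iInf_mono fun hv => iInf_mono fun _ => ENNReal.ofReal_le_ofReal ?_
  obtain ⟨i, hi⟩ := Finset.card_ne_zero.1 hv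
  have h1 : 0 < lqNorm 1 v := by
    rw [lqNorm_one]
    exact Finset.sum_pos' (fun _ _ => abs_nonneg _) ⟨i, Finset.mem_univ i,
      abs_pos.2 (mem_supp.1 hi)⟩
  have h2 := lqNorm_one_le_sqrt_card_mul v (supp v) eq_zero_of_notMem_supp
  have h3 : 0 < lqNorm 2 v := by
    by_contra h
    have h4 : lqNorm 2 v = 0 := le_antisymm (not_lt.1 h) (lqNorm_nonneg 2 v)
    rw [h4, mul_zero] at h2
    linarith
  rw [div_le_div_iff₀ (by positivity) (by positivity)]
  have h4 := lqNorm_nonneg 2 (X *ᵥ v)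
  have h5 := mul_le_mul_of_nonneg_left h2 (mul_nonneg h4 hX.le)
  linarith

theorem unifCompat_le_one (hX : 0 < colNorm X) (i : Fin p) {s : ℝ≥0∞} (hs : 1 ≤ s) :
    unifCompat X s ≤ 1 := by
  refine iInf_le_of_le (Pi.single i 1) (iInf_le_of_le (by simp [supp_single])
    (iInf_le_of_le (by simpa [supp_single] using hs) (ENNReal.ofReal_le_one.2
      (div_le_one_of_le₀ ?_ (mul_nonneg hX.le (lqNorm_nonneg 1 _))))))
  rw [lqNorm_mulVec_single, supp_single, lqNorm_one]
  have h1 : ∑ j, |(Pi.single i (1 : ℝ) : Fin p → ℝ) j| = 1 := by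
    simp [Pi.single_apply, apply_ite abs]
  rw [h1]
  simpa using col_le_colNorm X i

theorem unifCompat_bound (hX : 0 < colNorm X) {s : ℝ≥0∞} {g : ℝ}
    (h : ENNReal.ofReal g ≤ unifCompat X s) {v : Fin p → ℝ} (hv : ((supp v).card : ℝ≥0∞) ≤ s) :
    g * colNorm X * lqNorm 1 v ≤ lqNorm 2 (X *ᵥ v) * √((supp v).card : ℝ) := by
  rcases (lqNorm_nonneg 1 v).eq_or_lt with h0 | h0
  · rw [← h0, mul_zero]
    exact mul_nonneg (lqNorm_nonneg 2 _) (Real.sqrt_nonneg _)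
  have hc : (supp v).card ≠ 0 := by
    intro hc
    rw [Finset.card_eq_zero] at hc
    have : v = 0 := funext fun i => eq_zero_of_notMem_supp i (by simp [hc])
    rw [this, lqNorm_one] at h0
    simp at h0
  have h1 : unifCompat X s ≤ _ := iInf_le_of_le v (iInf_le_of_le hc (iInf_le _ hv))
  have h4 := (ENNReal.ofReal_le_ofReal_iff (div_nonneg
    (mul_nonneg (lqNorm_nonneg 2 _) (Real.sqrt_nonneg _)) (by positivity))).1 (h.trans h1)
  rwa [le_div_iff₀ (by positivity), ← mul_assoc] at h4

theorem sparseSingular_bound (hX : 0 < colNorm X) {s : ℝ≥0∞} {g : ℝ}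
    (h : ENNReal.ofReal g ≤ sparseSingular X s) {v : Fin p → ℝ}
    (hv : ((supp v).card : ℝ≥0∞) ≤ s) :
    g * colNorm X * lqNorm 2 v ≤ lqNorm 2 (X *ᵥ v) := by
  rcases (lqNorm_nonneg 2 v).eq_or_lt with h0 | h0
  · rw [← h0, mul_zero]
    exact lqNorm_nonneg 2 _
  have hc : (supp v).card ≠ 0 := by
    intro hc
    rw [Finset.card_eq_zero] at hc
    have : v = 0 := funext fun i => eq_zero_of_notMem_supp i (by simp [hc])
    rw [this] at h0
    simp [lqNorm] at h0
  have h1 : sparseSingular X s ≤ _ := iInf_le_of_le v (iInf_le_of_le hc (iInf_le _ hv))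
  have h4 := (ENNReal.ofReal_le_ofReal_iff (div_nonneg (lqNorm_nonneg 2 _)
    (by positivity))).1 (h.trans h1)
  rwa [le_div_iff₀ (by positivity), ← mul_assoc] at h4

theorem psiDim_eq {A₄ : ℝ} (hA₄ : 0 < A₄) {lam : ℝ} {S : Finset (Fin p)}
    (hτ : 0 ≤ lam / lamBar X) {f : ℝ} (hf : 0 < f) (hφ : compat X S = ENNReal.ofReal f) :
    psiDim A₄ X lam S
      = ENNReal.ofReal ((2 + 3 / A₄ + 33 / f ^ 2 * (lam / lamBar X)) * S.card) := by
  rw [psiDim, hφ]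
  generalize lam / lamBar X = τ at hτ ⊢
  rw [ENNReal.ofReal_mul (by positivity), ENNReal.ofReal_add (by positivity)
    (by positivity), ENNReal.ofReal_add (by positivity) (by positivity),
    ENNReal.ofReal_mul (by positivity), ENNReal.ofReal_div_of_pos hA₄,
    ENNReal.ofReal_div_of_pos (by positivity), ENNReal.ofReal_pow hf.le, ENNReal.ofReal_natCast]
  simp

theorem two_mul_card_le_psiDim (A₄ : ℝ) (lam : ℝ) (S : Finset (Fin p)) :
    2 * (S.card : ℝ≥0∞) ≤ psiDim A₄ X lam S := by
  unfold psiDim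
  gcongr
  rw [add_assoc]
  exact le_self_add

theorem supp_sub_card_le (β β₀ : Fin p → ℝ) :
    (supp (β - β₀)).card ≤ (supp β).card + (supp β₀).card := by
  refine le_trans (Finset.card_le_card fun i hi => ?_) (Finset.card_union_le _ _)
  rw [Finset.mem_union]
  by_contra h
  rw [not_or] at h
  exact mem_supp.1 hi (by simp [eq_zero_of_notMem_supp i h.1, eq_zero_of_notMem_supp i h.2])

end Indices

/-! ### Sparse approximation -/

section SparseApproximation

variable {p : ℕ}

/-- Empirical approximation of a vector by sparse vectors, in the sense of a quadratic form. -/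
theorem exists_sparse_quadratic_le (A : Matrix (Fin p) (Fin p) ℝ) (h : Fin p → ℝ) {a V : ℝ}
    (ha : a = ∑ j, |h j|) (ha0 : 0 < a) (hV : a * V = a * ∑ j, |h j| * A j j * a
      - a * (h ⬝ᵥ A *ᵥ h)) (m : ℕ) (u : Fin p → ℝ) :
    ∃ v : Fin p → ℝ, (supp v).card ≤ m ∧
      (u + v) ⬝ᵥ A *ᵥ (u + v) ≤ (u + (m : ℝ) • h) ⬝ᵥ A *ᵥ (u + (m : ℝ) • h) + m * V := by
  induction m generalizing u with
  | zero => exact ⟨0, by simp [supp], by simp⟩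
  | succ m ih =>
    obtain ⟨v, hv, hle⟩ := ih (u + h)
    set x := u + v
    -- Maurey's device: the one-sparse vector z_j, drawn with probability |h j|/a, has mean h.
    -- Replacing one summand h by z_j raises the quadratic form by V on average, so some j raises it
    -- by at most V. Repeating this for all m copies of h leaves at most m nonzero coordinates.
    set z : Fin p → Fin p → ℝ := fun j => (a * SignType.sign (h j)) • Pi.single j 1
    have hz : ∑ j, |h j| • z j = a • h := by
      have h1 : ∀ j, |h j| • z j = (a * h j) • Pi.single j 1 := by
        intro j
        simp only [z]
        rw [smul_smul]
        congr 1
        rw [mul_left_comm, mul_comm |h j|, sign_mul_abs]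
      simp_rw [h1, ← smul_smul]
      rw [← Finset.smul_sum]
      congr 1
      ext i
      simp [Finset.sum_apply, Pi.single_apply]
    have hzz : ∀ j, |h j| * (z j ⬝ᵥ A *ᵥ z j) = |h j| * A j j * a * a := by
      intro j
      simp only [z, Matrix.mulVec_smul, smul_dotProduct, dotProduct_smul, smul_eq_mul]
      rw [single_one_dotProduct, Matrix.mulVec_single_one]
      change |h j| * (a * SignType.sign (h j) * (a * SignType.sign (h j) * A j j)) = _
      have h2 : |h j| * (SignType.sign (h j) : ℝ) * SignType.sign (h j) = |h j| := by
        rw [abs_mul_sign]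
        exact self_mul_sign (h j)
      linear_combination a * a * A j j * h2
    have hsum : ∑ j, |h j| * ((x + z j) ⬝ᵥ A *ᵥ (x + z j))
        = ∑ j, |h j| * ((x + h) ⬝ᵥ A *ᵥ (x + h) + V) := by
      have h3 : ∑ j, |h j| * (x ⬝ᵥ A *ᵥ z j) = a * (x ⬝ᵥ A *ᵥ h) := by
        have := congrArg (fun y => x ⬝ᵥ A *ᵥ y) hz
        simpa [Matrix.mulVec_sum, dotProduct_sum, Matrix.mulVec_smul] using this
      have h4 : ∑ j, |h j| * (z j ⬝ᵥ A *ᵥ x) = a * (h ⬝ᵥ A *ᵥ x) := by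
        have := congrArg (fun y => y ⬝ᵥ A *ᵥ x) hz
        simpa [sum_dotProduct] using this
      rw [← Finset.sum_mul, ← ha]
      simp only [Matrix.mulVec_add, add_dotProduct, dotProduct_add, mul_add, Finset.sum_add_distrib,
        hzz, h3, h4, ← Finset.sum_mul]
      rw [← ha, hV, ← Finset.sum_mul]
      ring
    have hne : (Finset.univ.filter fun j => h j ≠ 0).Nonempty := by
      by_contra hcon
      rw [Finset.not_nonempty_iff_eq_empty, Finset.filter_eq_empty_iff] at hcon
      rw [ha, Finset.sum_eq_zero fun j _ => by simpa using hcon (Finset.mem_univ j)] at ha0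
      exact lt_irrefl _ ha0
    -- Indices of weight zero are removed so that the weight can be cancelled at the selected index.
    have hfil : ∀ F : Fin p → ℝ, ∑ j, |h j| * F j
        = ∑ j ∈ Finset.univ.filter (fun j => h j ≠ 0), |h j| * F j := by
      intro F
      refine (Finset.sum_filter_of_ne fun j _ hj => ?_).symm
      intro h0
      simp [h0] at hj
    rw [hfil, hfil] at hsum
    obtain ⟨j, hj, hj'⟩ := Finset.exists_le_of_sum_le hne hsum.le
    have hpos : 0 < |h j| := abs_pos.2 (Finset.mem_filter.1 hj).2
    have hj'' := le_of_mul_le_mul_left hj' hpos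
    refine ⟨v + z j, ?_, ?_⟩
    · refine le_trans (Finset.card_le_card (t := insert j (supp v)) fun i hi => ?_)
        ((Finset.card_insert_le _ _).trans (by omega))
      rw [Finset.mem_insert]
      by_contra hcon
      rw [not_or] at hcon
      refine mem_supp.1 hi ?_
      simp [z, eq_zero_of_notMem_supp i hcon.2, hcon.1]
    · have e1 : u + (v + z j) = x + z j := by simp only [x]; abel
      have e2 : u + h + v = x + h := by simp only [x]; abel
      have e3 : u + h + (m : ℝ) • h = u + ((m + 1 : ℕ) : ℝ) • h := by
        push_cast
        rw [add_smul, one_smul]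
        abel
      rw [e1]
      rw [e2, e3] at hle
      push_cast at hle ⊢
      linarith

theorem lqNorm_two_le_lqNorm_one {ι : Type} [Fintype ι] (v : ι → ℝ) :
    lqNorm 2 v ^ 2 ≤ lqNorm 1 v ^ 2 := by
  rw [lqNorm_two_sq', lqNorm_one]
  simp_rw [← sq_abs (v _)]
  exact Finset.sum_sq_le_sq_sum_of_nonneg fun i _ => abs_nonneg _

/-- A lower bound for the singular values over sparse vectors extends to all vectors, up to an
`ℓ¹` term. -/
theorem sparse_lower_bound_transfer {n : ℕ} (X : Matrix (Fin n) (Fin p) ℝ) {κ : ℝ} (hκ : 0 ≤ κ)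
    {m : ℕ} (hm : 1 ≤ m)
    (hQ : ∀ v : Fin p → ℝ, (supp v).card ≤ m → κ * lqNorm 2 v ^ 2 ≤ lqNorm 2 (X *ᵥ v) ^ 2)
    (h : Fin p → ℝ) :
    κ * lqNorm 2 h ^ 2 ≤ lqNorm 2 (X *ᵥ h) ^ 2 + colNorm X ^ 2 * lqNorm 1 h ^ 2 / m := by
  have hm' : (0 : ℝ) < m := by exact_mod_cast hm
  -- The hypothesis says that this form is nonnegative on m-sparse vectors. The empirical
  -- approximation of m • h then gives 0 ≤ m² h·Ah + mV, and V is at most ‖X‖²‖h‖₁² unless the claim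
  -- is trivial or already contained in κ‖h‖₂² ≤ κ‖h‖₁². Dividing by m² gives the bound.
  set A : Matrix (Fin p) (Fin p) ℝ := Xᵀ * X - κ • 1
  have hA : ∀ v : Fin p → ℝ,
      v ⬝ᵥ A *ᵥ v = lqNorm 2 (X *ᵥ v) ^ 2 - κ * lqNorm 2 v ^ 2 := by
    intro v
    simp only [A, Matrix.sub_mulVec, dotProduct_sub, Matrix.smul_mulVec, Matrix.one_mulVec,
      dotProduct_smul, smul_eq_mul]
    rw [← Matrix.mulVec_mulVec, Matrix.dotProduct_mulVec, Matrix.vecMul_transpose,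
      lqNorm_two_sq, lqNorm_two_sq]
  have hAj : ∀ j, A j j ≤ colNorm X ^ 2 - κ := by
    intro j
    simp only [A, Matrix.sub_apply, Matrix.smul_apply, Matrix.one_apply_eq, smul_eq_mul, mul_one]
    gcongr
    have : (Xᵀ * X) j j = lqNorm 2 (Xᵀ j) ^ 2 := by
      rw [lqNorm_two_sq]
      rfl
    rw [this]
    exact pow_le_pow_left₀ (lqNorm_nonneg 2 _) (col_le_colNorm X j) 2
  set a := lqNorm 1 h
  have ha : a = ∑ j, |h j| := lqNorm_one h
  rcases (lqNorm_nonneg 1 h).eq_or_lt with h0 | h0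
  · have h1 := lqNorm_two_le_lqNorm_one h
    rw [← h0] at h1
    have h2 : lqNorm 2 h ^ 2 = 0 := le_antisymm (by simpa using h1) (sq_nonneg _)
    rw [h2, mul_zero]
    positivity
  set V := ∑ j, |h j| * A j j * a - h ⬝ᵥ A *ᵥ h
  obtain ⟨v, hv, hle⟩ := exists_sparse_quadratic_le A h (V := V) ha h0
    (by simp only [V]; ring) m 0
  rw [zero_add, zero_add, hA, Matrix.mulVec_smul, smul_dotProduct, dotProduct_smul, smul_eq_mul,
    smul_eq_mul, hA] at hle
  have h1 := hQ v hv
  have hVle : V ≤ (colNorm X ^ 2 - κ) * a ^ 2 - (lqNorm 2 (X *ᵥ h) ^ 2 - κ * lqNorm 2 h ^ 2) := by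
    simp only [V]
    rw [hA]
    gcongr
    calc ∑ j, |h j| * A j j * a ≤ ∑ j, |h j| * (colNorm X ^ 2 - κ) * a := by
          refine Finset.sum_le_sum fun j _ => ?_
          have := hAj j
          have := abs_nonneg (h j)
          gcongr
      _ = _ := by
          rw [← Finset.sum_mul, ← Finset.sum_mul, ← ha]
          ring
  have h2 := lqNorm_two_le_lqNorm_one h
  have h3 : κ * lqNorm 2 h ^ 2 ≤ κ * a ^ 2 := by gcongr
  have h4 : 0 ≤ lqNorm 2 (X *ᵥ h) ^ 2 := sq_nonneg _
  have h5 : V ≤ colNorm X ^ 2 * a ^ 2 := by linarith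
  have h6 : 0 ≤ m * (m * (lqNorm 2 (X *ᵥ h) ^ 2 - κ * lqNorm 2 h ^ 2) + V) := by linarith
  have h7 := nonneg_of_mul_nonneg_right h6 hm'
  have h8 : colNorm X ^ 2 * a ^ 2 / m * m = colNorm X ^ 2 * a ^ 2 := by field_simp
  by_contra hcon
  push Not at hcon
  have h9 := mul_lt_mul_of_pos_right hcon hm'
  linarith

end SparseApproximation

/-! ### Recovery in prediction, `ℓ¹` and `ℓ²` norm -/

section Expected

variable {n p : ℕ} {X : Matrix (Fin n) (Fin p) ℝ} {Q : Measure (Fin p → ℝ)}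
  {β₀ : Fin p → ℝ}

theorem measurable_posterior [SFinite Q] (B : Set (Fin p → ℝ)) :
    Measurable fun y => posterior X Q y B := by
  simp_rw [posterior_apply X Q 0]
  have h : Measurable fun z : (Fin n → ℝ) × (Fin p → ℝ) =>
      ENNReal.ofReal (likRatio X 0 z.1 z.2) :=
    ENNReal.measurable_ofReal.comp (continuous_likRatio X 0).measurable
  exact (h.lintegral_prod_right' (ν := Q)).inv.mul
    (h.lintegral_prod_right' (ν := Q.restrict B))

theorem expectedPosterior_mono {B B' : Set (Fin p → ℝ)} (h : B ⊆ B') :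
    expectedPosterior X Q β₀ B ≤ expectedPosterior X Q β₀ B' :=
  lintegral_mono fun _ => measure_mono h

theorem expectedPosterior_union_le [SFinite Q] (B B' : Set (Fin p → ℝ)) :
    expectedPosterior X Q β₀ (B ∪ B')
      ≤ expectedPosterior X Q β₀ B + expectedPosterior X Q β₀ B' := by
  unfold expectedPosterior
  rw [← lintegral_add_left (measurable_posterior B)]
  exact lintegral_mono fun y => measure_union_le B B'

theorem expectedPosterior_empty : expectedPosterior X Q β₀ ∅ = 0 := by
  simp [expectedPosterior]

theorem measurable_card_supp : Measurable fun β : Fin p → ℝ => ((supp β).card : ℝ) := by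
  have h : ∀ β : Fin p → ℝ, ((supp β).card : ℝ) = ∑ i, ({0}ᶜ : Set ℝ).indicator 1 (β i) := by
    intro β
    rw [supp, Finset.card_filter]
    push_cast
    refine Finset.sum_congr rfl fun i _ => ?_
    simp [Set.indicator_apply]
  simp_rw [h]
  refine Finset.measurable_sum _ fun i _ => ?_
  exact (measurable_one.indicator (measurableSet_singleton (0 : ℝ)).compl).comp
    (measurable_pi_apply i)

theorem continuous_lqNorm_mulVec_sub :
    Continuous fun β : Fin p → ℝ => lqNorm 2 (X *ᵥ (β - β₀)) := by
  have h : Continuous fun β : Fin p → ℝ => X *ᵥ (β - β₀) := by fun_prop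
  exact continuous_lqNorm_two.comp h

theorem continuous_lqNorm_one_sub :
    Continuous fun β : Fin p → ℝ => lqNorm 1 (β - β₀) := by
  have h : Continuous fun β : Fin p → ℝ => β - β₀ := by fun_prop
  exact continuous_lqNorm_one.comp h

end Expected

/-! ### Radii, and the split between small and large regularization. -/

section Recovery

/-- A constant that governs the prediction radius. -/
def radiusConst (A₃ A₄ : ℝ) : ℝ := A₃ + 5 + 50 / splitExp A₄

/-- The factor in the prediction radius. -/
def predConst (A₃ A₄ : ℝ) : ℝ := 1 + 8 * radiusConst A₃ A₄ / splitExp A₄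

/-- The threshold for the ratio `lam / lamBar` between small and large regularization. -/
def lamThreshold (A₄ : ℝ) : ℝ := 2 * splitExp A₄ * A₄

/-- The factor in the `ℓ¹` radius for large regularization. -/
def lassoConst (A₃ A₄ : ℝ) : ℝ := 1 + 4 * radiusConst A₃ A₄ / lamThreshold A₄

/-- An upper bound for the expected posterior mass outside of the recovery sets. -/
def recoveryRate (A₄ : ℝ) (p : ℕ) : ℝ :=
  4 / p + Real.exp (-(1 / 2) * Real.log p) + 4 * Real.exp (-(9 / 10 * A₄) * Real.log p)

variable {A₁ A₂ A₃ A₄ : ℝ} {n p : ℕ} {X : Matrix (Fin n) (Fin p) ℝ} {lam : ℝ} {w : ℕ → ℝ}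

theorem lamThreshold_pos (hA₄ : 0 < A₄) : 0 < lamThreshold A₄ := by
  have := splitExp_pos hA₄
  unfold lamThreshold
  positivity

theorem radiusConst_pos (hA₃ : 0 < A₃) (hA₄ : 0 < A₄) : 0 < radiusConst A₃ A₄ := by
  have := splitExp_pos hA₄
  unfold radiusConst
  positivity

theorem one_le_predConst (hA₃ : 0 < A₃) (hA₄ : 0 < A₄) : 1 ≤ predConst A₃ A₄ := by
  have := splitExp_pos hA₄
  have := radiusConst_pos hA₃ hA₄
  unfold predConst
  have : 0 ≤ 8 * radiusConst A₃ A₄ / splitExp A₄ := by positivity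
  linarith

theorem one_le_lassoConst (hA₃ : 0 < A₃) (hA₄ : 0 < A₄) : 1 ≤ lassoConst A₃ A₄ := by
  have := lamThreshold_pos hA₄
  have := radiusConst_pos hA₃ hA₄
  unfold lassoConst
  have : 0 ≤ 4 * radiusConst A₃ A₄ / lamThreshold A₄ := by positivity
  linarith

theorem Admissible.lamBar_pos (h : Admissible A₁ A₂ A₃ A₄ X lam w) : 0 < lamBar X := by
  have := h.lam_pos
  have := h.lam_le
  linarith

theorem Admissible.ratio_le (h : Admissible A₁ A₂ A₃ A₄ X lam w) : lam / lamBar X ≤ 2 := by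
  rw [div_le_iff₀ h.lamBar_pos]
  exact h.lam_le

/-- From λ ≤ 4‖X‖√(log p) the compatibility cost is at most (25/(8θ)) · 16 = 50/θ times s log p /
f², and f ≤ 1 brings the other term to the same form. -/
theorem Admissible.radius_le (h : Admissible A₁ A₂ A₃ A₄ X lam w) (hA₃ : 0 < A₃) (hA₄ : 0 < A₄)
    (hp : LargeDim A₁ A₂ A₃ A₄ p) {f : ℝ} (hf : 0 < f) (hf1 : f ≤ 1) {s : ℝ} (hs : 0 ≤ s) :
    (A₃ + 5) * s * Real.log p + 25 / (8 * splitExp A₄) * (lam / (colNorm X * f)) ^ 2 * s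
      ≤ radiusConst A₃ A₄ * (s * Real.log p / f ^ 2) := by
  have hL := hp.one_le_log
  have hX := h.colNorm_pos
  have hθ := splitExp_pos hA₄
  set L := Real.log p
  have h1 : (lam / (colNorm X * f)) ^ 2 ≤ 16 * L / f ^ 2 := by
    have h2 : lam ≤ 4 * colNorm X * √L := by
      have := h.lam_le
      rw [lamBar] at this
      linarith
    have h3 : √L ^ 2 = L := Real.sq_sqrt (by linarith)
    have h4 := h.lam_pos
    calc (lam / (colNorm X * f)) ^ 2 ≤ (4 * colNorm X * √L / (colNorm X * f)) ^ 2 := by gcongr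
      _ = 16 * √L ^ 2 / f ^ 2 := by field_simp; ring
      _ = _ := by rw [h3]
  have h5 : (A₃ + 5) * s * L ≤ (A₃ + 5) * (s * L / f ^ 2) := by
    rw [mul_assoc]
    gcongr
    rw [le_div_iff₀ (by positivity)]
    exact mul_le_of_le_one_right (by positivity) (pow_le_one₀ hf.le hf1)
  calc _ ≤ (A₃ + 5) * (s * L / f ^ 2) + 25 / (8 * splitExp A₄) * (16 * L / f ^ 2) * s := by
        gcongr
    _ = _ := by
        unfold radiusConst
        field_simp
        ring

variable {β₀ : Fin p → ℝ}

theorem Admissible.far_prediction (h : Admissible A₁ A₂ A₃ A₄ X lam w) (hA₁ : 0 < A₁)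
    (hA₂ : 0 < A₂) (hA₃ : 0 < A₃) (hA₄ : 0 < A₄) (hp : LargeDim A₁ A₂ A₃ A₄ p)
    (hs₀ : 1 ≤ (supp β₀).card) {f : ℝ} (hf : 0 < f) (hf1 : f ≤ 1)
    (hc : CompatBound X (supp β₀) f) :
    expectedPosterior X (prior p w lam) β₀ {β | predConst A₃ A₄ *
      √((supp β₀).card * Real.log p) / f < lqNorm 2 (X *ᵥ (β - β₀))}
      ≤ ENNReal.ofReal (2 / p) := by
  have hL := hp.one_le_log
  have hθ := splitExp_pos hA₄
  have hM := one_le_predConst hA₃ hA₄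
  have hC := radiusConst_pos hA₃ hA₄
  refine h.expectedPosterior_le_of_far hA₁ hA₂ hA₄ hp hs₀ hf hc
    (measurableSet_lt measurable_const continuous_lqNorm_mulVec_sub.measurable) fun β hβ => ?_
  rw [Set.mem_ofPred_eq] at hβ
  refine (h.radius_le hA₃ hA₄ hp hf hf1 (Nat.cast_nonneg _)).trans ?_
  have h1 : 0 ≤ lam / 8 * lqNorm 1 (β - β₀) := by
    have := h.lam_pos
    have := lqNorm_nonneg 1 (β - β₀)
    positivity
  set x := lqNorm 2 (X *ᵥ (β - β₀))
  set u := ((supp β₀).card : ℝ) * Real.log p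
  have hu : 0 ≤ u := by positivity
  have h2 : (predConst A₃ A₄ * √u / f) ^ 2 ≤ x ^ 2 := by gcongr
  have h3 : (predConst A₃ A₄ * √u / f) ^ 2 = predConst A₃ A₄ ^ 2 * (u / f ^ 2) := by
    rw [div_pow, mul_pow, Real.sq_sqrt hu]
    ring
  have h4 : radiusConst A₃ A₄ ≤ splitExp A₄ / 8 * predConst A₃ A₄ ^ 2 := by
    have h5 : 8 * radiusConst A₃ A₄ / splitExp A₄ ≤ predConst A₃ A₄ ^ 2 := by
      have : predConst A₃ A₄ = 1 + 8 * radiusConst A₃ A₄ / splitExp A₄ := rfl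
      nlinarith
    calc radiusConst A₃ A₄ = splitExp A₄ / 8 * (8 * radiusConst A₃ A₄ / splitExp A₄) := by
          field_simp
      _ ≤ _ := by gcongr
  have h6 : 0 ≤ u / f ^ 2 := by positivity
  calc _ ≤ splitExp A₄ / 8 * predConst A₃ A₄ ^ 2 * (u / f ^ 2) := by gcongr
    _ = splitExp A₄ / 8 * (predConst A₃ A₄ * √u / f) ^ 2 := by rw [h3]; ring
    _ ≤ splitExp A₄ / 8 * x ^ 2 := by gcongr
    _ ≤ _ := by linarith

/-- Here λ is of the exact order ‖X‖√(log p), so the ℓ¹ term of the master bound alone exceeds the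
required radius and no sparsity is needed. -/
theorem Admissible.far_lasso (h : Admissible A₁ A₂ A₃ A₄ X lam w) (hA₁ : 0 < A₁)
    (hA₂ : 0 < A₂) (hA₃ : 0 < A₃) (hA₄ : 0 < A₄) (hp : LargeDim A₁ A₂ A₃ A₄ p)
    (hs₀ : 1 ≤ (supp β₀).card) {f : ℝ} (hf : 0 < f) (hf1 : f ≤ 1)
    (hc : CompatBound X (supp β₀) f) (hτ : lamThreshold A₄ ≤ lam / lamBar X) :
    expectedPosterior X (prior p w lam) β₀ {β | lassoConst A₃ A₄ *
      ((supp β₀).card * √(Real.log p)) / (colNorm X * f ^ 2) < lqNorm 1 (β - β₀)}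
      ≤ ENNReal.ofReal (2 / p) := by
  have hL := hp.one_le_log
  have hX := h.colNorm_pos
  have hθ := splitExp_pos hA₄
  have hT := lamThreshold_pos hA₄
  have hM := one_le_lassoConst hA₃ hA₄
  have hC := radiusConst_pos hA₃ hA₄
  refine h.expectedPosterior_le_of_far hA₁ hA₂ hA₄ hp hs₀ hf hc
    (measurableSet_lt measurable_const continuous_lqNorm_one_sub.measurable) fun β hβ => ?_
  rw [Set.mem_ofPred_eq] at hβ
  refine (h.radius_le hA₃ hA₄ hp hf hf1 (Nat.cast_nonneg _)).trans ?_
  have h1 : 0 ≤ splitExp A₄ / 8 * lqNorm 2 (X *ᵥ (β - β₀)) ^ 2 := by positivity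
  set L := Real.log p
  have h2 : √L ^ 2 = L := Real.sq_sqrt (by linarith)
  have hlam : lamThreshold A₄ * (2 * colNorm X * √L) ≤ lam := by
    rw [le_div_iff₀ h.lamBar_pos] at hτ
    exact hτ
  have h3 : 4 * radiusConst A₃ A₄ ≤ lamThreshold A₄ * lassoConst A₃ A₄ := by
    have : lamThreshold A₄ * lassoConst A₃ A₄ = lamThreshold A₄ + 4 * radiusConst A₃ A₄ := by
      unfold lassoConst
      field_simp
    linarith
  have h4 : 0 ≤ (supp β₀).card * L / f ^ 2 := by positivity
  calc _ ≤ lamThreshold A₄ * lassoConst A₃ A₄ / 4 * ((supp β₀).card * L / f ^ 2) := by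
        gcongr
        linarith
    _ = lamThreshold A₄ * (2 * colNorm X * √L) / 8 *
        (lassoConst A₃ A₄ * ((supp β₀).card * √L) / (colNorm X * f ^ 2)) := by
        rw [← h2, Real.sqrt_sq (Real.sqrt_nonneg L)]
        field_simp
        ring
    _ ≤ lam / 8 * lqNorm 1 (β - β₀) := by
        have h5 := h.lam_pos
        gcongr
    _ ≤ _ := by linarith

/-- Subtracting β₀ adds at most |S₀| to the support, which raises the leading constant from 1 to the
2 of `psiDim`. -/
theorem Admissible.far_card (h : Admissible A₁ A₂ A₃ A₄ X lam w) (hA₁ : 0 < A₁)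
    (hA₂ : 0 < A₂) (hA₄ : 0 < A₄) (hp : LargeDim A₁ A₂ A₃ A₄ p)
    (hs₀ : 1 ≤ (supp β₀).card) {f : ℝ} (hf : 0 < f)
    (hc : CompatBound X (supp β₀) f) (hτ : lam / lamBar X ≤ lamThreshold A₄) :
    expectedPosterior X (prior p w lam) β₀ {β |
      (2 + 3 / A₄ + 33 / f ^ 2 * (lam / lamBar X)) * (supp β₀).card < (supp (β - β₀)).card}
      ≤ ENNReal.ofReal (1 / p + Real.exp (-(1 / 2) * Real.log p)) := by
  have hsub : {β : Fin p → ℝ | (2 + 3 / A₄ + 33 / f ^ 2 * (lam / lamBar X)) * (supp β₀).card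
      < (supp (β - β₀)).card} ⊆ {β | (1 + 3 / A₄ + 33 / f ^ 2 * (lam / lamBar X)) *
        (supp β₀).card ≤ (supp β).card} := by
    intro β hβ
    rw [Set.mem_ofPred_eq] at hβ ⊢
    have h1 : ((supp (β - β₀)).card : ℝ) ≤ (supp β).card + (supp β₀).card := by
      exact_mod_cast supp_sub_card_le β β₀
    linarith
  exact (expectedPosterior_mono hsub).trans (h.expectedPosterior_le_of_card hA₁ hA₂ hA₄ hp hs₀
    hf hc hτ (measurableSet_le measurable_const measurable_card_supp) fun β hβ => hβ)

theorem le_recoveryRate (A₄ : ℝ) (p : ℕ) :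
    2 / (p : ℝ) ≤ recoveryRate A₄ p ∧
    2 / (p : ℝ) + (2 / p + (1 / p + Real.exp (-(1 / 2) * Real.log p)))
      ≤ recoveryRate A₄ p + 1 / p ∧
    1 / (p : ℝ) + 4 * Real.exp (-(9 / 10 * A₄) * Real.log p) ≤ recoveryRate A₄ p := by
  have h0 : 0 ≤ 1 / (p : ℝ) := by positivity
  have h1 : 2 / (p : ℝ) = 2 * (1 / p) := by ring
  have h2 : 4 / (p : ℝ) = 4 * (1 / p) := by ring
  have := Real.exp_pos (-(1 / 2) * Real.log p)
  have := Real.exp_pos (-(9 / 10 * A₄) * Real.log p)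
  unfold recoveryRate
  refine ⟨?_, ?_, ?_⟩ <;> linarith

/-- A factor that suffices in all recovery radii. -/
def recoveryConst (A₃ A₄ : ℝ) : ℝ :=
  predConst A₃ A₄ * (69 + 3 / A₄) + lassoConst A₃ A₄ * (1 + 1 / lamThreshold A₄)

theorem le_recoveryConst (hA₃ : 0 < A₃) (hA₄ : 0 < A₄) :
    predConst A₃ A₄ * (69 + 3 / A₄) ≤ recoveryConst A₃ A₄ ∧
    predConst A₃ A₄ + lassoConst A₃ A₄ * (1 + 1 / lamThreshold A₄) ≤ recoveryConst A₃ A₄ ∧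
    lassoConst A₃ A₄ ≤ recoveryConst A₃ A₄ ∧ predConst A₃ A₄ ≤ recoveryConst A₃ A₄ ∧
    0 < recoveryConst A₃ A₄ := by
  have h1 := one_le_predConst hA₃ hA₄
  have h2 := one_le_lassoConst hA₃ hA₄
  have h3 := lamThreshold_pos hA₄
  have h4 : 0 ≤ predConst A₃ A₄ * (3 / A₄) := by positivity
  have h5 : 0 ≤ lassoConst A₃ A₄ * (1 / lamThreshold A₄) := by positivity
  unfold recoveryConst
  refine ⟨?_, ?_, ?_, ?_, ?_⟩ <;> linarith

/-- A vanishing index makes the threshold infinite, since the other factor is nonzero; nothing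
exceeds it. Otherwise all quantities are finite and the inequality descends to the reals. -/
theorem threshold_lt {M a x : ℝ} {u v : ℝ≥0∞} (hM : 0 < M) (ha : 0 < a) (hu : u ≠ ∞)
    (hv : v ≠ ∞) (h : ENNReal.ofReal M / u * (ENNReal.ofReal a / v) < ENNReal.ofReal x) :
    u ≠ 0 ∧ v ≠ 0 ∧ M / u.toReal * (a / v.toReal) < x := by
  have hM' := ENNReal.ofReal_pos.2 hM
  have ha' := ENNReal.ofReal_pos.2 ha
  have hu0 : u ≠ 0 := by
    rintro rfl
    rw [ENNReal.div_zero hM'.ne', ENNReal.top_mul (ENNReal.div_pos ha'.ne' hv).ne'] at h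
    exact not_top_lt h
  have hv0 : v ≠ 0 := by
    rintro rfl
    rw [ENNReal.div_zero ha'.ne', ENNReal.mul_top (ENNReal.div_pos hM'.ne' hu).ne'] at h
    exact not_top_lt h
  refine ⟨hu0, hv0, ?_⟩
  rw [← ENNReal.ofReal_toReal hu, ← ENNReal.ofReal_toReal hv,
    ← ENNReal.ofReal_div_of_pos (ENNReal.toReal_pos hu0 hu),
    ← ENNReal.ofReal_div_of_pos (ENNReal.toReal_pos hv0 hv), ← ENNReal.ofReal_mul
    (div_nonneg hM.le ENNReal.toReal_nonneg)] at h
  exact (ENNReal.ofReal_lt_ofReal_iff_of_nonneg (by positivity)).1 h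

theorem one_le_psiDim (A₄ lam : ℝ) {S : Finset (Fin p)} (hS : 1 ≤ S.card) :
    1 ≤ psiDim A₄ X lam S := by
  refine le_trans ?_ (two_mul_card_le_psiDim A₄ lam S)
  have h1 : (1 : ℝ≥0∞) ≤ S.card := by exact_mod_cast hS
  calc (1 : ℝ≥0∞) ≤ 2 * 1 := by norm_num
    _ ≤ _ := by gcongr

theorem Admissible.psiBar_le_one (h : Admissible A₁ A₂ A₃ A₄ X lam w) {S : Finset (Fin p)}
    (hS : 1 ≤ S.card) : psiBar A₄ X lam S ≤ 1 := by
  obtain ⟨i, _⟩ := Finset.card_pos.1 hS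
  exact unifCompat_le_one h.colNorm_pos i (one_le_psiDim A₄ lam hS)

theorem Admissible.psiTilde_le_one (h : Admissible A₁ A₂ A₃ A₄ X lam w) {S : Finset (Fin p)}
    (hS : 1 ≤ S.card) : psiTilde A₄ X lam S ≤ 1 := by
  obtain ⟨i, _⟩ := Finset.card_pos.1 hS
  exact (sparseSingular_le_unifCompat h.colNorm_pos _).trans (h.psiBar_le_one hS)

theorem Admissible.recovery_prediction (h : Admissible A₁ A₂ A₃ A₄ X lam w) (hA₁ : 0 < A₁)
    (hA₂ : 0 < A₂) (hA₃ : 0 < A₃) (hA₄ : 0 < A₄) (hp : LargeDim A₁ A₂ A₃ A₄ p) {M : ℝ}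
    (hM : recoveryConst A₃ A₄ ≤ M) (β₀ : Fin p → ℝ) :
    expectedPosterior X (prior p w lam) β₀ {β | ENNReal.ofReal M / psiBar A₄ X lam (supp β₀) *
      (ENNReal.ofReal √((supp β₀).card * Real.log p) / compat X (supp β₀))
        < ENNReal.ofReal (lqNorm 2 (X *ᵥ (β - β₀)))}
      ≤ ENNReal.ofReal (recoveryRate A₄ p) := by
  have hX := h.colNorm_pos
  have hL := hp.one_le_log
  have hC := le_recoveryConst hA₃ hA₄
  rcases Nat.eq_zero_or_pos (supp β₀).card with hs₀ | hs₀
  · refine (h.expectedPosterior_le_of_zero hA₁ hA₂ hA₄ hp hs₀ ?_).trans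
      (ENNReal.ofReal_le_ofReal (le_recoveryRate A₄ p).2.2)
    rintro β hβ rfl
    simp [lqNorm] at hβ
  have hs : (0 : ℝ) < (supp β₀).card := by exact_mod_cast hs₀
  have hφ := compat_le_one hX hs₀
  have hψ := h.psiBar_le_one hs₀
  have hφt := (hφ.trans_lt ENNReal.one_lt_top).ne
  have hψt := (hψ.trans_lt ENNReal.one_lt_top).ne
  set φ := compat X (supp β₀)
  set ψ := psiBar A₄ X lam (supp β₀)
  by_cases hφ0 : φ = 0
  · refine (expectedPosterior_mono (B' := ∅) fun β hβ => ?_).trans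
      (expectedPosterior_empty.le.trans zero_le)
    exact absurd hφ0 (threshold_lt (by linarith) (by positivity) hψt hφt hβ).2.1
  have hf := ENNReal.toReal_pos hφ0 hφt
  have hf1 : φ.toReal ≤ 1 := by simpa using ENNReal.toReal_mono ENNReal.one_ne_top hφ
  have hc := compatBound_of_le_compat hX (S := supp β₀) (f := φ.toReal)
    (ENNReal.ofReal_toReal hφt).le
  refine (expectedPosterior_mono ?_).trans ((h.far_prediction hA₁ hA₂ hA₃ hA₄ hp hs₀ hf hf1
    hc).trans (ENNReal.ofReal_le_ofReal (le_recoveryRate A₄ p).1))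
  intro β hβ
  obtain ⟨hψ0, -, hlt⟩ := threshold_lt (by linarith) (by positivity) hψt hφt hβ
  have hg := ENNReal.toReal_pos hψ0 hψt
  have hg1 : ψ.toReal ≤ 1 := by simpa using ENNReal.toReal_mono ENNReal.one_ne_top hψ
  refine lt_of_le_of_lt ?_ hlt
  rw [mul_div_assoc]
  gcongr
  rw [le_div_iff₀ hg]
  nlinarith

theorem Admissible.recovery_l1 (h : Admissible A₁ A₂ A₃ A₄ X lam w) (hA₁ : 0 < A₁)
    (hA₂ : 0 < A₂) (hA₃ : 0 < A₃) (hA₄ : 0 < A₄) (hp : LargeDim A₁ A₂ A₃ A₄ p) {M : ℝ}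
    (hM : recoveryConst A₃ A₄ ≤ M) (β₀ : Fin p → ℝ) :
    expectedPosterior X (prior p w lam) β₀ {β |
      ENNReal.ofReal M / psiBar A₄ X lam (supp β₀) ^ 2 *
      (ENNReal.ofReal ((supp β₀).card * √(Real.log p)) /
        (ENNReal.ofReal (colNorm X) * compat X (supp β₀) ^ 2))
        < ENNReal.ofReal (lqNorm 1 (β - β₀))}
      ≤ ENNReal.ofReal (recoveryRate A₄ p) := by
  have hX := h.colNorm_pos
  have hL := hp.one_le_log
  have hC := le_recoveryConst hA₃ hA₄
  have hP := one_le_predConst hA₃ hA₄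
  rcases Nat.eq_zero_or_pos (supp β₀).card with hs₀ | hs₀
  · refine (h.expectedPosterior_le_of_zero hA₁ hA₂ hA₄ hp hs₀ ?_).trans
      (ENNReal.ofReal_le_ofReal (le_recoveryRate A₄ p).2.2)
    rintro β hβ rfl
    simp [lqNorm] at hβ
  have hs : (0 : ℝ) < (supp β₀).card := by exact_mod_cast hs₀
  have hφ := compat_le_one hX hs₀
  have hψ := h.psiBar_le_one hs₀
  have hφt := (hφ.trans_lt ENNReal.one_lt_top).ne
  have hψt := (hψ.trans_lt ENNReal.one_lt_top).ne
  set φ := compat X (supp β₀) with hφdef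
  set ψ := psiBar A₄ X lam (supp β₀) with hψdef
  have hut : ψ ^ 2 ≠ ∞ := ENNReal.pow_ne_top hψt
  have hvt : ENNReal.ofReal (colNorm X) * φ ^ 2 ≠ ∞ :=
    ENNReal.mul_ne_top ENNReal.ofReal_ne_top (ENNReal.pow_ne_top hφt)
  by_cases h0 : φ = 0 ∨ ψ = 0
  · refine (expectedPosterior_mono (B' := ∅) fun β hβ => ?_).trans
      (expectedPosterior_empty.le.trans zero_le)
    obtain ⟨h1, h2, -⟩ := threshold_lt (by linarith) (by positivity) hut hvt hβ
    rcases h0 with h0 | h0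
    · simp [h0] at h2
    · simp [h0] at h1
  rw [not_or] at h0
  obtain ⟨hφ0, hψ0⟩ := h0
  have hf := ENNReal.toReal_pos hφ0 hφt
  have hf1 : φ.toReal ≤ 1 := by simpa using ENNReal.toReal_mono ENNReal.one_ne_top hφ
  have hg := ENNReal.toReal_pos hψ0 hψt
  have hg1 : ψ.toReal ≤ 1 := by simpa using ENNReal.toReal_mono ENNReal.one_ne_top hψ
  have hφr := ENNReal.ofReal_toReal hφt
  have hψr := ENNReal.ofReal_toReal hψt
  set f := φ.toReal
  set g := ψ.toReal
  have hc := compatBound_of_le_compat hX (S := supp β₀) (f := f) hφr.le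
  -- Of the two powers of ψ̄ in the radius, one will be consumed by the uniform compatibility
  -- inequality; the other is dropped, since ψ̄ ≤ 1.
  have hB : ∀ β : Fin p → ℝ, ENNReal.ofReal M / ψ ^ 2 *
      (ENNReal.ofReal ((supp β₀).card * √(Real.log p)) / (ENNReal.ofReal (colNorm X) * φ ^ 2))
        < ENNReal.ofReal (lqNorm 1 (β - β₀)) →
      M * ((supp β₀).card * √(Real.log p)) / (colNorm X * f ^ 2) < g * lqNorm 1 (β - β₀) := by
    intro β hβ
    obtain ⟨-, -, h1⟩ := threshold_lt (by linarith) (by positivity) hut hvt hβ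
    rw [ENNReal.toReal_mul, ENNReal.toReal_ofReal hX.le, ENNReal.toReal_pow,
      ENNReal.toReal_pow] at h1
    refine lt_of_le_of_lt ?_ (mul_lt_mul_of_pos_left h1 hg)
    rw [mul_div_assoc, ← mul_assoc]
    gcongr
    change M ≤ g * (M / g ^ 2)
    rw [show g * (M / g ^ 2) = M / g by field_simp, le_div_iff₀ hg]
    nlinarith
  rcases le_total (lam / lamBar X) (lamThreshold A₄) with hτ | hτ
  · have hτ0 : 0 ≤ lam / lamBar X := div_nonneg h.lam_pos.le h.lamBar_pos.le
    have hdim := psiDim_eq hA₄ hτ0 hf hφr.symm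
    refine (expectedPosterior_mono (B' := _ ∪ _) ?_).trans ((expectedPosterior_union_le _ _).trans
      ((add_le_add (h.far_prediction hA₁ hA₂ hA₃ hA₄ hp hs₀ hf hf1 hc)
      (h.far_card hA₁ hA₂ hA₄ hp hs₀ hf hc hτ)).trans ?_))
    · intro β hβ
      by_contra hcon
      simp only [Set.mem_union, Set.mem_ofPred_eq, not_or, not_lt] at hcon
      obtain ⟨h1, h2⟩ := hcon
      have h3 : ((supp (β - β₀)).card : ℝ≥0∞) ≤ psiDim A₄ X lam (supp β₀) := by
        rw [hdim, ← ENNReal.ofReal_natCast]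
        exact ENNReal.ofReal_le_ofReal h2
      have h4 := unifCompat_bound hX (g := g) (s := psiDim A₄ X lam (supp β₀)) hψr.le h3
      have h5 := hB β hβ
      -- With λ/λ̄ ≤ 2 and f ≤ 1, the dimension factor times f² is at most 68 + 3/A₄, which is below
      -- the square of 69 + 3/A₄.
      have h6 : √((supp (β - β₀)).card : ℝ) ≤ (69 + 3 / A₄) * √((supp β₀).card : ℝ) / f := by
        refine Real.sqrt_le_iff.2 ⟨by positivity, h2.trans ?_⟩
        rw [div_pow, mul_pow, Real.sq_sqrt hs.le, le_div_iff₀ (by positivity)]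
        have h7 := h.ratio_le
        have h8 : f ^ 2 ≤ 1 := pow_le_one₀ hf.le hf1
        have h9 : 0 ≤ 3 / A₄ := by positivity
        have h10 : (2 + 3 / A₄ + 33 / f ^ 2 * (lam / lamBar X)) * f ^ 2 ≤ (69 + 3 / A₄) ^ 2 := by
          calc _ = (2 + 3 / A₄) * f ^ 2 + 33 * (lam / lamBar X) := by field_simp
            _ ≤ (2 + 3 / A₄) * 1 + 33 * 2 := by gcongr
            _ ≤ _ := by nlinarith
        nlinarith
      have h7 : g * colNorm X * lqNorm 1 (β - β₀)
          ≤ M * ((supp β₀).card * √(Real.log p)) / f ^ 2 := by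
        refine h4.trans ?_
        calc _ ≤ (predConst A₃ A₄ * √((supp β₀).card * Real.log p) / f) *
              ((69 + 3 / A₄) * √((supp β₀).card : ℝ) / f) := by
              gcongr
          _ = predConst A₃ A₄ * (69 + 3 / A₄) *
              (√((supp β₀).card : ℝ) ^ 2 * √(Real.log p)) / f ^ 2 := by
              rw [Real.sqrt_mul hs.le]
              field_simp
          _ = predConst A₃ A₄ * (69 + 3 / A₄) * ((supp β₀).card * √(Real.log p)) / f ^ 2 := by
              rw [Real.sq_sqrt hs.le]
          _ ≤ _ := by
              gcongr
              linarith
      rw [div_lt_iff₀ (by positivity)] at h5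
      rw [le_div_iff₀ (by positivity)] at h7
      linarith
    · rw [← ENNReal.ofReal_add (by positivity) (by positivity)]
      refine ENNReal.ofReal_le_ofReal ?_
      have h1 := (le_recoveryRate A₄ p).2.1
      have h2 : 2 / (p : ℝ) = 1 / p + 1 / p := by ring
      have h3 : 0 ≤ 1 / (p : ℝ) := by positivity
      linarith
  · refine (expectedPosterior_mono ?_).trans ((h.far_lasso hA₁ hA₂ hA₃ hA₄ hp hs₀ hf hf1 hc
      hτ).trans (ENNReal.ofReal_le_ofReal (le_recoveryRate A₄ p).1))
    intro β hβ
    have h1 := hB β hβ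
    rw [Set.mem_ofPred_eq]
    have h2 := lqNorm_nonneg 1 (β - β₀)
    calc _ ≤ M * ((supp β₀).card * √(Real.log p)) / (colNorm X * f ^ 2) := by
          gcongr
          linarith
      _ < g * lqNorm 1 (β - β₀) := h1
      _ ≤ 1 * lqNorm 1 (β - β₀) := by gcongr
      _ = _ := one_mul _

theorem add_sq_mul_le_sq {P Q i M : ℝ} (hP : 0 ≤ P) (hQ : 0 ≤ Q) (hi : 0 ≤ i)
    (h : P + Q * (1 + i) ≤ M) : P ^ 2 + Q ^ 2 * i ≤ M ^ 2 := by
  have h1 : (P + Q * (1 + i)) ^ 2 ≤ M ^ 2 := by gcongr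
  have h2 : 0 ≤ 2 * (P * (Q * (1 + i))) + Q ^ 2 * (1 + i + i ^ 2) := by positivity
  linarith

/-- An `ℓ²` bound from bounds in prediction and `ℓ¹` norm and a lower bound over sparse vectors. -/
theorem sq_lqNorm_le_of_sparse (hX : 0 < colNorm X) {g f s L T d P Q : ℝ} (hg : 0 < g)
    (hf : 0 < f) (hs : 1 ≤ s) (hL : 0 ≤ L) (hT : 0 < T) (hd : 2 ≤ d)
    (hdT : 2 * (T / f ^ 2 * s) ≤ d)
    (hsparse : ∀ v : Fin p → ℝ, ((supp v).card : ℝ) ≤ d →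
      g * colNorm X * lqNorm 2 v ≤ lqNorm 2 (X *ᵥ v)) {v : Fin p → ℝ}
    (h₂ : lqNorm 2 (X *ᵥ v) ≤ P * √(s * L) / f)
    (h₁ : lqNorm 1 v ≤ Q * (s * √L) / (colNorm X * f ^ 2)) :
    (g * colNorm X * lqNorm 2 v) ^ 2 ≤ (P ^ 2 + Q ^ 2 * (1 / T)) * (s * L / f ^ 2) := by
  set m := ⌊d⌋₊
  have hmd : (m : ℝ) ≤ d := Nat.floor_le (by linarith)
  -- Rounding down loses at most a factor two, because d ≥ 2.
  have hdm : d / 2 ≤ m := by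
    have := Nat.lt_floor_add_one d
    change d < m + 1 at this
    linarith
  have hm : 1 ≤ m := by
    have : (1 : ℝ) ≤ m := by linarith
    exact_mod_cast this
  have h3 := sparse_lower_bound_transfer X (κ := (g * colNorm X) ^ 2) (sq_nonneg _) hm
    (fun v hv => by
      rw [← mul_pow]
      exact pow_le_pow_left₀ (mul_nonneg (mul_nonneg hg.le hX.le) (lqNorm_nonneg 2 _))
        (hsparse v (le_trans (by exact_mod_cast hv) hmd)) 2) v
  have h4 : lqNorm 2 (X *ᵥ v) ^ 2 ≤ P ^ 2 * (s * L / f ^ 2) := by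
    calc _ ≤ (P * √(s * L) / f) ^ 2 := pow_le_pow_left₀ (lqNorm_nonneg 2 _) h₂ 2
      _ = _ := by rw [div_pow, mul_pow, Real.sq_sqrt (by positivity)]; ring
  have h5 : colNorm X ^ 2 * lqNorm 1 v ^ 2 / m ≤ Q ^ 2 * (1 / T) * (s * L / f ^ 2) := by
    have h6 := lqNorm_nonneg 1 v
    calc _ ≤ colNorm X ^ 2 * (Q * (s * √L) / (colNorm X * f ^ 2)) ^ 2 / (T / f ^ 2 * s) := by
          gcongr
          linarith
      _ = Q ^ 2 * (1 / T) * (s * √L ^ 2 / f ^ 2) := by field_simp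
      _ = _ := by rw [Real.sq_sqrt hL]
  rw [mul_pow]
  linarith

theorem Admissible.recovery_l2 (h : Admissible A₁ A₂ A₃ A₄ X lam w) (hA₁ : 0 < A₁)
    (hA₂ : 0 < A₂) (hA₃ : 0 < A₃) (hA₄ : 0 < A₄) (hp : LargeDim A₁ A₂ A₃ A₄ p) {M : ℝ}
    (hM : recoveryConst A₃ A₄ ≤ M) (β₀ : Fin p → ℝ) :
    expectedPosterior X (prior p w lam) β₀ {β |
      ENNReal.ofReal M / psiTilde A₄ X lam (supp β₀) ^ 2 *
      (ENNReal.ofReal √((supp β₀).card * Real.log p) /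
        (ENNReal.ofReal (colNorm X) * compat X (supp β₀)))
        < ENNReal.ofReal (lqNorm 2 (β - β₀))}
      ≤ ENNReal.ofReal (recoveryRate A₄ p) := by
  have hX := h.colNorm_pos
  have hL := hp.one_le_log
  have hC := le_recoveryConst hA₃ hA₄
  have hP := one_le_predConst hA₃ hA₄
  have hQ := one_le_lassoConst hA₃ hA₄
  have hT := lamThreshold_pos hA₄
  rcases Nat.eq_zero_or_pos (supp β₀).card with hs₀ | hs₀
  · refine (h.expectedPosterior_le_of_zero hA₁ hA₂ hA₄ hp hs₀ ?_).trans
      (ENNReal.ofReal_le_ofReal (le_recoveryRate A₄ p).2.2)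
    rintro β hβ rfl
    simp [lqNorm] at hβ
  have hs : (0 : ℝ) < (supp β₀).card := by exact_mod_cast hs₀
  have hφ := compat_le_one hX hs₀
  have hψ := h.psiTilde_le_one hs₀
  have hφt := (hφ.trans_lt ENNReal.one_lt_top).ne
  have hψt := (hψ.trans_lt ENNReal.one_lt_top).ne
  set φ := compat X (supp β₀) with hφdef
  set ψ := psiTilde A₄ X lam (supp β₀) with hψdef
  have hut : ψ ^ 2 ≠ ∞ := ENNReal.pow_ne_top hψt
  have hvt : ENNReal.ofReal (colNorm X) * φ ≠ ∞ :=
    ENNReal.mul_ne_top ENNReal.ofReal_ne_top hφt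
  by_cases h0 : φ = 0 ∨ ψ = 0
  · refine (expectedPosterior_mono (B' := ∅) fun β hβ => ?_).trans
      (expectedPosterior_empty.le.trans zero_le)
    obtain ⟨h1, h2, -⟩ := threshold_lt (by linarith) (by positivity) hut hvt hβ
    rcases h0 with h0 | h0
    · simp [h0] at h2
    · simp [h0] at h1
  rw [not_or] at h0
  obtain ⟨hφ0, hψ0⟩ := h0
  have hf := ENNReal.toReal_pos hφ0 hφt
  have hf1 : φ.toReal ≤ 1 := by simpa using ENNReal.toReal_mono ENNReal.one_ne_top hφ
  have hg := ENNReal.toReal_pos hψ0 hψt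
  have hg1 : ψ.toReal ≤ 1 := by simpa using ENNReal.toReal_mono ENNReal.one_ne_top hψ
  have hφr := ENNReal.ofReal_toReal hφt
  have hψr := ENNReal.ofReal_toReal hψt
  set f := φ.toReal
  set g := ψ.toReal
  have hc := compatBound_of_le_compat hX (S := supp β₀) (f := f) hφr.le
  have hB : ∀ β : Fin p → ℝ, ENNReal.ofReal M / ψ ^ 2 *
      (ENNReal.ofReal √((supp β₀).card * Real.log p) / (ENNReal.ofReal (colNorm X) * φ))
        < ENNReal.ofReal (lqNorm 2 (β - β₀)) →
      M * √((supp β₀).card * Real.log p) / f < g * colNorm X * lqNorm 2 (β - β₀) := by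
    intro β hβ
    obtain ⟨-, -, h1⟩ := threshold_lt (by linarith) (by positivity) hut hvt hβ
    rw [ENNReal.toReal_mul, ENNReal.toReal_ofReal hX.le, ENNReal.toReal_pow] at h1
    refine lt_of_le_of_lt ?_ (mul_lt_mul_of_pos_left h1 (mul_pos hg hX))
    change _ ≤ g * colNorm X * (M / g ^ 2 * (√((supp β₀).card * Real.log p) / (colNorm X * f)))
    rw [show g * colNorm X * (M / g ^ 2 * (√((supp β₀).card * Real.log p) / (colNorm X * f)))
      = M / g * (√((supp β₀).card * Real.log p) / f) by field_simp, mul_div_assoc]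
    gcongr
    rw [le_div_iff₀ hg]
    nlinarith
  have hτ0 : 0 ≤ lam / lamBar X := div_nonneg h.lam_pos.le h.lamBar_pos.le
  have hdim := psiDim_eq hA₄ hτ0 hf hφr.symm
  rcases le_total (lam / lamBar X) (lamThreshold A₄) with hτ | hτ
  · refine (expectedPosterior_mono (B' := _ ∪ _) ?_).trans ((expectedPosterior_union_le _ _).trans
      ((add_le_add (h.far_prediction hA₁ hA₂ hA₃ hA₄ hp hs₀ hf hf1 hc)
      (h.far_card hA₁ hA₂ hA₄ hp hs₀ hf hc hτ)).trans ?_))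
    · intro β hβ
      by_contra hcon
      simp only [Set.mem_union, Set.mem_ofPred_eq, not_or, not_lt] at hcon
      obtain ⟨h1, h2⟩ := hcon
      have h3 : ((supp (β - β₀)).card : ℝ≥0∞) ≤ psiDim A₄ X lam (supp β₀) := by
        rw [hdim, ← ENNReal.ofReal_natCast]
        exact ENNReal.ofReal_le_ofReal h2
      have h4 := sparseSingular_bound hX (g := g) (s := psiDim A₄ X lam (supp β₀)) hψr.le h3
      have h5 := hB β hβ
      have h6 : predConst A₃ A₄ * √((supp β₀).card * Real.log p) / f
          ≤ M * √((supp β₀).card * Real.log p) / f := by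
        gcongr
        linarith
      linarith
    · rw [← ENNReal.ofReal_add (by positivity) (by positivity)]
      refine ENNReal.ofReal_le_ofReal ?_
      have h1 := (le_recoveryRate A₄ p).2.1
      have h2 : 2 / (p : ℝ) = 1 / p + 1 / p := by ring
      have h3 : 0 ≤ 1 / (p : ℝ) := by positivity
      linarith
  · refine (expectedPosterior_mono (B' := _ ∪ _) ?_).trans ((expectedPosterior_union_le _ _).trans
      ((add_le_add (h.far_prediction hA₁ hA₂ hA₃ hA₄ hp hs₀ hf hf1 hc)
      (h.far_lasso hA₁ hA₂ hA₃ hA₄ hp hs₀ hf hf1 hc hτ)).trans ?_))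
    · intro β hβ
      by_contra hcon
      simp only [Set.mem_union, Set.mem_ofPred_eq, not_or, not_lt] at hcon
      obtain ⟨h1, h2⟩ := hcon
      have h5 := hB β hβ
      set d := (2 + 3 / A₄ + 33 / f ^ 2 * (lam / lamBar X)) * (supp β₀).card with hd
      have hs1 : (1 : ℝ) ≤ (supp β₀).card := by exact_mod_cast hs₀
      have hA : 0 ≤ 3 / A₄ := by positivity
      have hd2 : 2 ≤ d := by
        have : 0 ≤ 33 / f ^ 2 * (lam / lamBar X) := by positivity
        rw [hd]
        nlinarith
      -- For large λ/λ̄ the posterior need not be sparse, but the index ψ̃ covers dimensions of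
      -- order s₀/f². With m of this order, the transfer error ‖X‖²‖β-β₀‖₁²/m is of the order s₀ log
      -- p / f² of the squared prediction error.
      have hdT : 2 * (lamThreshold A₄ / f ^ 2 * (supp β₀).card) ≤ d := by
        have h9 : lamThreshold A₄ / f ^ 2 ≤ 1 / f ^ 2 * (lam / lamBar X) := by
          rw [div_mul_eq_mul_div, one_mul]
          gcongr
        have h11 : 0 ≤ 1 / f ^ 2 * (lam / lamBar X) := by positivity
        have h12 : 33 / f ^ 2 * (lam / lamBar X) = 33 * (1 / f ^ 2 * (lam / lamBar X)) := by ring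
        rw [hd, ← mul_assoc]
        gcongr
        linarith
      have h3 := sq_lqNorm_le_of_sparse hX hg hf hs1 (by linarith) hT hd2 hdT
        (fun v hv => sparseSingular_bound hX (g := g) (s := psiDim A₄ X lam (supp β₀)) hψr.le
          (by rw [hdim, ← ENNReal.ofReal_natCast]; exact ENNReal.ofReal_le_ofReal hv)) h1 h2
      have hM0 : 0 < M := by linarith
      have h6 := pow_lt_pow_left₀ h5 (by positivity) two_ne_zero
      have h11 : predConst A₃ A₄ ^ 2 + lassoConst A₃ A₄ ^ 2 * (1 / lamThreshold A₄) ≤ M ^ 2 :=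
        add_sq_mul_le_sq (by linarith) (by linarith) (by positivity) (by linarith)
      have h12 := mul_le_mul_of_nonneg_right h11
        (by positivity : 0 ≤ (supp β₀).card * Real.log p / f ^ 2)
      rw [div_pow, mul_pow, Real.sq_sqrt (by positivity), mul_div_assoc] at h6
      linarith
    · rw [← ENNReal.ofReal_add (by positivity) (by positivity)]
      refine ENNReal.ofReal_le_ofReal ?_
      have h2 : 2 / (p : ℝ) + 2 / p = 4 / p := by ring
      have := Real.exp_pos (-(1 / 2) * Real.log p)
      have := Real.exp_pos (-(9 / 10 * A₄) * Real.log p)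
      unfold recoveryRate
      linarith

end Recovery

/-! ### Coordinatewise concentration of the posterior -/

section OneDimensional

variable {lam ρ c b : ℝ}

/-- Only the interval of radius η = 1/(cl) around b is kept. There the Gaussian exponent is at least
-1/2 and the Laplace exponent differs from that at b by at most λη ≤ 4; hence 9/2. -/
theorem le_lintegral_gaussian_laplace (hlam : 0 < lam) (hρ : 0 ≤ ρ) (hρc : ρ ≤ c) (hc : 0 < c)
    {l : ℝ} (hl : 1 ≤ l) (hlam_le : lam ≤ 4 * c * l) :
    ENNReal.ofReal (lam / (c * l) * Real.exp (-lam * |b| - 9 / 2))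
      ≤ ∫⁻ t, ENNReal.ofReal (Real.exp (-(ρ ^ 2 * (t - b) ^ 2 / 2))) ∂laplace lam := by
  have hl0 : 0 < l := by linarith
  set η := 1 / (c * l)
  have hη : 0 < η := by positivity
  rw [lintegral_laplace (by fun_prop)]
  calc _ = ENNReal.ofReal (lam / 2 * Real.exp (-lam * |b| - 9 / 2)) *
        volume (Set.Icc (b - η) (b + η)) := by
        rw [Real.volume_Icc, ← ENNReal.ofReal_mul (by positivity)]
        congr 1
        simp only [η]
        field_simp
        ring
    _ = ∫⁻ _ in Set.Icc (b - η) (b + η),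
        ENNReal.ofReal (lam / 2 * Real.exp (-lam * |b| - 9 / 2)) := by
        rw [setLIntegral_const]
    _ ≤ ∫⁻ t in Set.Icc (b - η) (b + η), ENNReal.ofReal (lam / 2 * Real.exp (-lam * |t|)) *
        ENNReal.ofReal (Real.exp (-(ρ ^ 2 * (t - b) ^ 2 / 2))) := by
        refine setLIntegral_mono' measurableSet_Icc fun t ht => ?_
        rw [← ENNReal.ofReal_mul (by positivity), mul_assoc, ← Real.exp_add]
        refine ENNReal.ofReal_le_ofReal ?_
        gcongr
        have h1 : |t - b| ≤ η := abs_le.2 ⟨by linarith [ht.1], by linarith [ht.2]⟩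
        have h2 : |t| ≤ |b| + η := by
          have := abs_sub_abs_le_abs_sub t b
          linarith
        have h3 : lam * η ≤ 4 := by
          simp only [η]
          rw [mul_one_div, div_le_iff₀ (by positivity)]
          linarith
        have h4 : ρ * |t - b| ≤ 1 := by
          calc ρ * |t - b| ≤ c * η := by gcongr
            _ = 1 / l := by simp only [η]; field_simp
            _ ≤ 1 := (div_le_one hl0).2 hl
        have h5 : ρ ^ 2 * (t - b) ^ 2 ≤ 1 := by
          rw [← sq_abs (t - b), ← mul_pow]
          exact pow_le_one₀ (by positivity) h4
        have h6 : lam * |t| ≤ lam * (|b| + η) := by gcongr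
        linarith
    _ ≤ _ := setLIntegral_le_lintegral _ _

/-- In the tail, ρ²u² dominates both 8λ|u| and a²/c²; half of the exponent is spent on each. The
term 2λ|u| will offset the Laplace weights. -/
theorem exp_neg_sq_le_of_lt (hρ : 0 < ρ) (hρc : ρ ≤ c) {a : ℝ} (ha : 8 * lam ≤ a) (ha0 : 0 ≤ a)
    {u : ℝ} (hu : a < ρ ^ 2 * |u|) :
    Real.exp (-(ρ ^ 2 * u ^ 2 / 2)) ≤ Real.exp (-(a ^ 2 / (4 * c ^ 2)) - 2 * lam * |u|) := by
  refine Real.exp_le_exp.2 ?_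
  have h1 : ρ ^ 2 * u ^ 2 = ρ ^ 2 * |u| * |u| := by rw [← sq_abs u]; ring
  have h2 : a * |u| ≤ ρ ^ 2 * |u| * |u| := by gcongr
  have h3 : 8 * lam * |u| ≤ a * |u| := by gcongr
  have h4 : a ^ 2 / c ^ 2 ≤ ρ ^ 2 * u ^ 2 := by
    calc a ^ 2 / c ^ 2 ≤ (ρ ^ 2 * |u|) ^ 2 / ρ ^ 2 := by gcongr
      _ = ρ ^ 2 * |u| ^ 2 := by field_simp
      _ = _ := by rw [sq_abs]
  have h5 : a ^ 2 / (4 * c ^ 2) = a ^ 2 / c ^ 2 / 4 := by field_simp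
  linarith

/-- A spike and slab posterior in one dimension concentrates near the maximum of the likelihood. -/
theorem spike_slab_tail_le (hlam : 0 < lam) (hρ : 0 < ρ) (hρc : ρ ≤ c)
    {l : ℝ} (hl : 1 ≤ l) (hlam_le : lam ≤ 4 * c * l) {a : ℝ} (ha : 8 * lam ≤ a) {C : ℝ}
    (hC : 0 ≤ C) {ε : ℝ} (hε : 0 ≤ ε)
    (hCε : (C + 1) * Real.exp (-(a ^ 2 / (4 * c ^ 2)))
      ≤ ε * (lam / (c * l) * Real.exp (-(9 / 2)))) :
    ENNReal.ofReal C * {t | a < ρ ^ 2 * |t - b|}.indicator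
        (fun t => ENNReal.ofReal (Real.exp (-(ρ ^ 2 * (t - b) ^ 2 / 2)))) 0 +
      ∫⁻ t, {t | a < ρ ^ 2 * |t - b|}.indicator
        (fun t => ENNReal.ofReal (Real.exp (-(ρ ^ 2 * (t - b) ^ 2 / 2)))) t ∂laplace lam
      ≤ ENNReal.ofReal ε *
        ∫⁻ t, ENNReal.ofReal (Real.exp (-(ρ ^ 2 * (t - b) ^ 2 / 2))) ∂laplace lam := by
  have ha0 : 0 ≤ a := by linarith
  have hc : 0 < c := hρ.trans_le hρc
  set E := Real.exp (-(a ^ 2 / (4 * c ^ 2)))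
  have h1 : {t | a < ρ ^ 2 * |t - b|}.indicator
      (fun t => ENNReal.ofReal (Real.exp (-(ρ ^ 2 * (t - b) ^ 2 / 2)))) 0
      ≤ ENNReal.ofReal (E * Real.exp (-lam * |b|)) := by
    by_cases h0 : (0 : ℝ) ∈ {t | a < ρ ^ 2 * |t - b|}
    swap
    · rw [Set.indicator_of_notMem h0]
      exact zero_le
    rw [Set.indicator_of_mem h0]
    refine ENNReal.ofReal_le_ofReal ?_
    refine (exp_neg_sq_le_of_lt hρ hρc ha ha0 h0).trans ?_
    rw [← Real.exp_add, zero_sub, abs_neg]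
    refine Real.exp_le_exp.2 ?_
    have := mul_nonneg hlam.le (abs_nonneg b)
    linarith
  have h2 : ∫⁻ t, {t | a < ρ ^ 2 * |t - b|}.indicator
      (fun t => ENNReal.ofReal (Real.exp (-(ρ ^ 2 * (t - b) ^ 2 / 2)))) t ∂laplace lam
      ≤ ENNReal.ofReal (E * Real.exp (-lam * |b|)) := by
    calc _ ≤ ∫⁻ t, ENNReal.ofReal (E * Real.exp (-lam * |b|)) *
          ENNReal.ofReal (Real.exp (lam * |t| - lam * |t - b|)) ∂laplace lam := by
          refine lintegral_mono fun t => ?_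
          by_cases h0 : t ∈ {t | a < ρ ^ 2 * |t - b|}
          swap
          · rw [Set.indicator_of_notMem h0]
            exact zero_le
          rw [Set.indicator_of_mem h0]
          rw [← ENNReal.ofReal_mul (by positivity), mul_assoc, ← Real.exp_add]
          refine ENNReal.ofReal_le_ofReal ((exp_neg_sq_le_of_lt hρ hρc ha ha0 h0).trans ?_)
          rw [← Real.exp_add]
          refine Real.exp_le_exp.2 ?_
          have h3 := abs_sub_abs_le_abs_sub b t
          rw [abs_sub_comm] at h3
          have h4 := mul_le_mul_of_nonneg_left h3 hlam.le
          linarith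
      _ = _ := by
          rw [lintegral_const_mul' _ _ ENNReal.ofReal_ne_top,
            lintegral_exp_abs_laplace hlam hlam, div_self hlam.ne']
          simp
  -- Spike and slab tails both carry exp(-λ|b|), exactly as the lower bound for the denominator
  -- does. The unknown centre b therefore cancels and the estimate is uniform in the data.
  calc _ ≤ ENNReal.ofReal C * ENNReal.ofReal (E * Real.exp (-lam * |b|)) +
        ENNReal.ofReal (E * Real.exp (-lam * |b|)) := by gcongr
    _ = ENNReal.ofReal ((C + 1) * E * Real.exp (-lam * |b|)) := by
        rw [← ENNReal.ofReal_mul hC, ← ENNReal.ofReal_add (by positivity) (by positivity)]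
        congr 1
        ring
    _ ≤ ENNReal.ofReal (ε * (lam / (c * l) * Real.exp (-lam * |b| - 9 / 2))) := by
        refine ENNReal.ofReal_le_ofReal ?_
        calc _ ≤ ε * (lam / (c * l) * Real.exp (-(9 / 2))) * Real.exp (-lam * |b|) := by gcongr
          _ = _ := by
            rw [sub_eq_add_neg, Real.exp_add]
            ring
    _ ≤ _ := by
        rw [ENNReal.ofReal_mul hε]
        gcongr
        exact le_lintegral_gaussian_laplace hlam hρ.le hρc hc hl hlam_le

end OneDimensional

/-! ### Conditioning on all coordinates but one. -/

section Coordinate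

variable {n p : ℕ} (X : Matrix (Fin n) (Fin p) ℝ) (y : Fin n → ℝ) (i : Fin p)

theorem mulVec_update (β : Fin p → ℝ) (t : ℝ) :
    X *ᵥ Function.update β i t = X *ᵥ Function.update β i 0 + t • Xᵀ i := by
  have h : Function.update β i t = Function.update β i 0 + t • Pi.single i 1 := by
    ext j
    by_cases hj : j = i
    · subst hj; simp
    · simp [hj]
  rw [h, Matrix.mulVec_add, Matrix.mulVec_smul, Matrix.mulVec_single_one]
  rfl

/-- The correlation of a column with the residual is affine in the corresponding coordinate and
vanishes at the conditional maximum likelihood point, so a large correlation is exactly a tail event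
for that coordinate. -/
theorem col_dotProduct_residual_update (hρ : 0 < lqNorm 2 (Xᵀ i)) (β : Fin p → ℝ) (t : ℝ) :
    Xᵀ i ⬝ᵥ (y - X *ᵥ Function.update β i t) = -(lqNorm 2 (Xᵀ i) ^ 2 *
      (t - Xᵀ i ⬝ᵥ (y - X *ᵥ Function.update β i 0) / lqNorm 2 (Xᵀ i) ^ 2)) := by
  rw [mulVec_update, ← sub_sub, dotProduct_sub, dotProduct_smul, smul_eq_mul, ← lqNorm_two_sq]
  field_simp
  ring

theorem sq_lqNorm_two_sub_smul (r v : Fin n → ℝ) (t : ℝ) :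
    lqNorm 2 (r - t • v) ^ 2 = lqNorm 2 r ^ 2 - 2 * t * (v ⬝ᵥ r) + t ^ 2 * lqNorm 2 v ^ 2 := by
  rw [lqNorm_two_sq, lqNorm_two_sq, lqNorm_two_sq]
  simp only [sub_dotProduct, dotProduct_sub, dotProduct_smul, smul_dotProduct, smul_eq_mul,
    dotProduct_comm r v]
  ring

theorem likelihood_update (hρ : 0 < lqNorm 2 (Xᵀ i)) (β : Fin p → ℝ) : ∃ A : ℝ, 0 < A ∧
    ∀ t, likelihood X y (Function.update β i t) = ENNReal.ofReal A * ENNReal.ofReal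
      (Real.exp (-(lqNorm 2 (Xᵀ i) ^ 2 *
        (t - Xᵀ i ⬝ᵥ (y - X *ᵥ Function.update β i 0) / lqNorm 2 (Xᵀ i) ^ 2) ^ 2 / 2))) := by
  set r := y - X *ᵥ Function.update β i 0
  set ρ := lqNorm 2 (Xᵀ i)
  refine ⟨Real.exp (-(lqNorm 2 r ^ 2 / 2) + (Xᵀ i ⬝ᵥ r) ^ 2 / ρ ^ 2 / 2), Real.exp_pos _,
    fun t => ?_⟩
  rw [likelihood, ← ENNReal.ofReal_mul (Real.exp_pos _).le, ← Real.exp_add]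
  congr 2
  have h1 : y - X *ᵥ Function.update β i t = r - t • Xᵀ i := by
    rw [mulVec_update, ← sub_sub]
  have h2 := sq_lqNorm_two_sub_smul r (Xᵀ i) t
  rw [h1, neg_div, h2]
  field_simp
  ring

variable {lam : ℝ}

theorem lintegral_slab_eq_lmarginal (S : Finset (Fin p)) {F : (Fin p → ℝ) → ℝ≥0∞}
    (hF : Measurable F) :
    ∫⁻ β, F β ∂slab lam S = (∫⋯∫⁻_Finset.univ.erase i, fun β =>
      ∫⁻ t, F (Function.update β i t) ∂slabCoord lam S i ∂slabCoord lam S) 0 := by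
  rw [slab_eq_pi, lintegral_eq_lmarginal_univ (0 : Fin p → ℝ),
    lmarginal_erase' _ hF (Finset.mem_univ i)]

theorem lmarginal_slabCoord_insert (S : Finset (Fin p)) (G : (Fin p → ℝ) → ℝ≥0∞) :
    (∫⋯∫⁻_Finset.univ.erase i, G ∂slabCoord lam (insert i S))
      = ∫⋯∫⁻_Finset.univ.erase i, G ∂slabCoord lam S := by
  ext x
  unfold lmarginal
  congr 2
  ext1 j
  have hj : (j : Fin p) ≠ i := Finset.ne_of_mem_erase j.2
  simp [slabCoord, hj]

theorem measurableSet_residual (a : ℝ) :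
    MeasurableSet {β : Fin p → ℝ | a < |Xᵀ i ⬝ᵥ (y - X *ᵥ β)|} := by
  have h : Continuous fun β : Fin p → ℝ => Xᵀ i ⬝ᵥ (y - X *ᵥ β) := by
    refine Continuous.dotProduct continuous_const ?_
    fun_prop
  exact measurableSet_lt measurable_const h.abs.measurable

/-- Comparison of the models with and without a given coordinate. -/
theorem slab_pair_tail_le (hlam : 0 < lam) (hρ : 0 < lqNorm 2 (Xᵀ i))
    {l : ℝ} (hl : 1 ≤ l) (hlam_le : lam ≤ 4 * colNorm X * l) {a : ℝ} (ha : 8 * lam ≤ a) {C : ℝ}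
    (hC : 0 ≤ C) {ε : ℝ} (hε : 0 ≤ ε)
    (hCε : (C + 1) * Real.exp (-(a ^ 2 / (4 * colNorm X ^ 2)))
      ≤ ε * (lam / (colNorm X * l) * Real.exp (-(9 / 2)))) {S : Finset (Fin p)} (hS : i ∉ S) :
    ENNReal.ofReal C * ∫⁻ β in {β | a < |Xᵀ i ⬝ᵥ (y - X *ᵥ β)|}, likelihood X y β ∂slab lam S +
      ∫⁻ β in {β | a < |Xᵀ i ⬝ᵥ (y - X *ᵥ β)|}, likelihood X y β ∂slab lam (insert i S)
      ≤ ENNReal.ofReal ε * ∫⁻ β, likelihood X y β ∂slab lam (insert i S) := by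
  set B := {β : Fin p → ℝ | a < |Xᵀ i ⬝ᵥ (y - X *ᵥ β)|}
  have hB : MeasurableSet B := measurableSet_residual X y i a
  have hF := measurable_likelihood X y
  have hFB := hF.indicator hB
  -- The two models differ in coordinate i only: a spike at zero against a Laplace slab. With
  -- coordinate i integrated innermost, the outer integrals coincide and the inner comparison is
  -- `spike_slab_tail_le`.
  have hcS : slabCoord lam S i = Measure.dirac 0 := by rw [slabCoord, if_neg hS]
  have hcS' : slabCoord lam (insert i S) i = laplace lam := by
    rw [slabCoord, if_pos (Finset.mem_insert_self i S)]
  rw [← lintegral_indicator hB, ← lintegral_indicator hB,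
    lintegral_slab_eq_lmarginal i S hFB, lintegral_slab_eq_lmarginal i (insert i S) hFB,
    lintegral_slab_eq_lmarginal i (insert i S) hF, lmarginal_slabCoord_insert,
    lmarginal_slabCoord_insert, hcS, hcS']
  have hm : ∀ (ν : Measure ℝ) [SigmaFinite ν] {G : (Fin p → ℝ) → ℝ≥0∞}, Measurable G →
      Measurable fun β => ∫⁻ t, G (Function.update β i t) ∂ν := by
    intro ν _ G hG
    refine Measurable.lintegral_prod_right' (f := fun z : (Fin p → ℝ) × ℝ =>
      G (Function.update z.1 i z.2)) (hG.comp ?_)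
    exact measurable_update'
  have hJ : ∀ {G : (Fin p → ℝ) → ℝ≥0∞}, Measurable G → Measurable fun z =>
      G (Function.updateFinset (0 : Fin p → ℝ) (Finset.univ.erase i) z) :=
    fun hG => hG.comp measurable_updateFinset
  unfold lmarginal
  rw [← lintegral_const_mul _ (hJ (hm _ hFB)), ← lintegral_const_mul _ (hJ (hm _ hF)),
    ← lintegral_add_right _ (hJ (hm _ hFB))]
  refine lintegral_mono fun z => ?_
  generalize Function.updateFinset (0 : Fin p → ℝ) (Finset.univ.erase i) z = β
  dsimp only
  obtain ⟨A, hA, hlik⟩ := likelihood_update X y i hρ β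
  set ρ := lqNorm 2 (Xᵀ i)
  set b := Xᵀ i ⬝ᵥ (y - X *ᵥ Function.update β i 0) / ρ ^ 2
  have hind : ∀ t, B.indicator (likelihood X y) (Function.update β i t)
      = ENNReal.ofReal A * {t | a < ρ ^ 2 * |t - b|}.indicator
        (fun t => ENNReal.ofReal (Real.exp (-(ρ ^ 2 * (t - b) ^ 2 / 2)))) t := by
    intro t
    have hmem : Function.update β i t ∈ B ↔ t ∈ {t | a < ρ ^ 2 * |t - b|} := by
      change a < |Xᵀ i ⬝ᵥ (y - X *ᵥ Function.update β i t)| ↔ a < ρ ^ 2 * |t - b|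
      rw [col_dotProduct_residual_update X y i hρ, abs_neg, abs_mul, abs_of_nonneg (sq_nonneg ρ)]
    by_cases ht : t ∈ {t | a < ρ ^ 2 * |t - b|}
    · rw [Set.indicator_of_mem (hmem.2 ht), Set.indicator_of_mem ht, hlik]
    · rw [Set.indicator_of_notMem (mt hmem.1 ht), Set.indicator_of_notMem ht, mul_zero]
  simp_rw [hind, hlik]
  rw [lintegral_const_mul' _ _ ENNReal.ofReal_ne_top, lintegral_const_mul' _ _
    ENNReal.ofReal_ne_top, lintegral_const_mul' _ _ ENNReal.ofReal_ne_top, lintegral_dirac]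
  have h := spike_slab_tail_le (b := b) hlam hρ (col_le_colNorm X i) hl hlam_le ha hC hε hCε
  calc _ = ENNReal.ofReal A * (ENNReal.ofReal C * {t | a < ρ ^ 2 * |t - b|}.indicator
        (fun t => ENNReal.ofReal (Real.exp (-(ρ ^ 2 * (t - b) ^ 2 / 2)))) 0 +
      ∫⁻ t, {t | a < ρ ^ 2 * |t - b|}.indicator
        (fun t => ENNReal.ofReal (Real.exp (-(ρ ^ 2 * (t - b) ^ 2 / 2)))) t ∂laplace lam) := by
        ring
    _ ≤ _ := (mul_le_mul_right h _).trans_eq (by ring)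

theorem sum_finset_eq_sum_insert (f : Finset (Fin p) → ℝ≥0∞) :
    ∑ S : Finset (Fin p), f S
      = ∑ S ∈ (Finset.univ.erase i).powerset, (f S + f (insert i S)) := by
  rw [Finset.sum_add_distrib, ← Finset.sum_powerset_insert (Finset.notMem_erase i _),
    Finset.insert_erase (Finset.mem_univ i), Finset.powerset_univ]

/-- Whatever the data, the posterior concentrates on vectors whose residuals have a small inner
product with a given column. -/
theorem posterior_residual_le (hlam : 0 < lam) (hρ : 0 < lqNorm 2 (Xᵀ i))
    {l : ℝ} (hl : 1 ≤ l) (hlam_le : lam ≤ 4 * colNorm X * l) {a : ℝ} (ha : 8 * lam ≤ a) {C : ℝ}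
    (hC : 0 ≤ C) {ε : ℝ} (hε : 0 ≤ ε)
    (hCε : (C + 1) * Real.exp (-(a ^ 2 / (4 * colNorm X ^ 2)))
      ≤ ε * (lam / (colNorm X * l) * Real.exp (-(9 / 2)))) {w : ℕ → ℝ}
    (hw : ∀ s ≤ p, 0 < w s)
    (hwC : ∀ s < p, w s / p.choose s ≤ C * (w (s + 1) / p.choose (s + 1))) :
    posterior X (prior p w lam) y {β | a < |Xᵀ i ⬝ᵥ (y - X *ᵥ β)|} ≤ ENNReal.ofReal ε := by
  set B := {β : Fin p → ℝ | a < |Xᵀ i ⬝ᵥ (y - X *ᵥ β)|}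
  have hB : MeasurableSet B := measurableSet_residual X y i a
  have key : ∫⁻ β in B, likelihood X y β ∂prior p w lam
      ≤ ENNReal.ofReal ε * ∫⁻ β, likelihood X y β ∂prior p w lam := by
    rw [← lintegral_indicator hB, lintegral_prior, lintegral_prior]
    simp_rw [lintegral_indicator hB]
    -- The models are grouped in pairs S, S ∪ {i}. The prior weight of S is at most C times that of
    -- S ∪ {i}, so the larger model alone supplies the denominator.
    rw [sum_finset_eq_sum_insert i, sum_finset_eq_sum_insert i, Finset.mul_sum]
    refine Finset.sum_le_sum fun S hS => ?_
    have hiS : i ∉ S := fun h => Finset.notMem_erase i _ (Finset.mem_powerset.1 hS h)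
    have hcard : (insert i S).card = S.card + 1 := Finset.card_insert_of_notMem hiS
    have hlt : S.card < p := by
      have : (insert i S).card ≤ p := by simpa using Finset.card_le_univ (insert i S)
      omega
    rw [hcard]
    set q := ENNReal.ofReal (w (S.card + 1) / p.choose (S.card + 1))
    have h1 : ENNReal.ofReal (w S.card / p.choose S.card) ≤ q * ENNReal.ofReal C := by
      rw [← ENNReal.ofReal_mul (div_nonneg (hw _ hlt).le (Nat.cast_nonneg _)), mul_comm]
      exact ENNReal.ofReal_le_ofReal (hwC _ hlt)
    have h2 := slab_pair_tail_le X y i hlam hρ hl hlam_le ha hC hε hCε hiS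
    calc _ ≤ q * ENNReal.ofReal C * ∫⁻ β in B, likelihood X y β ∂slab lam S +
          q * ∫⁻ β in B, likelihood X y β ∂slab lam (insert i S) := by gcongr
      _ = q * (ENNReal.ofReal C * ∫⁻ β in B, likelihood X y β ∂slab lam S +
          ∫⁻ β in B, likelihood X y β ∂slab lam (insert i S)) := by ring
      _ ≤ q * (ENNReal.ofReal ε * ∫⁻ β, likelihood X y β ∂slab lam (insert i S)) := by
          gcongr
      _ ≤ _ := by
          rw [mul_add, ← mul_assoc, mul_comm q, mul_assoc]
          exact le_add_self
  rw [posterior, Measure.smul_apply, withDensity_apply' _ B, smul_eq_mul]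
  calc _ ≤ (∫⁻ β, likelihood X y β ∂prior p w lam)⁻¹ *
        (ENNReal.ofReal ε * ∫⁻ β, likelihood X y β ∂prior p w lam) := by gcongr
    _ = ENNReal.ofReal ε * ((∫⁻ β, likelihood X y β ∂prior p w lam)⁻¹ *
        ∫⁻ β, likelihood X y β ∂prior p w lam) := by ring
    _ ≤ ENNReal.ofReal ε * 1 := by
        gcongr
        exact ENNReal.inv_mul_le_one _
    _ = _ := mul_one _

end Coordinate

/-! ### Recovery in supremum norm -/

section Coherence

variable {n p : ℕ} {X : Matrix (Fin n) (Fin p) ℝ}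

theorem mutualCoherence_le_one : mutualCoherence X ≤ 1 :=
  iSup_le fun _ => iSup_le fun _ => iSup_le fun _ => ENNReal.ofReal_le_one.2
    (div_le_one_of_le₀ (dotProduct_le_lqNorm _ _)
      (mul_nonneg (lqNorm_nonneg 2 _) (lqNorm_nonneg 2 _)))

theorem abs_col_dotProduct_col_le (hρ : ∀ i, 0 < lqNorm 2 (Xᵀ i)) {i j : Fin p} (hij : i ≠ j) :
    |Xᵀ i ⬝ᵥ Xᵀ j|
      ≤ (mutualCoherence X).toReal * (lqNorm 2 (Xᵀ i) * lqNorm 2 (Xᵀ j)) := by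
  have h1 : ENNReal.ofReal (|Xᵀ i ⬝ᵥ Xᵀ j| / (lqNorm 2 (Xᵀ i) * lqNorm 2 (Xᵀ j)))
      ≤ mutualCoherence X :=
    le_iSup_of_le i (le_iSup_of_le j (le_iSup_of_le hij le_rfl))
  have h2 := (ENNReal.ofReal_le_iff_le_toReal
    (mutualCoherence_le_one.trans_lt ENNReal.one_lt_top).ne).1 h1
  rwa [div_le_iff₀ (mul_pos (hρ i) (hρ j))] at h2

/-- The maximum with zero reflects the truncation in `ENNReal.ofReal` for negative d₀. -/
theorem mul_toReal_mutualCoherence_le {s : ℕ} {d₀ : ℝ}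
    (h : (s : ℝ≥0∞) ≤ ENNReal.ofReal d₀ * (mutualCoherence X)⁻¹) :
    s * (mutualCoherence X).toReal ≤ max d₀ 0 := by
  have h1 : (s : ℝ≥0∞) * mutualCoherence X ≤ ENNReal.ofReal d₀ := by
    calc _ ≤ ENNReal.ofReal d₀ * (mutualCoherence X)⁻¹ * mutualCoherence X := by gcongr
      _ = ENNReal.ofReal d₀ * ((mutualCoherence X)⁻¹ * mutualCoherence X) := mul_assoc _ _ _
      _ ≤ ENNReal.ofReal d₀ * 1 := by gcongr; exact ENNReal.inv_mul_le_one _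
      _ = _ := mul_one _
  have h2 := ENNReal.toReal_mono ENNReal.ofReal_ne_top h1
  rwa [ENNReal.toReal_mul, ENNReal.toReal_natCast, ENNReal.toReal_ofReal'] at h2

/-- Mutual coherence turns a bound for the residual correlations into a bound for a coordinate. -/
theorem sq_mul_abs_le_residual (hρ : ∀ i, 0 < lqNorm 2 (Xᵀ i)) (y : Fin n → ℝ)
    (β β₀ : Fin p → ℝ) (i : Fin p) :
    lqNorm 2 (Xᵀ i) ^ 2 * |(β - β₀) i| ≤ |Xᵀ i ⬝ᵥ (y - X *ᵥ β)| + |Xᵀ i ⬝ᵥ (y - X *ᵥ β₀)| +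
      (mutualCoherence X).toReal * (lqNorm 2 (Xᵀ i) * colNorm X) * lqNorm 1 (β - β₀) := by
  set v := β - β₀ with hv
  set μ := (mutualCoherence X).toReal
  have hμ : 0 ≤ μ := ENNReal.toReal_nonneg
  set R := ∑ j ∈ Finset.univ.erase i, v j * (Xᵀ i ⬝ᵥ Xᵀ j) with hR
  have h1 : Xᵀ i ⬝ᵥ (X *ᵥ v) = v i * lqNorm 2 (Xᵀ i) ^ 2 + R := by
    rw [mulVec_eq_sum_smul_col, dotProduct_sum,
      ← Finset.add_sum_erase _ _ (Finset.mem_univ i), lqNorm_two_sq, dotProduct_smul, smul_eq_mul]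
    simp only [hR, dotProduct_smul, smul_eq_mul]
  have h2 : |R| ≤ μ * (lqNorm 2 (Xᵀ i) * colNorm X) * lqNorm 1 v := by
    rw [lqNorm_one, Finset.mul_sum]
    calc |R| ≤ ∑ j ∈ Finset.univ.erase i, |v j * (Xᵀ i ⬝ᵥ Xᵀ j)| :=
          Finset.abs_sum_le_sum_abs _ _
      _ ≤ ∑ j ∈ Finset.univ.erase i, μ * (lqNorm 2 (Xᵀ i) * colNorm X) * |v j| := by
          refine Finset.sum_le_sum fun j hj => ?_
          rw [abs_mul, mul_comm]
          have h3 := abs_col_dotProduct_col_le hρ (Finset.ne_of_mem_erase hj).symm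
          have h4 := col_le_colNorm X j
          have h5 := (hρ i).le
          refine mul_le_mul_of_nonneg_right (h3.trans ?_) (abs_nonneg _)
          gcongr
      _ ≤ _ := by
          refine Finset.sum_le_sum_of_subset_of_nonneg (Finset.erase_subset _ _) fun j _ _ => ?_
          have h4 := colNorm_nonneg X
          have h5 := (hρ i).le
          positivity
  have h3 : Xᵀ i ⬝ᵥ (X *ᵥ v) = Xᵀ i ⬝ᵥ (y - X *ᵥ β₀) - Xᵀ i ⬝ᵥ (y - X *ᵥ β) := by
    rw [← dotProduct_sub, hv, Matrix.mulVec_sub]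
    congr 1
    abel
  have h4 : lqNorm 2 (Xᵀ i) ^ 2 * |v i| = |Xᵀ i ⬝ᵥ (y - X *ᵥ β₀) - Xᵀ i ⬝ᵥ (y - X *ᵥ β) - R| := by
    rw [← h3, h1, add_sub_cancel_right, abs_mul, abs_of_nonneg (sq_nonneg (lqNorm 2 _)), mul_comm]
  rw [h4]
  have h5 := abs_sub (Xᵀ i ⬝ᵥ (y - X *ᵥ β₀) - Xᵀ i ⬝ᵥ (y - X *ᵥ β)) R
  have h6 := abs_sub (Xᵀ i ⬝ᵥ (y - X *ᵥ β₀)) (Xᵀ i ⬝ᵥ (y - X *ᵥ β))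
  linarith

theorem abs_col_dotProduct_noise_le {β₀ : Fin p → ℝ} {y : Fin n → ℝ} {L : ℝ} (hL : 0 < L)
    (hy : ∀ (U : Finset (Fin p)) (β : Fin p → ℝ), (∀ i ∉ U, β i = 0) →
      (X *ᵥ β) ⬝ᵥ (y - X *ᵥ β₀) ≤ lqNorm 2 (X *ᵥ β) ^ 2 / 4 + 12 * U.card * L)
    {i : Fin p} (hρ : 0 < lqNorm 2 (Xᵀ i)) :
    |Xᵀ i ⬝ᵥ (y - X *ᵥ β₀)| ≤ 4 * lqNorm 2 (Xᵀ i) * √L := by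
  set ρ := lqNorm 2 (Xᵀ i)
  set u := Xᵀ i ⬝ᵥ (y - X *ᵥ β₀)
  have hs : 0 < √L := Real.sqrt_pos.2 hL
  have hsq : √L ^ 2 = L := Real.sq_sqrt hL.le
  have key : ∀ σ : ℝ, σ ^ 2 = 1 → σ * u ≤ 4 * ρ * √L := by
    intro σ hσ
    -- Scaling of a single column with t²ρ² = 16L: the noise event for {i} then reads tu ≤ 4L + 12L.
    -- The two signs σ give the absolute value.
    set t := 4 * √L / ρ * σ
    have h0 : X *ᵥ (t • Pi.single i 1) = t • Xᵀ i := by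
      rw [Matrix.mulVec_smul, Matrix.mulVec_single_one]
      rfl
    have h1 := hy {i} (t • Pi.single i 1) fun j hj => by
      rw [Finset.mem_singleton] at hj
      simp [hj]
    have h2 : lqNorm 2 (t • Xᵀ i) ^ 2 = t ^ 2 * ρ ^ 2 := by
      rw [lqNorm_two_sq, lqNorm_two_sq, smul_dotProduct, dotProduct_smul, smul_eq_mul,
        smul_eq_mul]
      ring
    rw [h0, h2, smul_dotProduct, smul_eq_mul, Finset.card_singleton] at h1
    have h3 : t ^ 2 * ρ ^ 2 = 16 * L := by
      calc t ^ 2 * ρ ^ 2 = 16 * √L ^ 2 * σ ^ 2 := by simp only [t]; field_simp; ring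
        _ = _ := by rw [hσ, hsq, mul_one]
    have h4 : 4 * √L / ρ * (σ * u) ≤ 4 * √L / ρ * (4 * ρ * √L) := by
      calc 4 * √L / ρ * (σ * u) = t * u := by simp only [t]; ring
        _ ≤ 16 * √L ^ 2 := by
          rw [hsq]
          push_cast at h1
          linarith
        _ = _ := by field_simp; ring
    exact le_of_mul_le_mul_left h4 (by positivity)
  have h1 := key 1 (by norm_num)
  have h2 := key (-1) (by norm_num)
  exact abs_le.2 ⟨by linarith, by linarith⟩

end Coherence

/-! ### Residual correlations in admissible problems and the supremum norm bound. -/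

section Supremum

variable {A₁ A₂ A₃ A₄ : ℝ} {n p : ℕ} {X : Matrix (Fin n) (Fin p) ℝ} {lam : ℝ} {w : ℕ → ℝ}

/-- Adding one given coordinate costs p^A₃/A₁ through the dimension weight and at most a factor p
through the number of models. -/
theorem DimensionPrior.div_choose_le (hw : DimensionPrior A₁ A₂ A₃ A₄ p w) (hA₁ : 0 < A₁)
    (hp : 0 < p) {s : ℕ} (hs : s < p) :
    w s / p.choose s
      ≤ A₁⁻¹ * Real.exp (A₃ * Real.log p) * p * (w (s + 1) / p.choose (s + 1)) := by
  have h1 := hw.le_pow_mul_of_le hA₁ hp (Nat.le_succ s) hs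
  rw [Nat.succ_eq_add_one, Nat.add_sub_cancel_left, pow_one] at h1
  have h2 : p.choose (s + 1) ≤ p * p.choose s := by
    calc p.choose (s + 1) ≤ p.choose (s + 1) * (s + 1) := Nat.le_mul_of_pos_right _ (by omega)
      _ = p.choose s * (p - s) := Nat.choose_succ_right_eq p s
      _ ≤ p.choose s * p := by gcongr; omega
      _ = _ := mul_comm _ _
  have h3 : (p.choose (s + 1) : ℝ) ≤ p * p.choose s := by exact_mod_cast h2
  have h4 : (0 : ℝ) < p.choose s := by exact_mod_cast Nat.choose_pos hs.le
  have h5 : (0 : ℝ) < p.choose (s + 1) := by exact_mod_cast Nat.choose_pos hs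
  have h6 := hw.pos hA₁ hp (s + 1) hs
  have h7 : 0 ≤ A₁⁻¹ * Real.exp (A₃ * Real.log p) * w (s + 1) := by positivity
  rw [div_le_iff₀ h4]
  refine h1.trans ?_
  calc _ = A₁⁻¹ * Real.exp (A₃ * Real.log p) * w (s + 1) * 1 := (mul_one _).symm
    _ ≤ A₁⁻¹ * Real.exp (A₃ * Real.log p) * w (s + 1) * (p * p.choose s / p.choose (s + 1)) := by
        gcongr
        exact (one_le_div h5).2 h3
    _ = _ := by ring

theorem Admissible.lam_le_mul (h : Admissible A₁ A₂ A₃ A₄ X lam w) :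
    lam ≤ 4 * colNorm X * √(Real.log p) := by
  have := h.lam_le
  rw [lamBar] at this
  linarith

/-- The level is (32 + A₃)‖X‖√(log p): the 32 makes it at least 8λ. Its Gaussian decay
p^(-(32+A₃)²/4) beats the polynomial losses: p^(A₃+3) for the prior odds, p² from λ/(‖X‖√(log p)) ≥
p⁻², and the target p⁻², which leaves 1/p after a union over columns. -/
theorem Admissible.spike_slab_condition (h : Admissible A₁ A₂ A₃ A₄ X lam w) (hA₃ : 0 < A₃)
    (hp : LargeDim A₁ A₂ A₃ A₄ p) :
    (A₁⁻¹ * Real.exp (A₃ * Real.log p) * p + 1) * Real.exp (-(((32 + A₃) * colNorm X *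
        √(Real.log p)) ^ 2 / (4 * colNorm X ^ 2)))
      ≤ Real.exp (-(2 * Real.log p)) *
        (lam / (colNorm X * √(Real.log p)) * Real.exp (-(9 / 2))) := by
  have hX := h.colNorm_pos
  have hL := hp.one_le_log
  have hp0 : (0 : ℝ) < p := hp.p_pos
  have hpexp : (p : ℝ) = Real.exp (Real.log p) := (Real.exp_log hp0).symm
  have hp1 : (1 : ℝ) ≤ p := by exact_mod_cast hp.p_pos
  set L := Real.log p
  have hs : √L ^ 2 = L := Real.sq_sqrt (by linarith)
  have hs0 : 0 < √L := Real.sqrt_pos.2 (by linarith)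
  have h1 : A₁⁻¹ * Real.exp (A₃ * L) * p + 1 ≤ Real.exp ((A₃ + 3) * L) := by
    have h2 : 1 ≤ A₁⁻¹ * Real.exp (A₃ * L) * p := one_le_mul_of_one_le_of_one_le hp.lower hp1
    have h3 : 2 ≤ Real.exp L := by have := Real.add_one_le_exp L; linarith
    calc _ ≤ 2 * (A₁⁻¹ * Real.exp (A₃ * L) * p) := by linarith
      _ ≤ Real.exp L * (Real.exp L * Real.exp (A₃ * L) * Real.exp L) := by
          rw [← hpexp]
          have := hp.inv
          rw [← hpexp] at this h3
          gcongr
      _ = _ := by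
          rw [← Real.exp_add, ← Real.exp_add, ← Real.exp_add]
          congr 1
          ring
  have h2 : ((32 + A₃) * colNorm X * √L) ^ 2 / (4 * colNorm X ^ 2) = (32 + A₃) ^ 2 / 4 * L := by
    rw [mul_pow, hs]
    field_simp
  have h3 : Real.exp (-(2 * L)) ≤ lam / (colNorm X * √L) := by
    have h4 : √L ≤ Real.exp L := by
      have := Real.add_one_le_exp L
      nlinarith
    have h5 := h.le_lam
    rw [div_le_iff₀ hp0] at h5
    rw [le_div_iff₀ (by positivity)]
    calc Real.exp (-(2 * L)) * (colNorm X * √L)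
        ≤ Real.exp (-(2 * L)) * (lam * p * Real.exp L) := by
          have := h.lam_pos
          gcongr
      _ = lam * (Real.exp (-(2 * L)) * Real.exp L * Real.exp L) := by
          rw [hpexp]; simp only [L]; ring_nf
      _ = lam := by
          rw [← Real.exp_add, ← Real.exp_add, show -(2 * L) + L + L = 0 by ring, Real.exp_zero,
            mul_one]
  calc _ ≤ Real.exp ((A₃ + 3) * L) * Real.exp (-((32 + A₃) ^ 2 / 4 * L)) := by
        rw [h2]; gcongr
    _ ≤ Real.exp (-(2 * L)) * (Real.exp (-(2 * L)) * Real.exp (-(9 / 2))) := by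
        rw [← Real.exp_add, ← Real.exp_add, ← Real.exp_add]
        refine Real.exp_le_exp.2 ?_
        nlinarith [mul_nonneg hA₃.le (by linarith : 0 ≤ L),
          mul_nonneg (sq_nonneg A₃) (by linarith : 0 ≤ L)]
    _ ≤ _ := by gcongr

/-- Whatever the data, all correlations between residuals and columns are small under the
posterior. -/
theorem Admissible.posterior_iUnion_residual_le (h : Admissible A₁ A₂ A₃ A₄ X lam w)
    (hA₁ : 0 < A₁) (hA₃ : 0 < A₃) (hp : LargeDim A₁ A₂ A₃ A₄ p)
    (hρ : ∀ i, 0 < lqNorm 2 (Xᵀ i)) (y : Fin n → ℝ) :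
    posterior X (prior p w lam) y (⋃ i, {β |
      (32 + A₃) * colNorm X * √(Real.log p) < |Xᵀ i ⬝ᵥ (y - X *ᵥ β)|})
      ≤ ENNReal.ofReal (1 / p) := by
  have hX := h.colNorm_pos
  have hL := hp.one_le_log
  have hp0 : (0 : ℝ) < p := hp.p_pos
  have hpn : 0 < p := by exact_mod_cast hp0
  have hl := h.lam_le_mul
  have hs : 1 ≤ √(Real.log p) := Real.one_le_sqrt.2 hL
  have hle : ∀ i : Fin p, posterior X (prior p w lam) y {β |
      (32 + A₃) * colNorm X * √(Real.log p) < |Xᵀ i ⬝ᵥ (y - X *ᵥ β)|}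
      ≤ ENNReal.ofReal (Real.exp (-(2 * Real.log p))) := fun i =>
    posterior_residual_le X y i h.lam_pos (hρ i) hs hl
      (by
        have : 0 ≤ A₃ * colNorm X * √(Real.log p) := by positivity
        linarith)
      (by positivity) (Real.exp_pos _).le
      (h.spike_slab_condition hA₃ hp) (h.dimensionPrior.pos hA₁ hpn)
      fun s hs => h.dimensionPrior.div_choose_le hA₁ hpn hs
  calc _ ≤ ∑' i : Fin p, _ := measure_iUnion_le _
    _ = ∑ i : Fin p, _ := tsum_fintype _
    _ ≤ ∑ _i : Fin p, ENNReal.ofReal (Real.exp (-(2 * Real.log p))) :=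
        Finset.sum_le_sum fun i _ => hle i
    _ = ENNReal.ofReal (1 / p) := by
        rw [Finset.sum_const, Finset.card_univ, Fintype.card_fin, nsmul_eq_mul,
          ← ENNReal.ofReal_natCast, ← ENNReal.ofReal_mul hp0.le, neg_eq_neg_one_mul, ← mul_assoc,
          mul_comm _ (Real.log p), Real.exp_mul, Real.exp_log hp0]
        congr 1
        rw [show (-1 * 2 : ℝ) = ((-2 : ℤ) : ℝ) by norm_num, Real.rpow_intCast]
        field_simp

/-- A factor that suffices in the radius for recovery in supremum norm. -/
def supConst (A₃ A₄ c₀ d₀ : ℝ) : ℝ :=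
  (32 + A₃) / c₀ ^ 2 + 4 / c₀ + max d₀ 0 * recoveryConst A₃ A₄ / c₀ ^ 5

theorem Admissible.lqNorm_one_le_of_notMem (h : Admissible A₁ A₂ A₃ A₄ X lam w) (hA₃ : 0 < A₃)
    (hA₄ : 0 < A₄) {S : Finset (Fin p)} {c₀ : ℝ} (hc₀ : 0 < c₀)
    (hφ : ENNReal.ofReal c₀ ≤ compat X S) (hψ : ENNReal.ofReal c₀ ≤ psiBar A₄ X lam S)
    {v : Fin p → ℝ} (hv : ¬ ENNReal.ofReal (recoveryConst A₃ A₄) / psiBar A₄ X lam S ^ 2 *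
      (ENNReal.ofReal (S.card * √(Real.log p)) /
        (ENNReal.ofReal (colNorm X) * compat X S ^ 2)) < ENNReal.ofReal (lqNorm 1 v)) :
    lqNorm 1 v ≤ recoveryConst A₃ A₄ / c₀ ^ 2 * (S.card * √(Real.log p) / (colNorm X * c₀ ^ 2)) := by
  have hX := h.colNorm_pos
  have hC := (le_recoveryConst hA₃ hA₄).2.2.2.2
  have h1 : ENNReal.ofReal (lqNorm 1 v) ≤ ENNReal.ofReal (recoveryConst A₃ A₄) /
      ENNReal.ofReal c₀ ^ 2 * (ENNReal.ofReal (S.card * √(Real.log p)) /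
        (ENNReal.ofReal (colNorm X) * ENNReal.ofReal c₀ ^ 2)) := by
    refine (not_lt.1 hv).trans ?_
    gcongr
  rw [← ENNReal.ofReal_pow hc₀.le, ← ENNReal.ofReal_mul hX.le,
    ← ENNReal.ofReal_div_of_pos (by positivity), ← ENNReal.ofReal_div_of_pos (by positivity),
    ← ENNReal.ofReal_mul (by positivity)] at h1
  exact (ENNReal.ofReal_le_ofReal_iff (by positivity)).1 h1

theorem Admissible.recovery_sup (h : Admissible A₁ A₂ A₃ A₄ X lam w) (hA₁ : 0 < A₁)
    (hA₂ : 0 < A₂) (hA₃ : 0 < A₃) (hA₄ : 0 < A₄) (hp : LargeDim A₁ A₂ A₃ A₄ p) {c₀ d₀ M : ℝ}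
    (hc₀ : 0 < c₀) (hM : supConst A₃ A₄ c₀ d₀ ≤ M) {β₀ : Fin p → ℝ}
    (hφ : ENNReal.ofReal c₀ ≤ compat X (supp β₀))
    (hψ : ENNReal.ofReal c₀ ≤ psiTilde A₄ X lam (supp β₀))
    (hmc : ((supp β₀).card : ℝ≥0∞) ≤ ENNReal.ofReal d₀ * (mutualCoherence X)⁻¹) :
    expectedPosterior X (prior p w lam) β₀ {β |
      M * √(Real.log p) / colNorm X < lqNorm ∞ (β - β₀)}
      ≤ ENNReal.ofReal (2 / p + recoveryRate A₄ p) := by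
  have hX := h.colNorm_pos
  have hL := hp.one_le_log
  have hp0 : (0 : ℝ) < p := hp.p_pos
  have hC := (le_recoveryConst hA₃ hA₄).2.2.2.2
  have hM0 : 0 ≤ M := le_trans (by unfold supConst; positivity) hM
  rcases Nat.eq_zero_or_pos (supp β₀).card with hs₀ | hs₀
  · refine (h.expectedPosterior_le_of_zero hA₁ hA₂ hA₄ hp hs₀ ?_).trans
      (ENNReal.ofReal_le_ofReal ((le_recoveryRate A₄ p).2.2.trans
        (le_add_of_nonneg_left (by positivity))))
    rintro β hβ rfl
    have : M * √(Real.log p) / colNorm X < 0 := by simpa [lqNorm] using hβ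
    exact absurd this (not_lt.2 (by positivity))
  have hψ' : ENNReal.ofReal c₀ ≤ psiBar A₄ X lam (supp β₀) :=
    hψ.trans (sparseSingular_le_unifCompat hX _)
  -- One-sparse test vectors in ψ̃ show that all columns have comparable norms.
  have hcol : ∀ i, c₀ * colNorm X ≤ lqNorm 2 (Xᵀ i) := by
    intro i
    have h1 := sparseSingular_bound hX hψ (v := Pi.single i 1)
      (by simpa [supp_single] using one_le_psiDim A₄ lam hs₀)
    have h2 : lqNorm 2 (Pi.single i (1 : ℝ) : Fin p → ℝ) ^ 2 = 1 := by
      rw [lqNorm_two_sq]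
      simp
    have h3 : lqNorm 2 (Pi.single i (1 : ℝ) : Fin p → ℝ) = 1 :=
      (pow_eq_one_iff_of_nonneg (lqNorm_nonneg 2 _) two_ne_zero).1 h2
    rwa [h3, mul_one, lqNorm_mulVec_single] at h1
  have hρ : ∀ i, 0 < lqNorm 2 (Xᵀ i) := fun i => (mul_pos hc₀ hX).trans_le (hcol i)
  have hμ := mul_toReal_mutualCoherence_le hmc
  obtain ⟨T, hT, hTp, hTle⟩ := exists_noise_event X hp.three_le β₀
  set Q := prior p w lam
  set B₁ := {β : Fin p → ℝ | ENNReal.ofReal (recoveryConst A₃ A₄) / psiBar A₄ X lam (supp β₀) ^ 2 *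
      (ENNReal.ofReal ((supp β₀).card * √(Real.log p)) /
        (ENNReal.ofReal (colNorm X) * compat X (supp β₀) ^ 2))
        < ENNReal.ofReal (lqNorm 1 (β - β₀))} with hB₁
  set B := {β : Fin p → ℝ | M * √(Real.log p) / colNorm X < lqNorm ∞ (β - β₀)}
  -- This exceptional set depends on the data, so its posterior mass is bounded for each y before
  -- integrating; only T and the ℓ¹ set enter through expectations.
  set R := fun y : Fin n → ℝ => ⋃ i, {β : Fin p → ℝ |
      (32 + A₃) * colNorm X * √(Real.log p) < |Xᵀ i ⬝ᵥ (y - X *ᵥ β)|}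
  have hsub : ∀ y ∈ T, B ⊆ R y ∪ B₁ := by
    intro y hy β hβ
    by_contra hcon
    rw [Set.mem_union, not_or, Set.mem_iUnion, not_exists] at hcon
    obtain ⟨hR, hβ₁⟩ := hcon
    obtain ⟨i, hi⟩ := exists_lt_of_lt_lqNorm_top (by positivity) hβ
    have h1 := h.lqNorm_one_le_of_notMem hA₃ hA₄ hc₀ hφ hψ' hβ₁
    have h2 : |Xᵀ i ⬝ᵥ (y - X *ᵥ β)| ≤ (32 + A₃) * colNorm X * √(Real.log p) := not_lt.1 (hR i)
    have h3 := abs_col_dotProduct_noise_le (by linarith) (hTle y hy) (hρ i)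
    have h4 := sq_mul_abs_le_residual hρ y β β₀ i
    have h5 := hcol i
    have h6 := hρ i
    set ρ := lqNorm 2 (Xᵀ i)
    set c := colNorm X
    set l := √(Real.log p)
    set μ := (mutualCoherence X).toReal
    set N := lqNorm 1 (β - β₀)
    have hl : 0 ≤ l := Real.sqrt_nonneg _
    have hμ0 : 0 ≤ μ := ENNReal.toReal_nonneg
    have h7 : |(β - β₀) i| ≤ (32 + A₃) * c * l / ρ ^ 2 + 4 * l / ρ + μ * c * N / ρ := by
      calc |(β - β₀) i| = ρ ^ 2 * |(β - β₀) i| / ρ ^ 2 := by field_simp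
        _ ≤ ((32 + A₃) * c * l + 4 * ρ * l + μ * (ρ * c) * N) / ρ ^ 2 := by
            gcongr
            linarith
        _ = _ := by field_simp
    have h8 : (32 + A₃) * c * l / ρ ^ 2 ≤ (32 + A₃) * c * l / (c₀ * c) ^ 2 := by gcongr
    have h9 : 4 * l / ρ ≤ 4 * l / (c₀ * c) := by gcongr
    -- The coherence term: the ℓ¹ radius is proportional to |S₀|, and |S₀| times the coherence is
    -- bounded. The fifth power collects c₀⁴ from the ℓ¹ radius and c₀ from the column norm.
    have h10 : μ * c * N / ρ ≤ max d₀ 0 * recoveryConst A₃ A₄ / c₀ ^ 5 * l / c := by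
      calc μ * c * N / ρ ≤ μ * c * (recoveryConst A₃ A₄ / c₀ ^ 2 *
            ((supp β₀).card * l / (c * c₀ ^ 2))) / (c₀ * c) := by gcongr
        _ = (supp β₀).card * μ * (recoveryConst A₃ A₄ / c₀ ^ 5 * l / c) := by field_simp
        _ ≤ max d₀ 0 * (recoveryConst A₃ A₄ / c₀ ^ 5 * l / c) := by gcongr
        _ = _ := by ring
    have h11 : supConst A₃ A₄ c₀ d₀ * l / c ≤ M * l / c := by gcongr
    have h12 : supConst A₃ A₄ c₀ d₀ * l / c = (32 + A₃) * c * l / (c₀ * c) ^ 2 +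
        4 * l / (c₀ * c) + max d₀ 0 * recoveryConst A₃ A₄ / c₀ ^ 5 * l / c := by
      unfold supConst
      field_simp
    linarith
  have hpt : ∀ y, posterior X Q y B
      ≤ (Tᶜ.indicator 1 y + ENNReal.ofReal (1 / p)) + posterior X Q y B₁ := by
    intro y
    by_cases hy : y ∈ T
    · refine (measure_mono (hsub y hy)).trans ((measure_union_le _ _).trans ?_)
      gcongr
      exact (h.posterior_iUnion_residual_le hA₁ hA₃ hp hρ y).trans le_add_self
    · rw [Set.indicator_of_mem (Set.mem_compl hy), add_assoc]
      exact (posterior_le_one X Q y B).trans le_self_add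
  calc expectedPosterior X Q β₀ B
      ≤ ∫⁻ y, (Tᶜ.indicator 1 y + ENNReal.ofReal (1 / p)) + posterior X Q y B₁
          ∂dataLaw X β₀ := lintegral_mono hpt
    _ = dataLaw X β₀ Tᶜ + ENNReal.ofReal (1 / p) + expectedPosterior X Q β₀ B₁ := by
        rw [lintegral_add_right _ (measurable_posterior B₁), lintegral_add_right _ measurable_const,
          lintegral_indicator_one hT.compl, lintegral_const, measure_univ, mul_one]
        rfl
    _ ≤ ENNReal.ofReal (1 / p) + ENNReal.ofReal (1 / p) + ENNReal.ofReal (recoveryRate A₄ p) := by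
        gcongr
        exact h.recovery_l1 hA₁ hA₂ hA₃ hA₄ hp le_rfl β₀
    _ = _ := by
        have : 0 ≤ recoveryRate A₄ p := by unfold recoveryRate; positivity
        rw [← ENNReal.ofReal_add (by positivity) (by positivity),
          ← ENNReal.ofReal_add (by positivity) this]
        congr 2
        ring

end Supremum

/-! ### Sequences of problems -/

theorem tendsto_recoveryRate {A₄ : ℝ} (hA₄ : 0 < A₄) :
    Tendsto (fun p : ℕ => 2 / (p : ℝ) + recoveryRate A₄ p) atTop (𝓝 0) := by
  have hexp : ∀ a : ℝ, a < 0 → Tendsto (fun p : ℕ => Real.exp (a * Real.log p)) atTop (𝓝 0) :=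
    fun a ha => Real.tendsto_exp_atBot.comp (tendsto_log_natCast.const_mul_atTop_of_neg ha)
  have h1 := (((tendsto_const_div_atTop_nhds_zero_nat 4).add
    (hexp (-(1 / 2)) (by norm_num))).add ((hexp (-(9 / 10 * A₄)) (by linarith)).const_mul 4))
  simpa [recoveryRate] using (tendsto_const_div_atTop_nhds_zero_nat 2).add h1

theorem Experiments.admissible {A₁ A₂ A₃ A₄ : ℝ} (E : Experiments A₁ A₂ A₃ A₄) (k : ℕ) :
    Admissible A₁ A₂ A₃ A₄ (E.X k) (E.lam k) (E.w k) :=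
  ⟨E.lam_pos k, E.le_lam k, E.lam_le k, E.dimensionPrior k⟩

/-- A bound for large dimensions by the recovery rate gives convergence to zero. -/
theorem Experiments.tendsto_zero {A₁ A₂ A₃ A₄ : ℝ} (hA₁ : 0 < A₁) (hA₃ : 0 < A₃) (hA₄ : 0 < A₄)
    (E : Experiments A₁ A₂ A₃ A₄) {r : ℕ → ℝ≥0∞} (hr : ∀ k, LargeDim A₁ A₂ A₃ A₄ (E.p k) →
      r k ≤ ENNReal.ofReal (2 / E.p k + recoveryRate A₄ (E.p k))) :
    Tendsto r atTop (𝓝 0) := by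
  have h1 := ENNReal.tendsto_ofReal ((tendsto_recoveryRate hA₄).comp E.p_tendsto)
  rw [ENNReal.ofReal_zero] at h1
  refine tendsto_of_tendsto_of_tendsto_of_le_of_le' tendsto_const_nhds h1
    (Eventually.of_forall fun _ => zero_le) ?_
  filter_upwards [E.p_tendsto.eventually (eventually_largeDim hA₁ hA₃ hA₄)] with k hk
  exact hr k hk

theorem ofReal_recoveryRate_le (A₄ : ℝ) (p : ℕ) :
    ENNReal.ofReal (recoveryRate A₄ p) ≤ ENNReal.ofReal (2 / p + recoveryRate A₄ p) :=
  ENNReal.ofReal_le_ofReal (le_add_of_nonneg_left (by positivity))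

end SparseRegression

end

theorem theorem2 (A₁ A₂ A₃ A₄ : ℝ) (hA₁ : 0 < A₁) (hA₂ : 0 < A₂) (hA₃ : 0 < A₃) (hA₄ : 0 < A₄) :
    (∃ M₀ : ℝ, ∀ M : ℝ, M₀ ≤ M → ∀ E : SparseRegression.Experiments A₁ A₂ A₃ A₄,
      Tendsto (fun k => ⨆ β₀ : Fin (E.p k) → ℝ, E.risk k β₀ {β |
          ENNReal.ofReal M / E.psiBar k (SparseRegression.supp β₀) *
            (ENNReal.ofReal √((SparseRegression.supp β₀).card * E.logp k) /
              E.phi k (SparseRegression.supp β₀)) <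
          ENNReal.ofReal (SparseRegression.lqNorm 2 (E.X k *ᵥ (β - β₀)))})
        atTop (𝓝 0) ∧
      Tendsto (fun k => ⨆ β₀ : Fin (E.p k) → ℝ, E.risk k β₀ {β |
          ENNReal.ofReal M / E.psiBar k (SparseRegression.supp β₀) ^ 2 *
            (ENNReal.ofReal ((SparseRegression.supp β₀).card * √(E.logp k)) /
              (ENNReal.ofReal (SparseRegression.colNorm (E.X k)) *
                E.phi k (SparseRegression.supp β₀) ^ 2)) <
          ENNReal.ofReal (SparseRegression.lqNorm 1 (β - β₀))})
        atTop (𝓝 0) ∧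
      Tendsto (fun k => ⨆ β₀ : Fin (E.p k) → ℝ, E.risk k β₀ {β |
          ENNReal.ofReal M / E.psiTilde k (SparseRegression.supp β₀) ^ 2 *
            (ENNReal.ofReal √((SparseRegression.supp β₀).card * E.logp k) /
              (ENNReal.ofReal (SparseRegression.colNorm (E.X k)) *
                E.phi k (SparseRegression.supp β₀))) <
          ENNReal.ofReal (SparseRegression.lqNorm 2 (β - β₀))})
        atTop (𝓝 0)) ∧
    (∀ c₀ : ℝ, 0 < c₀ → ∀ d₀ : ℝ, d₀ < c₀ ^ 2 * (1 + 2 / A₄)⁻¹ / 8 →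
      ∃ M₀ : ℝ, ∀ M : ℝ, M₀ ≤ M → ∀ (E : SparseRegression.Experiments A₁ A₂ A₃ A₄) (s : ℕ → ℝ),
        Tendsto (fun k => E.lam k * s k * √(E.logp k) / SparseRegression.colNorm (E.X k))
          atTop (𝓝 0) →
        Tendsto (fun k => ⨆ (β₀ : Fin (E.p k) → ℝ)
            (_ : ENNReal.ofReal c₀ ≤ E.phi k (SparseRegression.supp β₀))
            (_ : ENNReal.ofReal c₀ ≤ E.psiTilde k (SparseRegression.supp β₀))
            (_ : ((SparseRegression.supp β₀).card : ℝ) ≤ s k)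
            (_ : ((SparseRegression.supp β₀).card : ℝ≥0∞) ≤
              ENNReal.ofReal d₀ * (SparseRegression.mutualCoherence (E.X k))⁻¹),
            E.risk k β₀ {β |
              M * √(E.logp k) / SparseRegression.colNorm (E.X k) <
              SparseRegression.lqNorm ∞ (β - β₀)})
          atTop (𝓝 0)) := by
  -- The bounds are uniform in β₀ and depend on the problem only through p and A₄, so the suprema
  -- inherit them and p → ∞ concludes.
  refine ⟨⟨SparseRegression.recoveryConst A₃ A₄, fun M hM E => ⟨?_, ?_, ?_⟩⟩,
    fun c₀ hc₀ d₀ _ => ⟨SparseRegression.supConst A₃ A₄ c₀ d₀, fun M hM E s _ => ?_⟩⟩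
  · exact E.tendsto_zero hA₁ hA₃ hA₄ fun k hk => iSup_le fun β₀ =>
      ((E.admissible k).recovery_prediction hA₁ hA₂ hA₃ hA₄ hk hM β₀).trans
        (SparseRegression.ofReal_recoveryRate_le A₄ _)
  · exact E.tendsto_zero hA₁ hA₃ hA₄ fun k hk => iSup_le fun β₀ =>
      ((E.admissible k).recovery_l1 hA₁ hA₂ hA₃ hA₄ hk hM β₀).trans
        (SparseRegression.ofReal_recoveryRate_le A₄ _)
  · exact E.tendsto_zero hA₁ hA₃ hA₄ fun k hk => iSup_le fun β₀ =>
      ((E.admissible k).recovery_l2 hA₁ hA₂ hA₃ hA₄ hk hM β₀).trans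
        (SparseRegression.ofReal_recoveryRate_le A₄ _)
  · exact E.tendsto_zero hA₁ hA₃ hA₄ fun k hk => iSup_le fun β₀ => iSup_le fun hφ =>
      iSup_le fun hψ => iSup_le fun _ => iSup_le fun hmc =>
        (E.admissible k).recovery_sup hA₁ hA₂ hA₃ hA₄ hk hc₀ hM hφ hψ hmc
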